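/- **Setting.** Let $n\ge 3$, $\tau>0$, $c>0$, $b,k\in\mathbb R$, and let $g$ be a memory kernel on $(0,\infty)$ such that: $g\in W^{1,1}(0,\infty)$ is differentiable with $g'$ absolutely continuous on compact subintervals of $(0,\infty)$; $g\ge 0$ and $0<\int_0^\infty g(s)\,ds<c^2$; there is $\zeta>0$ with $g'(s)\le-\zeta g(s)$ for all $s>0$; and $g''\ge 0$ almost everywhere. Put $c_g^2=c^2-\int_0^\infty g(s)\,ds$ and $\|\eta\|_{L^2,-g'}^2=\int_0^\infty(-g'(s))\|\eta(s)\|_{L^2(\mathbb R^n)}^2\,ds$. For an integer $m\ge1$ let $\mathcal H^{m-1}$ be the space of $\Psi=(\psi,v,w,\eta)$ with $$\|\Psi\|_{\mathcal H^{m-1}}^2=\|\nabla\psi\|_{H^{m-1}}^2+\|v\|_{H^m}^2+\|w\|_{H^{m-1}}^2+\int_0^\infty(-g'(s))\|\nabla\eta(s)\|_{H^{m-1}}^2\,ds<\infty .$$ For an integer $m>n/2+1$ and $T>0$, a solution on $[0,T]$ with initial value $\Psi_0=\Psi(0)\in\mathcal H^{m-1}$ is a function $\Psi=(\psi,v,w,\eta)\in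 C([0,T];\mathcal H^{m-1})$ that satisfies, in the mild sense (that is, after integration over $[0,t]$ for every $t\in[0,T]$, in the sense of distributions in $x$ and $s$), $$\psi_t=v,\qquad v_t=w,\qquad \tau w_t=-w+c_g^2\Delta\psi+b\Delta v+\int_0^\infty g(s)\Delta\eta(s)\,ds+2\,(k\,v\,w+\nabla\psi\cdot\nabla v),\qquad \eta_t=v-\eta_s,\quad \eta|_{s=0}=0 .$$ Define $$\begin{aligned}\mathcal E^{(0)}[\Psi]={}&\|\nabla(\psi+\tau v)\|_{L^2}^2+\|v+\tau w\|_{L^2}^2+\|\nabla v\|_{L^2}^2+\|\nabla\eta\|_{L^2,-g'}^2+\|w\|_{L^2}^2\\&+\|\Delta(\psi+\tau v)\|_{L^2}^2+\|\nabla(v+\tau w)\|_{L^2}^2+\|\Delta v\|_{L^2}^2+\|\Delta\eta\|_{L^2,-g'}^2,\\ \mathcal D^{(0)}[\Psi]={}&\|\nabla v\|_{L^2}^2+\|\nabla\eta\|_{L^2,-g'}^2+\|\Delta(\psi+\tau v)\|_{L^2}^2+\|\nabla(v+\tau w)\|_{L^2}^2+\|\Delta v\|_{L^2}^2+\|\Delta\eta\|_{L^2,-g'}^2+\|w\|_{L^2}^2,\end{aligned}$$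 $$\|\Psi\|_{\mathcal E_0(t)}^2=\sup_{0\le\sigma\le t}\mathcal E^{(0)}[\Psi](\sigma),\qquad \|\Psi\|_{\mathcal D_0(t)}^2=\int_0^t\mathcal D^{(0)}[\Psi](\sigma)\,d\sigma,\qquad \|\Psi_0\|_{\mathcal E_0(0)}^2=\mathcal E^{(0)}[\Psi](0),$$ $$\begin{aligned}\Lambda[\Psi](t)=\sup_{0\le\sigma\le t}\Big(&\|v(\sigma)\|_{W^{1,\infty}}+\|w(\sigma)\|_{L^\infty}+\|\nabla\psi(\sigma)\|_{L^\infty}+\|\nabla\psi(\sigma)\|_{H^{\frac{n-2}2}}+\|\nabla^2\psi(\sigma)\|_{H^{\frac{n-2}2}}\\&+\|v(\sigma)\|_{H^{\frac{n-2}2}}+\|\nabla v(\sigma)\|_{H^{\frac{n-2}2}}+\|w(\sigma)\|_{H^{\frac{n-2}2}}\Big).\end{aligned}$$ **Theorem.** Let $b>\tau c^2>\tau c_g^2$ and $n\ge3$. There is a constant $C>0$, depending only on $n,\tau,b,c,k$ and $g$, such that for every integer $m>n/2+1$, every $T>0$, every solution $\Psi\in C([0,T];\mathcal H^{m-1})$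 of the above system, and every $t\in[0,T]$, $$\|\Psi\|_{\mathcal E_0(t)}^2+\|\Psi\|_{\mathcal D_0(t)}^2\le C\left(\|\Psi_0\|_{\mathcal E_0(0)}^2+\Lambda[\Psi](t)\,\|\Psi\|_{\mathcal D_0(t)}^2\right).$$ -/

import Mathlib

open MeasureTheory Set Filter Topology
open scoped ENNReal NNReal ContDiff FourierTransform Laplacian

noncomputable section

namespace JMGT

/-- The space `ℝⁿ` with its Euclidean norm. -/
abbrev Rn (n : ℕ) : Type := EuclideanSpace ℝ (Fin n)

variable {n : ℕ}

/-! ### Weak derivatives and Sobolev spaces on `ℝⁿ` -/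

/-- Smooth compactly supported real test functions. -/
def IsTestFunction (φ : Rn n → ℝ) : Prop :=
  ContDiff ℝ ∞ φ ∧ HasCompactSupport φ

/-- `f'` is the weak partial derivative `∂ᵢ f`. -/
def IsWeakPartial (i : Fin n) (f f' : Rn n → ℝ) : Prop :=
  LocallyIntegrable f volume ∧ LocallyIntegrable f' volume ∧
    ∀ φ : Rn n → ℝ, IsTestFunction φ →
      ∫ x, f x * fderiv ℝ φ x (EuclideanSpace.single i 1) = -∫ x, f' x * φ x

open Classical in
/-- A representative of the weak partial derivative `∂ᵢ f`, which is unique up to null sets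
(the zero function if there is no weak derivative). -/
def weakPartial (i : Fin n) (f : Rn n → ℝ) : Rn n → ℝ :=
  if h : ∃ f', IsWeakPartial i f f' then h.choose else 0

/-- The weak gradient `∇ f`. -/
def weakGrad (f : Rn n → ℝ) : Rn n → Rn n :=
  fun x => WithLp.toLp 2 fun i => weakPartial i f x

/-- The weak Laplacian `Δ f = ∑ᵢ ∂ᵢ ∂ᵢ f`. -/
def weakLaplacian (f : Rn n → ℝ) : Rn n → ℝ :=
  fun x => ∑ i, weakPartial i (weakPartial i f) x

/-- The Sobolev space `Hʲ(ℝⁿ)` of integer order. -/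
def MemH : ℕ → (Rn n → ℝ) → Prop
  | 0, f => MemLp f 2 volume
  | j + 1, f => MemLp f 2 volume ∧
      ∀ i, (∃ f', IsWeakPartial i f f') ∧ MemH j (weakPartial i f)

/-- The square of the norm of `Hʲ(ℝⁿ)` (the sum of the squares of the `L²` norms of the weak
derivatives up to order `j`). -/
def normHSq : ℕ → (Rn n → ℝ) → ℝ≥0∞
  | 0, f => eLpNorm f 2 volume ^ 2
  | j + 1, f => eLpNorm f 2 volume ^ 2 + ∑ i, normHSq j (weakPartial i f)

/-- `f` has a weak gradient, and `∇ f ∈ Hʲ(ℝⁿ)`; that is, `∇ f, …, ∇^(j+1) f ∈ L²(ℝⁿ)`. -/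
def GradMemH (j : ℕ) (f : Rn n → ℝ) : Prop :=
  ∀ i, (∃ f', IsWeakPartial i f f') ∧ MemH j (weakPartial i f)

/-- The square of `‖∇ f‖` in `Hʲ(ℝⁿ)`. -/
def gradNormHSq (j : ℕ) (f : Rn n → ℝ) : ℝ≥0∞ :=
  ∑ i, normHSq j (weakPartial i f)

open Classical in
/-- The square of the norm of the Sobolev space `Hˢ(ℝⁿ)` of real order `s ≥ 0`,
`∫ (1 + |2πξ|²)ˢ |f̂(ξ)|² dξ`, where `f̂` is the Fourier transform of `f ∈ L²(ℝⁿ)` with the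
kernel `exp(-2πi x·ξ)`; it is `∞` if `f` is not in `L²(ℝⁿ)`. -/
def normHsSq (s : ℝ) (f : Rn n → ℝ) : ℝ≥0∞ :=
  if h : MemLp (fun x => (f x : ℂ)) 2 (volume : Measure (Rn n)) then
    ∫⁻ ξ, ENNReal.ofReal ((1 + (2 * Real.pi * ‖ξ‖) ^ 2) ^ s) *
      ‖(𝓕 (h.toLp (fun x => (f x : ℂ))) : Lp ℂ 2 (volume : Measure (Rn n))) ξ‖ₑ ^ 2
  else ⊤

/-- The norm of `Hˢ(ℝⁿ)`. -/
def normHs (s : ℝ) (f : Rn n → ℝ) : ℝ≥0∞ :=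
  normHsSq s f ^ (1 / 2 : ℝ)

/-- `‖∇ f‖` in `Hˢ(ℝⁿ)`. -/
def gradNormHs (s : ℝ) (f : Rn n → ℝ) : ℝ≥0∞ :=
  (∑ i, normHsSq s (weakPartial i f)) ^ (1 / 2 : ℝ)

/-- `‖∇² f‖` in `Hˢ(ℝⁿ)`. -/
def hessNormHs (s : ℝ) (f : Rn n → ℝ) : ℝ≥0∞ :=
  (∑ i, ∑ l, normHsSq s (weakPartial l (weakPartial i f))) ^ (1 / 2 : ℝ)

/-! ### The memory kernel -/

/-- The assumptions on the memory kernel `g` on `(0, ∞)`. -/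
structure IsMemoryKernel (c : ℝ) (g : ℝ → ℝ) : Prop where
  differentiable : ∀ s, 0 < s → DifferentiableAt ℝ g s
  integrable : IntegrableOn g (Ioi 0)
  integrable_deriv : IntegrableOn (deriv g) (Ioi 0)
  absCont_deriv : ∀ p q, 0 < p → p ≤ q → AbsolutelyContinuousOnInterval (deriv g) p q
  nonneg : ∀ s, 0 < s → 0 ≤ g s
  integral_pos : 0 < ∫ s in Ioi 0, g s
  integral_lt : ∫ s in Ioi 0, g s < c ^ 2
  decay : ∃ ζ : ℝ, 0 < ζ ∧ ∀ s, 0 < s → deriv g s ≤ -ζ * g s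
  second_deriv_nonneg : ∀ᵐ s ∂volume.restrict (Ioi (0 : ℝ)), 0 ≤ deriv (deriv g) s

/-- The square of the modified speed, `c_g² = c² - ∫₀^∞ g(s) ds`. -/
def cgSq (c : ℝ) (g : ℝ → ℝ) : ℝ := c ^ 2 - ∫ s in Ioi 0, g s

/-- The measure `-g'(s) ds` on `(0, ∞)`. -/
def memMeasure (g : ℝ → ℝ) : Measure ℝ :=
  (volume.restrict (Ioi 0)).withDensity fun s => ENNReal.ofReal (-deriv g s)

/-! ### States and solutions -/

/-- A state `Ψ = (ψ, v, w, η)`, where `η` also depends on the history variable `s`. -/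
@[ext]
structure State (n : ℕ) where
  ψ : Rn n → ℝ
  v : Rn n → ℝ
  w : Rn n → ℝ
  η : ℝ → Rn n → ℝ

/-- The difference of two states, componentwise. -/
def State.diff (Ψ Φ : State n) : State n where
  ψ := Ψ.ψ - Φ.ψ
  v := Ψ.v - Φ.v
  w := Ψ.w - Φ.w
  η := Ψ.η - Φ.η

/-- The square of the norm of `∇ η` in `L²((0, ∞), -g'(s) ds; Hʲ(ℝⁿ))`. -/
def memNormSq (g : ℝ → ℝ) (j : ℕ) (η : ℝ → Rn n → ℝ) : ℝ≥0∞ :=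
  ∫⁻ s, gradNormHSq j (η s) ∂memMeasure g

/-- The space of histories `η` with `∇ η ∈ L²((0, ∞), -g'(s) ds; Hʲ(ℝⁿ))`. -/
def MemHistory (g : ℝ → ℝ) (j : ℕ) (η : ℝ → Rn n → ℝ) : Prop :=
  AEStronglyMeasurable (fun p : ℝ × Rn n => η p.1 p.2) ((memMeasure g).prod volume) ∧
    (∀ᵐ s ∂memMeasure g, GradMemH j (η s)) ∧ memNormSq g j η < ⊤

/-- The phase space `𝓗ʲ`: `∇ ψ ∈ Hʲ`, `v ∈ Hʲ⁺¹`, `w ∈ Hʲ`, and `∇ η` is square integrable with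
values in `Hʲ` for the weight `-g'`. -/
def MemPhase (g : ℝ → ℝ) (j : ℕ) (Ψ : State n) : Prop :=
  GradMemH j Ψ.ψ ∧ MemH (j + 1) Ψ.v ∧ MemH j Ψ.w ∧ MemHistory g j Ψ.η

/-- The square of the norm of the phase space `𝓗ʲ`. -/
def phaseNormSq (g : ℝ → ℝ) (j : ℕ) (Ψ : State n) : ℝ≥0∞ :=
  gradNormHSq j Ψ.ψ + normHSq (j + 1) Ψ.v + normHSq j Ψ.w + memNormSq g j Ψ.η

/-- `Ψ ∈ C([0,T]; 𝓗ʲ)` is a (mild) solution on `[0,T]` of the first-order system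
```
ψ_t = v,   v_t = w,
τ w_t = -w + c_g² Δψ + b Δv + ∫₀^∞ g(s) Δη(s) ds + 2 (k v w + ∇ψ·∇v),
η_t = v - η_s,   η|_{s=0} = 0,
```
with the initial value `Ψ 0`. Each equation is integrated over `[0,t]` and tested with `φ ∈ C_c^∞(ℝⁿ)`.
The last one is also tested with smooth functions `χ` of `s` that have compact support in `[0,∞)`
and need not vanish at `s = 0`: this is how the boundary condition at `s = 0` enters.
If `g` vanishes for large `s`, the histories are determined only where `g > 0`, and the support of
`χ` in `(0,∞)` is restricted accordingly. -/
structure IsSolution (τ b c k : ℝ) (g : ℝ → ℝ) (j : ℕ) (T : ℝ) (Ψ : ℝ → State n) : Prop where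
  mem : ∀ t ∈ Icc 0 T, MemPhase g j (Ψ t)
  cont : ∀ t₀ ∈ Icc 0 T,
    Tendsto (fun t => phaseNormSq g j ((Ψ t).diff (Ψ t₀))) (𝓝[Icc 0 T] t₀) (𝓝 0)
  eq_ψ : ∀ t ∈ Icc 0 T, ∀ φ : Rn n → ℝ, IsTestFunction φ →
    ∫ x, (Ψ t).ψ x * φ x = (∫ x, (Ψ 0).ψ x * φ x) + ∫ σ in (0 : ℝ)..t, ∫ x, (Ψ σ).v x * φ x
  eq_v : ∀ t ∈ Icc 0 T, ∀ φ : Rn n → ℝ, IsTestFunction φ →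
    ∫ x, (Ψ t).v x * φ x = (∫ x, (Ψ 0).v x * φ x) + ∫ σ in (0 : ℝ)..t, ∫ x, (Ψ σ).w x * φ x
  eq_w : ∀ t ∈ Icc 0 T, ∀ φ : Rn n → ℝ, IsTestFunction φ →
    τ * ∫ x, (Ψ t).w x * φ x = τ * (∫ x, (Ψ 0).w x * φ x) +
      ∫ σ in (0 : ℝ)..t,
        (-(∫ x, (Ψ σ).w x * φ x)
          + cgSq c g * (∫ x, (Ψ σ).ψ x * (Δ φ) x)
          + b * (∫ x, (Ψ σ).v x * (Δ φ) x)
          + (∫ s in Ioi 0, g s * ∫ x, (Ψ σ).η s x * (Δ φ) x)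
          + ∫ x, 2 * (k * (Ψ σ).v x * (Ψ σ).w x
              + inner ℝ (weakGrad (Ψ σ).ψ x) (weakGrad (Ψ σ).v x)) * φ x)
  eq_η : ∀ t ∈ Icc 0 T, ∀ φ : Rn n → ℝ, IsTestFunction φ →
    ∀ χ : ℝ → ℝ, ContDiff ℝ ∞ χ → HasCompactSupport χ → (∀ s ∈ tsupport χ, 0 < s → 0 < g s) →
    ∫ s in Ioi 0, χ s * ∫ x, (Ψ t).η s x * φ x =
      (∫ s in Ioi 0, χ s * ∫ x, (Ψ 0).η s x * φ x) +
      ∫ σ in (0 : ℝ)..t,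
        ((∫ s in Ioi 0, χ s) * (∫ x, (Ψ σ).v x * φ x)
          + ∫ s in Ioi 0, deriv χ s * ∫ x, (Ψ σ).η s x * φ x)

/-! ### Energies -/

/-- `‖f‖²` in `L²(ℝⁿ)`, for scalar functions or vector fields. -/
def l2Sq {F : Type*} [NormedAddCommGroup F] (f : Rn n → F) : ℝ≥0∞ :=
  eLpNorm f 2 volume ^ 2

/-- The energy `𝓔⁽⁰⁾[Ψ]` of order zero. -/
def energyDensity (τ : ℝ) (g : ℝ → ℝ) (Ψ : State n) : ℝ≥0∞ :=
  l2Sq (weakGrad (Ψ.ψ + τ • Ψ.v)) + l2Sq (Ψ.v + τ • Ψ.w) + l2Sq (weakGrad Ψ.v)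
    + (∫⁻ s, l2Sq (weakGrad (Ψ.η s)) ∂memMeasure g)
    + l2Sq Ψ.w
    + l2Sq (weakLaplacian (Ψ.ψ + τ • Ψ.v)) + l2Sq (weakGrad (Ψ.v + τ • Ψ.w))
    + l2Sq (weakLaplacian Ψ.v)
    + ∫⁻ s, l2Sq (weakLaplacian (Ψ.η s)) ∂memMeasure g

/-- The dissipation `𝓓⁽⁰⁾[Ψ]` of order zero. -/
def dissipationDensity (τ : ℝ) (g : ℝ → ℝ) (Ψ : State n) : ℝ≥0∞ :=
  l2Sq (weakGrad Ψ.v) + (∫⁻ s, l2Sq (weakGrad (Ψ.η s)) ∂memMeasure g)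
    + l2Sq (weakLaplacian (Ψ.ψ + τ • Ψ.v)) + l2Sq (weakGrad (Ψ.v + τ • Ψ.w))
    + l2Sq (weakLaplacian Ψ.v)
    + (∫⁻ s, l2Sq (weakLaplacian (Ψ.η s)) ∂memMeasure g)
    + l2Sq Ψ.w

/-- `‖Ψ‖²_{𝓔₀(t)}`, the supremum of `𝓔⁽⁰⁾[Ψ](σ)` over `0 ≤ σ ≤ t`. -/
def energySq (τ : ℝ) (g : ℝ → ℝ) (Ψ : ℝ → State n) (t : ℝ) : ℝ≥0∞ :=
  ⨆ σ ∈ Icc 0 t, energyDensity τ g (Ψ σ)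

/-- `‖Ψ‖²_{𝓓₀(t)}`, the integral of `𝓓⁽⁰⁾[Ψ](σ)` over `0 ≤ σ ≤ t`. -/
def dissipationSq (τ : ℝ) (g : ℝ → ℝ) (Ψ : ℝ → State n) (t : ℝ) : ℝ≥0∞ :=
  ∫⁻ σ in Icc 0 t, dissipationDensity τ g (Ψ σ)

/-- The functional `Λ[Ψ](t)`. -/
def Lam (Ψ : ℝ → State n) (t : ℝ) : ℝ≥0∞ :=
  ⨆ σ ∈ Icc 0 t,
    ((eLpNorm (Ψ σ).v ⊤ volume + eLpNorm (weakGrad (Ψ σ).v) ⊤ volume)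
      + eLpNorm (Ψ σ).w ⊤ volume
      + eLpNorm (weakGrad (Ψ σ).ψ) ⊤ volume
      + gradNormHs (((n : ℝ) - 2) / 2) (Ψ σ).ψ
      + hessNormHs (((n : ℝ) - 2) / 2) (Ψ σ).ψ
      + normHs (((n : ℝ) - 2) / 2) (Ψ σ).v
      + gradNormHs (((n : ℝ) - 2) / 2) (Ψ σ).v
      + normHs (((n : ℝ) - 2) / 2) (Ψ σ).w)

end JMGT

end

noncomputable section

namespace JMGT

local notation "⟪" x ", " y "⟫" => inner ℝ x y

/-! ### Upper right derivatives -/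

/-- The upper right Dini derivative of `f` at `t` is at most `a`. -/
def UpperRightDerivLE (f : ℝ → ℝ) (a t : ℝ) : Prop :=
  ∀ r, a < r → ∀ᶠ z in 𝓝[>] t, slope f t z < r

theorem UpperRightDerivLE.add {f g : ℝ → ℝ} {a b t : ℝ} (hf : UpperRightDerivLE f a t)
    (hg : UpperRightDerivLE g b t) : UpperRightDerivLE (fun s => f s + g s) (a + b) t := by
  intro r hr
  filter_upwards [hf (a + (r - a - b) / 2) (by linarith), hg (b + (r - a - b) / 2) (by linarith)]
    with z h1 h2
  have : slope (fun s => f s + g s) t z = slope f t z + slope g t z := by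
    simp only [slope_def_field]; ring
  linarith

theorem UpperRightDerivLE.const_mul {f : ℝ → ℝ} {a t c : ℝ} (hf : UpperRightDerivLE f a t)
    (hc : 0 < c) : UpperRightDerivLE (fun s => c * f s) (c * a) t := by
  intro r hr
  filter_upwards [hf (r / c) (by rwa [lt_div_iff₀ hc, mul_comm])] with z h1
  have : slope (fun s => c * f s) t z = c * slope f t z := by
    simp only [slope_def_field]; ring
  rw [this]
  rwa [lt_div_iff₀ hc, mul_comm] at h1

theorem UpperRightDerivLE.mono {f : ℝ → ℝ} {a b t : ℝ} (hf : UpperRightDerivLE f a t)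
    (hab : a ≤ b) : UpperRightDerivLE f b t := fun r hr => hf r (hab.trans_lt hr)

theorem upperRightDerivLE_of_hasDerivWithinAt {f : ℝ → ℝ} {a t : ℝ}
    (hf : HasDerivWithinAt f a (Ici t) t) : UpperRightDerivLE f a t := fun r hr =>
  (hf.mono Ioi_subset_Ici_self).limsup_slope_le' (by simp) hr

/-- A continuous function whose upper right derivative is bounded by a continuous function grows
at most like the integral of that function. -/
theorem le_add_integral_of_upperRightDerivLE {f B : ℝ → ℝ} {T : ℝ} (hf : Continuous f)
    (hB : Continuous B) (h : ∀ t ∈ Ico 0 T, UpperRightDerivLE f (B t) t) :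
    ∀ t ∈ Icc 0 T, f t ≤ f 0 + ∫ s in (0 : ℝ)..t, B s := by
  have hd : ∀ t, HasDerivAt (fun t => f 0 + ∫ s in (0 : ℝ)..t, B s) (B t) t := fun t =>
    ((hB.integral_hasStrictDerivAt 0 t).hasDerivAt).const_add _
  intro t ht
  exact image_le_of_liminf_slope_right_le_deriv_boundary hf.continuousOn (by simp)
    (fun t _ => (hd t).continuousAt.continuousWithinAt) (fun t _ => (hd t).hasDerivWithinAt)
    (fun x hx r hr => (h x hx r hr).frequently) ht

/-! ### The Lyapunov functional in Hilbert spaces -/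

section Abstract

variable {H K : Type*} [NormedAddCommGroup H] [InnerProductSpace ℝ H]
  [NormedAddCommGroup K] [InnerProductSpace ℝ K]

theorem inner_le_young {E : Type*} [NormedAddCommGroup E] [InnerProductSpace ℝ E] (x y : E)
    {ε : ℝ} (hε : 0 < ε) : |⟪x, y⟫| ≤ ε * ‖x‖ ^ 2 + (4 * ε)⁻¹ * ‖y‖ ^ 2 := by
  refine (abs_real_inner_le_norm x y).trans ?_
  have h : ε * ‖x‖ ^ 2 + (4 * ε)⁻¹ * ‖y‖ ^ 2 - ‖x‖ * ‖y‖
      = (4 * ε)⁻¹ * (2 * ε * ‖x‖ - ‖y‖) ^ 2 := by field_simp; ring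
  have : 0 ≤ (4 * ε)⁻¹ * (2 * ε * ‖x‖ - ‖y‖) ^ 2 := by positivity
  linarith

theorem abs_memory_cross_le {E : Type*} [NormedAddCommGroup E] [InnerProductSpace ℝ E] {m y : E}
    {P τ G : ℝ} (hτ : 0 < τ) (hG : 0 < G) (h : ‖m‖ ^ 2 ≤ G * P) :
    |2 * τ * ⟪m, y⟫| ≤ P + τ ^ 2 * G * ‖y‖ ^ 2 := by
  have h1 := inner_le_young m y (ε := 1 / (2 * τ * G)) (by positivity)
  have h2 : 2 * τ * |⟪m, y⟫| ≤ ‖m‖ ^ 2 / G + τ ^ 2 * G * ‖y‖ ^ 2 := by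
    refine (mul_le_mul_of_nonneg_left h1 (by positivity)).trans (le_of_eq ?_)
    field_simp
    ring
  have h3 : ‖m‖ ^ 2 / G ≤ P := by rwa [div_le_iff₀ hG, mul_comm]
  rw [abs_mul, abs_of_pos (by positivity)]
  linarith

/-- A trajectory of the linearized system with a source `f`, seen through its gradients (in `K`)
and Laplacians (in `H`): `gu`, `lu` belong to `ψ + τ v`, and `m₀`, `m₁`, `N₀`, `N₁`, `P₀`, `P₁` are
the memory integral and the squares of the norms of the history with weights `-g'` and `g`. -/
structure IsEnergyTrajectory (τ κ β G ζ T : ℝ) (gu gv gw m₀ : ℝ → K) (lu lv lw v w m₁ f : ℝ → H)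
    (N₀ N₁ P₀ P₁ : ℝ → ℝ) : Prop where
  cont_gu : Continuous gu
  cont_gv : Continuous gv
  cont_gw : Continuous gw
  cont_m₀ : Continuous m₀
  cont_lu : Continuous lu
  cont_lv : Continuous lv
  cont_lw : Continuous lw
  cont_v : Continuous v
  cont_w : Continuous w
  cont_m₁ : Continuous m₁
  cont_N₀ : Continuous N₀
  cont_N₁ : Continuous N₁
  cont_P₀ : Continuous P₀
  cont_P₁ : Continuous P₁
  deriv_gu : ∀ t ∈ Ico 0 T, HasDerivWithinAt gu (gv t + τ • gw t) (Ici t) t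
  deriv_gv : ∀ t ∈ Ico 0 T, HasDerivWithinAt gv (gw t) (Ici t) t
  deriv_lu : ∀ t ∈ Ico 0 T, HasDerivWithinAt lu (lv t + τ • lw t) (Ici t) t
  deriv_lv : ∀ t ∈ Ico 0 T, HasDerivWithinAt lv (lw t) (Ici t) t
  deriv_v : ∀ t ∈ Ico 0 T, HasDerivWithinAt v (w t) (Ici t) t
  deriv_w : ∀ t ∈ Ico 0 T,
    HasDerivWithinAt w (τ⁻¹ • (κ • lu t + β • lv t + m₁ t + f t - w t)) (Ici t) t
  green_u : ∀ t, ⟪gu t, gv t + τ • gw t⟫ = -⟪lu t, v t + τ • w t⟫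
  green_v : ∀ t, ⟪gv t, gv t + τ • gw t⟫ = -⟪lv t, v t + τ • w t⟫
  green_z : ∀ s t, ⟪gv s + τ • gw s, gv t + τ • gw t⟫ = -⟪v s + τ • w s, lv t + τ • lw t⟫
  green_m : ∀ t, ⟪m₀ t, gv t + τ • gw t⟫ = -⟪m₁ t, v t + τ • w t⟫
  memory₀ : ∀ t ∈ Ico 0 T, UpperRightDerivLE (fun t => τ * N₀ t + P₀ t + 2 * τ * ⟪m₀ t, gv t⟫)
    (2 * ⟪m₀ t, gv t⟫ - N₀ t + 2 * τ * G * ‖gv t‖ ^ 2 + 2 * τ * ⟪m₀ t, gw t⟫) t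
  memory₁ : ∀ t ∈ Ico 0 T, UpperRightDerivLE (fun t => τ * N₁ t + P₁ t + 2 * τ * ⟪m₁ t, lv t⟫)
    (2 * ⟪m₁ t, lv t⟫ - N₁ t + 2 * τ * G * ‖lv t‖ ^ 2 + 2 * τ * ⟪m₁ t, lw t⟫) t
  bound_m₀ : ∀ t, ‖m₀ t‖ ^ 2 ≤ G * P₀ t
  bound_m₁ : ∀ t, ‖m₁ t‖ ^ 2 ≤ G * P₁ t
  bound_P₀ : ∀ t, ζ * P₀ t ≤ N₀ t
  bound_P₁ : ∀ t, ζ * P₁ t ≤ N₁ t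

namespace IsEnergyTrajectory

variable {τ κ β G ζ T : ℝ} {gu gv gw m₀ : ℝ → K} {lu lv lw v w m₁ f : ℝ → H}
  {N₀ N₁ P₀ P₁ : ℝ → ℝ}

theorem hasDerivWithinAt_norm_sq {E : Type*} [NormedAddCommGroup E] [InnerProductSpace ℝ E]
    {a : ℝ → E} {a' : E} {s : Set ℝ} {t : ℝ} (h : HasDerivWithinAt a a' s t) :
    HasDerivWithinAt (fun t => ‖a t‖ ^ 2) (2 * ⟪a t, a'⟫) s t := by
  have := h.norm_sq
  convert this using 1

theorem deriv_z (X : IsEnergyTrajectory τ κ β G ζ T gu gv gw m₀ lu lv lw v w m₁ f N₀ N₁ P₀ P₁)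
    (hτ : 0 < τ) {t : ℝ} (ht : t ∈ Ico 0 T) :
    HasDerivWithinAt (fun t => v t + τ • w t) (κ • lu t + β • lv t + m₁ t + f t) (Ici t) t := by
  refine ((X.deriv_v t ht).add ((X.deriv_w t ht).const_smul τ)).congr_deriv ?_
  rw [smul_smul, mul_inv_cancel₀ hτ.ne', one_smul]
  abel

theorem deriv_grad_z (X : IsEnergyTrajectory τ κ β G ζ T gu gv gw m₀ lu lv lw v w m₁ f N₀ N₁ P₀ P₁)
    (hτ : 0 < τ) {t : ℝ} (ht : t ∈ Ico 0 T) :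
    HasDerivWithinAt (fun t => ‖gv t + τ • gw t‖ ^ 2)
      (-2 * ⟪κ • lu t + β • lv t + m₁ t + f t, lv t + τ • lw t⟫) (Ici t) t := by
  have hz := X.deriv_z hτ ht
  rw [hasDerivWithinAt_iff_tendsto_slope] at hz ⊢
  have hc : Tendsto (fun s => (lv s + τ • lw s) + (lv t + τ • lw t)) (𝓝[Ici t \ {t}] t)
      (𝓝 ((lv t + τ • lw t) + (lv t + τ • lw t))) :=
    ((X.cont_lv.add (X.cont_lw.const_smul τ)).add continuous_const).continuousAt.tendsto.mono_left
      nhdsWithin_le_nhds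
  have := (hz.inner hc (𝕜 := ℝ)).neg
  refine (this.congr fun s => ?_).trans_eq ?_
  · have h1 := X.green_z s s
    have h2 := X.green_z t t
    have h3 := X.green_z s t
    have h4 := X.green_z t s
    rw [real_inner_self_eq_norm_sq] at h1 h2
    rw [real_inner_comm] at h4
    simp only [slope, vsub_eq_sub, real_inner_smul_left, inner_sub_left, inner_add_right,
      smul_eq_mul, h1, h2] at h1 h2 h3 h4 ⊢
    have h5 := h3.symm.trans h4
    linear_combination (s - t)⁻¹ * h5
  · rw [inner_add_right]; ring_nf

/-- The Lyapunov functional. -/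
def lyapunov (M δ τ κ β : ℝ) (gu gv gw m₀ : K) (lu lv w v m₁ : H) (N₀ N₁ P₀ P₁ : ℝ) : ℝ :=
  M * ((κ * ‖gu‖ ^ 2 + τ * β * ‖gv‖ ^ 2 + ‖v + τ • w‖ ^ 2 + (τ * N₀ + P₀ + 2 * τ * ⟪m₀, gv⟫))
    + (κ * ‖lu‖ ^ 2 + τ * β * ‖lv‖ ^ 2 + ‖gv + τ • gw‖ ^ 2
      + (τ * N₁ + P₁ + 2 * τ * ⟪m₁, lv⟫)))
  + (4 * τ * ⟪lv, v + τ • w⟫ - ⟪lu, v + τ • w⟫ + δ * ‖w‖ ^ 2)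

/-- The dissipation. -/
def dissipation (gv gz : K) (lu lv w : H) (N₀ N₁ : ℝ) : ℝ :=
  ‖gv‖ ^ 2 + N₀ + ‖lu‖ ^ 2 + ‖gz‖ ^ 2 + ‖lv‖ ^ 2 + N₁ + ‖w‖ ^ 2

/-- The energy. -/
def energy (gu gv gz : K) (z lu lv w : H) (N₀ N₁ : ℝ) : ℝ :=
  ‖gu‖ ^ 2 + ‖z‖ ^ 2 + ‖gv‖ ^ 2 + N₀ + ‖w‖ ^ 2 + ‖lu‖ ^ 2 + ‖gz‖ ^ 2 + ‖lv‖ ^ 2 + N₁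

/-- The work done by the source `f`. -/
def sourceWork (z lz lu lv w f : H) : ℝ :=
  |⟪f, z⟫| + |⟪f, lz⟫| + |⟪f, lu⟫| + |⟪f, lv⟫| + |⟪f, w⟫|

theorem upperRightDerivLE_lyapunov
    (X : IsEnergyTrajectory τ κ β G ζ T gu gv gw m₀ lu lv lw v w m₁ f N₀ N₁ P₀ P₁)
    (hτ : 0 < τ) {M δ : ℝ} (hM : 0 < M) {t : ℝ} (ht : t ∈ Ico 0 T) :
    UpperRightDerivLE (fun t => lyapunov M δ τ κ β (gu t) (gv t) (gw t) (m₀ t) (lu t) (lv t) (w t)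
        (v t) (m₁ t) (N₀ t) (N₁ t) (P₀ t) (P₁ t))
      (M * (-2 * (β - τ * G) * (‖gv t‖ ^ 2 + ‖lv t‖ ^ 2) - N₀ t - N₁ t
          + 2 * ⟪f t, v t + τ • w t⟫ - 2 * ⟪f t, lv t + τ • lw t⟫)
        + (4 * (⟪gv t, gv t + τ • gw t⟫ - ‖gv t + τ • gw t‖ ^ 2)
          + 4 * τ * (κ * ⟪lv t, lu t⟫ + β * ‖lv t‖ ^ 2 + ⟪lv t, m₁ t⟫ + ⟪f t, lv t⟫)
          + (‖gv t + τ • gw t‖ ^ 2 - κ * ‖lu t‖ ^ 2 - β * ⟪lv t, lu t⟫ - ⟪lu t, m₁ t⟫ - ⟪f t, lu t⟫)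
          + 2 * δ / τ * (κ * ⟪w t, lu t⟫ + β * ⟪w t, lv t⟫ + ⟪w t, m₁ t⟫ + ⟪f t, w t⟫
            - ‖w t‖ ^ 2))) t := by
  have hz := X.deriv_z hτ ht
  have h0 := (upperRightDerivLE_of_hasDerivWithinAt
    ((((hasDerivWithinAt_norm_sq (X.deriv_gu t ht)).const_mul κ).add
    ((hasDerivWithinAt_norm_sq (X.deriv_gv t ht)).const_mul (τ * β))).add
    (hasDerivWithinAt_norm_sq hz))).add (X.memory₀ t ht)
  have h1 := (upperRightDerivLE_of_hasDerivWithinAt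
    ((((hasDerivWithinAt_norm_sq (X.deriv_lu t ht)).const_mul κ).add
    ((hasDerivWithinAt_norm_sq (X.deriv_lv t ht)).const_mul (τ * β))).add
    (X.deriv_grad_z hτ ht))).add (X.memory₁ t ht)
  have h2 := upperRightDerivLE_of_hasDerivWithinAt
    (((((X.deriv_lv t ht).inner ℝ hz).const_mul (4 * τ)).sub
    ((X.deriv_lu t ht).inner ℝ hz)).add
    ((hasDerivWithinAt_norm_sq (X.deriv_w t ht)).const_mul δ))
  have h3 := ((h0.add h1).const_mul hM).add h2
  refine UpperRightDerivLE.mono h3 (le_of_eq ?_)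
  have e1 := X.green_u t
  have e2 := X.green_v t
  have e3 := X.green_z t t
  have e4 := X.green_m t
  have e5 : ⟪lv t + τ • lw t, v t + τ • w t⟫ = -‖gv t + τ • gw t‖ ^ 2 := by
    rw [real_inner_comm, ← neg_eq_iff_eq_neg, ← e3, real_inner_self_eq_norm_sq]
  have e6 : τ * ⟪lw t, v t + τ • w t⟫ = -‖gv t + τ • gw t‖ ^ 2 + ⟪gv t, gv t + τ • gw t⟫ := by
    rw [inner_add_left, real_inner_smul_left] at e5
    linarith
  have c1 : ⟪f t, lu t⟫ = ⟪lu t, f t⟫ := real_inner_comm _ _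
  have c2 : ⟪f t, lv t⟫ = ⟪lv t, f t⟫ := real_inner_comm _ _
  have c3 : ⟪f t, w t⟫ = ⟪w t, f t⟫ := real_inner_comm _ _
  have c4 : ⟪lu t, lv t⟫ = ⟪lv t, lu t⟫ := real_inner_comm _ _
  have z0 : ⟪v t + τ • w t, κ • lu t + β • lv t + m₁ t + f t⟫
      = κ * ⟪lu t, v t + τ • w t⟫ + β * ⟪lv t, v t + τ • w t⟫ + ⟪m₁ t, v t + τ • w t⟫
        + ⟪f t, v t + τ • w t⟫ := by
    rw [real_inner_comm]
    simp only [inner_add_left, real_inner_smul_left]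
  have z1 : ⟪κ • lu t + β • lv t + m₁ t + f t, lv t + τ • lw t⟫
      = κ * ⟪lu t, lv t + τ • lw t⟫ + β * (‖lv t‖ ^ 2 + τ * ⟪lv t, lw t⟫)
        + (⟪m₁ t, lv t⟫ + τ * ⟪m₁ t, lw t⟫) + ⟪f t, lv t + τ • lw t⟫ := by
    simp only [inner_add_left, inner_add_right, real_inner_smul_left, real_inner_smul_right,
      real_inner_self_eq_norm_sq]
    ring
  have z2 : ⟪lv t, κ • lu t + β • lv t + m₁ t + f t⟫
      = κ * ⟪lv t, lu t⟫ + β * ‖lv t‖ ^ 2 + ⟪lv t, m₁ t⟫ + ⟪lv t, f t⟫ := by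
    simp only [inner_add_right, real_inner_smul_right, real_inner_self_eq_norm_sq]
  have z3 : ⟪lu t, κ • lu t + β • lv t + m₁ t + f t⟫
      = κ * ‖lu t‖ ^ 2 + β * ⟪lv t, lu t⟫ + ⟪lu t, m₁ t⟫ + ⟪lu t, f t⟫ := by
    simp only [inner_add_right, real_inner_smul_right, real_inner_self_eq_norm_sq, c4]
  have z4 : ⟪w t, τ⁻¹ • (κ • lu t + β • lv t + m₁ t + f t - w t)⟫
      = τ⁻¹ * (κ * ⟪w t, lu t⟫ + β * ⟪w t, lv t⟫ + ⟪w t, m₁ t⟫ + ⟪w t, f t⟫ - ‖w t‖ ^ 2) := by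
    simp only [inner_add_right, inner_sub_right, real_inner_smul_right, real_inner_self_eq_norm_sq]
  have g0 : ⟪gv t, gv t + τ • gw t⟫ = ‖gv t‖ ^ 2 + τ * ⟪gv t, gw t⟫ := by
    simp only [inner_add_right, real_inner_smul_right, real_inner_self_eq_norm_sq]
  have g1 : ⟪m₀ t, gv t + τ • gw t⟫ = ⟪m₀ t, gv t⟫ + τ * ⟪m₀ t, gw t⟫ := by
    simp only [inner_add_right, real_inner_smul_right]
  rw [z0, z1, z2, z3, z4, e5, c1, c2, c3, e1]
  rw [g1] at e4
  rw [g0] at e2 e6 ⊢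
  have e7 : ⟪lv t, v t + τ • w t⟫ = -(‖gv t‖ ^ 2 + τ * ⟪gv t, gw t⟫) := by linarith
  have e8 : ⟪m₁ t, v t + τ • w t⟫ = -(⟪m₀ t, gv t⟫ + τ * ⟪m₀ t, gw t⟫) := by linarith
  rw [e7, e8]
  field_simp
  linear_combination 4 * τ * e6

theorem exists_dissipation_bound (hτ : 0 < τ) (hκ : 0 < κ) (hG : 0 < G) (hζ : 0 < ζ)
    (hβ : τ * G < β) :
    ∃ M δ c C : ℝ, 0 < M ∧ 0 < δ ∧ 0 < c ∧ 0 < C ∧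
      (∀ (gv gz : K) (lu lv z lz w m₁ f : H) (N₀ N₁ P₁ : ℝ), ‖m₁‖ ^ 2 ≤ G * P₁ → ζ * P₁ ≤ N₁ →
        0 ≤ N₀ →
        M * (-2 * (β - τ * G) * (‖gv‖ ^ 2 + ‖lv‖ ^ 2) - N₀ - N₁ + 2 * ⟪f, z⟫ - 2 * ⟪f, lz⟫)
        + (4 * (⟪gv, gz⟫ - ‖gz‖ ^ 2)
          + 4 * τ * (κ * ⟪lv, lu⟫ + β * ‖lv‖ ^ 2 + ⟪lv, m₁⟫ + ⟪f, lv⟫)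
          + (‖gz‖ ^ 2 - κ * ‖lu‖ ^ 2 - β * ⟪lv, lu⟫ - ⟪lu, m₁⟫ - ⟪f, lu⟫)
          + 2 * δ / τ * (κ * ⟪w, lu⟫ + β * ⟪w, lv⟫ + ⟪w, m₁⟫ + ⟪f, w⟫ - ‖w‖ ^ 2))
        ≤ -c * dissipation gv gz lu lv w N₀ N₁ + C * sourceWork z lz lu lv w f) ∧
      (∀ (gu gv gw m₀ : K) (lu lv w v m₁ : H) (N₀ N₁ P₀ P₁ : ℝ),
        ‖m₀‖ ^ 2 ≤ G * P₀ → ζ * P₀ ≤ N₀ → ‖m₁‖ ^ 2 ≤ G * P₁ → ζ * P₁ ≤ N₁ →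
        ⟪gu, gv + τ • gw⟫ = -⟪lu, v + τ • w⟫ → ⟪gv, gv + τ • gw⟫ = -⟪lv, v + τ • w⟫ →
        c * energy gu gv (gv + τ • gw) (v + τ • w) lu lv w N₀ N₁
          ≤ lyapunov M δ τ κ β gu gv gw m₀ lu lv w v m₁ N₀ N₁ P₀ P₁ ∧
        lyapunov M δ τ κ β gu gv gw m₀ lu lv w v m₁ N₀ N₁ P₀ P₁
          ≤ C * energy gu gv (gv + τ • gw) (v + τ • w) lu lv w N₀ N₁) := by
  have hα : 0 < β - τ * G := by linarith
  have hβ0 : 0 < β := by have := mul_pos hτ hG; linarith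
  set e : ℝ := 1 / (8 * κ) with he
  have he0 : 0 < e := by positivity
  set C₁ : ℝ := 32 * τ ^ 2 * κ + 4 * τ * β + 2 * τ + 2 * β ^ 2 / κ + e * β ^ 2 with hC₁
  set C₃ : ℝ := 2 * τ + 2 / κ + e with hC₃
  have hC₁0 : 0 < C₁ := by positivity
  have hC₃0 : 0 < C₃ := by positivity
  obtain ⟨M, hM1, hM2, hM3, hM4, hM5, hM6⟩ : ∃ M : ℝ, C₁ + 5 ≤ 2 * (β - τ * G) * M ∧
      C₃ * G / ζ + 1 ≤ M ∧ 1 ≤ M * κ ∧ 2 * τ + 1 ≤ M * (τ * (β - τ * G)) ∧ 2 * τ + 2 ≤ M ∧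
      1 ≤ M * τ := by
    have h (a b : ℝ) (hb : 0 < b) : ∀ᶠ M : ℝ in atTop, a ≤ M * b :=
      (tendsto_id.atTop_mul_const hb).eventually_ge_atTop a
    obtain ⟨M, h1, h2, h3, h4, h5, h6⟩ := ((h (C₁ + 5) (2 * (β - τ * G)) (by linarith)).and
      ((h (C₃ * G / ζ + 1) 1 one_pos).and ((h 1 κ hκ).and ((h (2 * τ + 1) (τ * (β - τ * G))
      (by positivity)).and ((h (2 * τ + 2) 1 one_pos).and (h 1 τ hτ)))))).exists
    exact ⟨M, by linarith, by linarith, h3, h4, by linarith, h6⟩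
  have hM0 : 0 < M := by linarith
  obtain ⟨c, hc0, hc1, hc2, hc3, hc4⟩ : ∃ c : ℝ, 0 < c ∧ c ≤ 1 / 2 ∧ c ≤ κ / 2 ∧ c ≤ e / 4 ∧
      c ≤ τ / (16 * κ) :=
    ⟨min (min (1 / 2) (κ / 2)) (min (e / 4) (τ / (16 * κ))), by positivity,
      (min_le_left _ _).trans (min_le_left _ _), (min_le_left _ _).trans (min_le_right _ _),
      (min_le_right _ _).trans (min_le_left _ _), (min_le_right _ _).trans (min_le_right _ _)⟩
  have hδe : 2 * (τ / (16 * κ)) / τ = e := by rw [he]; field_simp; norm_num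
  refine ⟨M, τ / (16 * κ), c, M * (κ + τ * β + 1 + τ + 2 / ζ + τ ^ 2 * G) + 8 * τ + 2
    + τ / (16 * κ) + 2 * M + e, hM0, by positivity, hc0, by positivity, ?_, ?_⟩
  · intro gv gz lu lv z lz w m₁ f N₀ N₁ P₁ hm hP hN₀
    rw [hδe]
    have y1 := (abs_le.1 (inner_le_young gz gv (ε := 1 / 4) (by norm_num))).2
    have y2 := (abs_le.1 (inner_le_young lu lv (ε := 1 / (32 * τ)) (by positivity))).2
    have y3 := (abs_le.1 (inner_le_young lv m₁ (ε := 1 / 2) (by norm_num))).2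
    have y4 := (abs_le.1 (inner_le_young lu lv (ε := κ / (8 * β)) (by positivity))).1
    have y5 := (abs_le.1 (inner_le_young lu m₁ (ε := κ / 8) (by positivity))).1
    have y6 := (abs_le.1 (inner_le_young w lu (ε := 1 / (4 * κ)) (by positivity))).2
    have y7 := (abs_le.1 (inner_le_young w lv (ε := 1 / (4 * β)) (by positivity))).2
    have y8 := (abs_le.1 (inner_le_young w m₁ (ε := 1 / 4) (by positivity))).2
    rw [real_inner_comm] at y1
    rw [real_inner_comm] at y2 y4
    have x2 : 4 * τ * (κ * ⟪lv, lu⟫) ≤ κ / 8 * ‖lu‖ ^ 2 + 32 * τ ^ 2 * κ * ‖lv‖ ^ 2 := by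
      refine (mul_le_mul_of_nonneg_left y2 (by positivity : 0 ≤ 4 * τ * κ)).trans' (by ring_nf; rfl)
        |>.trans (le_of_eq ?_)
      field_simp
      ring
    have x4 : -(β * ⟪lv, lu⟫) ≤ κ / 8 * ‖lu‖ ^ 2 + 2 * β ^ 2 / κ * ‖lv‖ ^ 2 := by
      refine (mul_le_mul_of_nonneg_left (neg_le.1 y4) hβ0.le).trans' (by ring_nf; rfl)
        |>.trans (le_of_eq ?_)
      field_simp
      ring
    have x5 : -⟪lu, m₁⟫ ≤ κ / 8 * ‖lu‖ ^ 2 + 2 / κ * ‖m₁‖ ^ 2 := by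
      refine (neg_le.1 y5).trans (le_of_eq ?_)
      field_simp
      ring
    have x6 : e * (κ * ⟪w, lu⟫) ≤ e / 4 * ‖w‖ ^ 2 + κ / 8 * ‖lu‖ ^ 2 := by
      refine (mul_le_mul_of_nonneg_left y6 (by positivity : 0 ≤ e * κ)).trans' (by ring_nf; rfl)
        |>.trans (le_of_eq ?_)
      rw [he]
      field_simp
    have x7 : e * (β * ⟪w, lv⟫) ≤ e / 4 * ‖w‖ ^ 2 + e * β ^ 2 * ‖lv‖ ^ 2 := by
      refine (mul_le_mul_of_nonneg_left y7 (by positivity : 0 ≤ e * β)).trans' (by ring_nf; rfl)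
        |>.trans (le_of_eq ?_)
      field_simp
    have x8 : e * ⟪w, m₁⟫ ≤ e / 4 * ‖w‖ ^ 2 + e * ‖m₁‖ ^ 2 := by
      refine (mul_le_mul_of_nonneg_left y8 he0.le).trans (le_of_eq ?_)
      ring
    have x3 : 4 * τ * ⟪lv, m₁⟫ ≤ 2 * τ * ‖lv‖ ^ 2 + 2 * τ * ‖m₁‖ ^ 2 := by
      refine (mul_le_mul_of_nonneg_left y3 (by positivity : 0 ≤ 4 * τ)).trans (le_of_eq ?_)
      ring
    have hm' : C₃ * ‖m₁‖ ^ 2 ≤ (M - 1) * N₁ := by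
      have h1 : ‖m₁‖ ^ 2 ≤ G / ζ * N₁ := by
        have h2 : P₁ ≤ N₁ / ζ := by rwa [le_div_iff₀ hζ, mul_comm]
        calc ‖m₁‖ ^ 2 ≤ G * (N₁ / ζ) := hm.trans (mul_le_mul_of_nonneg_left h2 hG.le)
          _ = G / ζ * N₁ := by ring
      have h3 : 0 ≤ P₁ := nonneg_of_mul_nonneg_right ((sq_nonneg _).trans hm) hG
      have h4 : 0 ≤ N₁ := (mul_nonneg hζ.le h3).trans hP
      calc C₃ * ‖m₁‖ ^ 2 ≤ C₃ * (G / ζ * N₁) := mul_le_mul_of_nonneg_left h1 hC₃0.le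
        _ = C₃ * G / ζ * N₁ := by ring
        _ ≤ (M - 1) * N₁ := mul_le_mul_of_nonneg_right (by linarith) h4
    have hN₁ : 0 ≤ N₁ := by
      have h3 : 0 ≤ P₁ := nonneg_of_mul_nonneg_right ((sq_nonneg _).trans hm) hG
      exact (mul_nonneg hζ.le h3).trans hP
    have k1 := mul_le_mul_of_nonneg_right hM1 (sq_nonneg ‖gv‖)
    have k2 := mul_le_mul_of_nonneg_right hM1 (sq_nonneg ‖lv‖)
    have k3 := mul_le_mul_of_nonneg_right hc1 (sq_nonneg ‖gv‖)
    have k4 := mul_le_mul_of_nonneg_right hc1 (sq_nonneg ‖lv‖)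
    have k5 := mul_le_mul_of_nonneg_right hc1 (sq_nonneg ‖gz‖)
    have k6 := mul_le_mul_of_nonneg_right hc2 (sq_nonneg ‖lu‖)
    have k7 := mul_le_mul_of_nonneg_right hc3 (sq_nonneg ‖w‖)
    have k8 := mul_le_mul_of_nonneg_right hc1 hN₁
    have k9 := mul_le_mul_of_nonneg_right hc1 hN₀
    have k10 : 1 * N₀ ≤ M * N₀ := mul_le_mul_of_nonneg_right (by linarith) hN₀
    have p1 := mul_nonneg hC₁0.le (sq_nonneg ‖gv‖)
    have hsrc : M * (2 * ⟪f, z⟫ - 2 * ⟪f, lz⟫) + 4 * τ * ⟪f, lv⟫ - ⟪f, lu⟫ + e * ⟪f, w⟫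
        ≤ (M * (κ + τ * β + 1 + τ + 2 / ζ + τ ^ 2 * G) + 8 * τ + 2 + τ / (16 * κ) + 2 * M + e) *
          sourceWork z lz lu lv w f := by
      have a1 := le_abs_self ⟪f, z⟫
      have a2 := neg_abs_le ⟪f, lz⟫
      have a3 := le_abs_self ⟪f, lv⟫
      have a4 := neg_abs_le ⟪f, lu⟫
      have a5 := le_abs_self ⟪f, w⟫
      have q : ∀ x y : ℝ, ∀ r s, 0 ≤ r → x ≤ y → r ≤ s → 0 ≤ y → r * x ≤ s * y :=
        fun x y r s h1 h2 h3 h4 => (mul_le_mul_of_nonneg_left h2 h1).trans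
          (mul_le_mul_of_nonneg_right h3 h4)
      set S := M * (κ + τ * β + 1 + τ + 2 / ζ + τ ^ 2 * G) + 8 * τ + 2 + τ / (16 * κ) + 2 * M + e
        with hS
      have hS' : 0 ≤ M * (κ + τ * β + 1 + τ + 2 / ζ + τ ^ 2 * G) + τ / (16 * κ) := by positivity
      have b1 := q _ _ (2 * M) S (by positivity) a1 (by linarith) (abs_nonneg _)
      have b2 := q _ _ (2 * M) S (by positivity) (neg_le.1 a2) (by linarith) (abs_nonneg _)
      have b3 := q _ _ (4 * τ) S (by positivity) a3 (by linarith) (abs_nonneg _)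
      have b4 := q _ _ 1 S (by positivity) (neg_le.1 a4) (by linarith) (abs_nonneg _)
      have b5 := q _ _ e S (by positivity) a5 (by linarith) (abs_nonneg _)
      simp only [sourceWork]
      linarith
    simp only [dissipation]
    rw [hC₁] at k1 k2 p1
    rw [hC₃] at hm'
    linarith [sq_nonneg ‖gv‖, sq_nonneg ‖lv‖, sq_nonneg ‖gz‖]
  · intro gu gv gw m₀ lu lv w v m₁ N₀ N₁ P₀ P₁ h0 h0' h1 h1' gr1 gr2
    have c0 := abs_le.1 (abs_memory_cross_le (y := gv) hτ hG h0)
    have c1 := abs_le.1 (abs_memory_cross_le (y := lv) hτ hG h1)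
    have P₀0 : 0 ≤ P₀ := nonneg_of_mul_nonneg_right ((sq_nonneg _).trans h0) hG
    have P₁0 : 0 ≤ P₁ := nonneg_of_mul_nonneg_right ((sq_nonneg _).trans h1) hG
    have N₀0 : 0 ≤ N₀ := (mul_nonneg hζ.le P₀0).trans h0'
    have N₁0 : 0 ≤ N₁ := (mul_nonneg hζ.le P₁0).trans h1'
    have y1 := abs_le.1 (inner_le_young gu (gv + τ • gw) (ε := 1 / 2) (by norm_num))
    have y2 := abs_le.1 (inner_le_young gv (gv + τ • gw) (ε := 1 / 2) (by norm_num))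
    have e1 : ⟪lu, v + τ • w⟫ = -⟪gu, gv + τ • gw⟫ := by linarith
    have e2 : ⟪lv, v + τ • w⟫ = -⟪gv, gv + τ • gw⟫ := by linarith
    simp only [lyapunov, energy, e1, e2]
    generalize ⟪gu, gv + τ • gw⟫ = i1 at *
    generalize ⟪gv, gv + τ • gw⟫ = i2 at *
    generalize 2 * τ * ⟪m₀, gv⟫ = i3 at *
    generalize 2 * τ * ⟪m₁, lv⟫ = i4 at *
    have s1 := sq_nonneg ‖gu‖
    have s2 := sq_nonneg ‖gv‖
    have s3 := sq_nonneg ‖gv + τ • gw‖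
    have s4 := sq_nonneg ‖lu‖
    have s5 := sq_nonneg ‖lv‖
    have s6 := sq_nonneg ‖w‖
    have s7 := sq_nonneg ‖v + τ • w‖
    generalize ‖gu‖ ^ 2 = a1 at *
    generalize ‖gv‖ ^ 2 = a2 at *
    generalize ‖gv + τ • gw‖ ^ 2 = a3 at *
    generalize ‖lu‖ ^ 2 = a4 at *
    generalize ‖lv‖ ^ 2 = a5 at *
    generalize ‖w‖ ^ 2 = a6 at *
    generalize ‖v + τ • w‖ ^ 2 = a7 at *
    have y2a := mul_le_mul_of_nonneg_left y2.1 (by positivity : 0 ≤ 4 * τ)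
    have y2b := mul_le_mul_of_nonneg_left y2.2 (by positivity : 0 ≤ 4 * τ)
    constructor
    · have d0 := mul_le_mul_of_nonneg_left c0.1 hM0.le
      have d1 := mul_le_mul_of_nonneg_left c1.1 hM0.le
      have k1 := mul_le_mul_of_nonneg_right hM3 s1
      have k2 := mul_le_mul_of_nonneg_right hM4 s2
      have k3 := mul_le_mul_of_nonneg_right hM5 s3
      have k4 := mul_le_mul_of_nonneg_right hM3 s4
      have k5 := mul_le_mul_of_nonneg_right hM4 s5
      have k7 := mul_le_mul_of_nonneg_right hM5 s7
      have k8 := mul_le_mul_of_nonneg_right hM6 N₀0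
      have k9 := mul_le_mul_of_nonneg_right hM6 N₁0
      have q1 := mul_le_mul_of_nonneg_right hc1 s1
      have q2 := mul_le_mul_of_nonneg_right hc1 s2
      have q3 := mul_le_mul_of_nonneg_right hc1 s3
      have q4 := mul_le_mul_of_nonneg_right hc1 s4
      have q5 := mul_le_mul_of_nonneg_right hc1 s5
      have q6 := mul_le_mul_of_nonneg_right hc4 s6
      have q7 := mul_le_mul_of_nonneg_right hc1 s7
      have q8 := mul_le_mul_of_nonneg_right hc1 N₀0
      have q9 := mul_le_mul_of_nonneg_right hc1 N₁0
      have t5 := mul_nonneg hτ.le s5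
      have t7 := mul_nonneg hτ.le s7
      linarith
    · have d0 := mul_le_mul_of_nonneg_left c0.2 hM0.le
      have d1 := mul_le_mul_of_nonneg_left c1.2 hM0.le
      have p0 : M * P₀ ≤ M * (1 / ζ) * N₀ := by
        rw [mul_assoc]
        refine mul_le_mul_of_nonneg_left ?_ hM0.le
        rw [div_mul_eq_mul_div, one_mul, le_div_iff₀ hζ, mul_comm]; exact h0'
      have p1 : M * P₁ ≤ M * (1 / ζ) * N₁ := by
        rw [mul_assoc]
        refine mul_le_mul_of_nonneg_left ?_ hM0.le
        rw [div_mul_eq_mul_div, one_mul, le_div_iff₀ hζ, mul_comm]; exact h1'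
      set S := M * (κ + τ * β + 1 + τ + 2 / ζ + τ ^ 2 * G) + 8 * τ + 2 + τ / (16 * κ) + 2 * M + e
        with hS
      have u1 : 0 < M * κ := by positivity
      have u2 : 0 < M * (τ * β) := by positivity
      have u3 : 0 < M * τ := by positivity
      have u4 : 0 < M * (1 / ζ) := by positivity
      have u5 : 0 < M * (τ ^ 2 * G) := by positivity
      have u6 : 0 < τ / (16 * κ) := by positivity
      have hS' : S = M * κ + M * (τ * β) + M + M * τ + 2 * (M * (1 / ζ)) + M * (τ ^ 2 * G)
        + 8 * τ + 2 + τ / (16 * κ) + 2 * M + e := by rw [hS]; ring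
      have k1 := mul_le_mul_of_nonneg_right (by linarith : M * κ + 1 ≤ S) s1
      have k2 := mul_le_mul_of_nonneg_right
        (by linarith : M * (τ * β) + M * (τ ^ 2 * G) + 2 * τ ≤ S) s2
      have k3 := mul_le_mul_of_nonneg_right (by linarith : M + 2 * τ + 1 ≤ S) s3
      have k4 := mul_le_mul_of_nonneg_right (by linarith : M * κ ≤ S) s4
      have k5 := mul_le_mul_of_nonneg_right
        (by linarith : M * (τ * β) + M * (τ ^ 2 * G) ≤ S) s5
      have k6 := mul_le_mul_of_nonneg_right (by linarith : τ / (16 * κ) ≤ S) s6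
      have k7 := mul_le_mul_of_nonneg_right (by linarith : M ≤ S) s7
      have k8 := mul_le_mul_of_nonneg_right (by linarith : M * τ + 2 * (M * (1 / ζ)) ≤ S) N₀0
      have k9 := mul_le_mul_of_nonneg_right (by linarith : M * τ + 2 * (M * (1 / ζ)) ≤ S) N₁0
      clear_value S
      linarith

theorem exists_energy_estimate (hτ : 0 < τ) (hκ : 0 < κ) (hG : 0 < G) (hζ : 0 < ζ)
    (hβ : τ * G < β) (H K : Type*) [NormedAddCommGroup H] [InnerProductSpace ℝ H]
    [NormedAddCommGroup K] [InnerProductSpace ℝ K] :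
    ∃ C : ℝ, 0 < C ∧ ∀ (T lam : ℝ) (gu gv gw m₀ : ℝ → K) (lu lv lw v w m₁ f : ℝ → H)
      (N₀ N₁ P₀ P₁ : ℝ → ℝ),
      IsEnergyTrajectory τ κ β G ζ T gu gv gw m₀ lu lv lw v w m₁ f N₀ N₁ P₀ P₁ →
      0 ≤ lam →
      (∀ t ∈ Ico 0 T, sourceWork (v t + τ • w t) (lv t + τ • lw t) (lu t) (lv t) (w t) (f t)
        ≤ lam * dissipation (gv t) (gv t + τ • gw t) (lu t) (lv t) (w t) (N₀ t) (N₁ t)) →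
      ∀ t ∈ Icc 0 T,
        energy (gu t) (gv t) (gv t + τ • gw t) (v t + τ • w t) (lu t) (lv t) (w t) (N₀ t) (N₁ t)
          + ∫ s in (0 : ℝ)..t,
            dissipation (gv s) (gv s + τ • gw s) (lu s) (lv s) (w s) (N₀ s) (N₁ s)
        ≤ C * (energy (gu 0) (gv 0) (gv 0 + τ • gw 0) (v 0 + τ • w 0) (lu 0) (lv 0) (w 0)
            (N₀ 0) (N₁ 0)
          + lam * ∫ s in (0 : ℝ)..t,
            dissipation (gv s) (gv s + τ • gw s) (lu s) (lv s) (w s) (N₀ s) (N₁ s)) := by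
  obtain ⟨M, δ, c, C, hM, hδ, hc, hC, hD, hE⟩ :=
    exists_dissipation_bound (H := H) (K := K) hτ hκ hG hζ hβ
  refine ⟨C / c, by positivity, fun T lam gu gv gw m₀ lu lv lw v w m₁ f N₀ N₁ P₀ P₁ X hlam hF t ht
    => ?_⟩
  set D : ℝ → ℝ := fun s =>
    dissipation (gv s) (gv s + τ • gw s) (lu s) (lv s) (w s) (N₀ s) (N₁ s) with hDdef
  have hm : ∀ t, 0 ≤ P₀ t := fun t =>
    nonneg_of_mul_nonneg_right ((sq_nonneg _).trans (X.bound_m₀ t)) hG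
  have hDc : Continuous D := by
    have := X.cont_gv; have := X.cont_gw; have := X.cont_lu; have := X.cont_lv
    have := X.cont_w; have := X.cont_N₀; have := X.cont_N₁
    simp only [hDdef, dissipation]
    fun_prop
  have hLc : Continuous fun t => lyapunov M δ τ κ β (gu t) (gv t) (gw t) (m₀ t) (lu t) (lv t) (w t)
        (v t) (m₁ t) (N₀ t) (N₁ t) (P₀ t) (P₁ t) := by
    have := X.cont_gv; have := X.cont_gw; have := X.cont_lu; have := X.cont_lv
    have := X.cont_w; have := X.cont_N₀; have := X.cont_N₁
    have := X.cont_gu; have := X.cont_m₀; have := X.cont_v; have := X.cont_m₁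
    have := X.cont_P₀; have := X.cont_P₁
    simp only [lyapunov]
    fun_prop
  have key := le_add_integral_of_upperRightDerivLE (B := fun s => (-c + C * lam) * D s) (T := T) hLc
    (by fun_prop) (fun s hs => by
      refine UpperRightDerivLE.mono (X.upperRightDerivLE_lyapunov hτ hM hs) ?_
      refine (hD _ _ _ _ _ _ _ _ _ _ _ _ (X.bound_m₁ s) (X.bound_P₁ s) ?_).trans ?_
      · exact (mul_nonneg hζ.le (hm s)).trans (X.bound_P₀ s)
      · have := mul_le_mul_of_nonneg_left (hF s hs) hC.le
        simp only [hDdef]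
        linarith) t ht
  simp only [intervalIntegral.integral_const_mul] at key
  obtain ⟨h1, -⟩ := hE _ _ _ _ _ _ _ _ _ _ _ _ _ (X.bound_m₀ t) (X.bound_P₀ t) (X.bound_m₁ t)
    (X.bound_P₁ t) (X.green_u t) (X.green_v t)
  obtain ⟨-, h2⟩ := hE _ _ _ _ _ _ _ _ _ _ _ _ _ (X.bound_m₀ 0) (X.bound_P₀ 0) (X.bound_m₁ 0)
    (X.bound_P₁ 0) (X.green_u 0) (X.green_v 0)
  rw [div_mul_eq_mul_div, le_div_iff₀ hc]
  linarith

end IsEnergyTrajectory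
end Abstract

end JMGT
end

noncomputable section

namespace JMGT

local notation "⟪" x ", " y "⟫" => inner ℝ x y

/-! ### The memory kernel -/

/-- Nonnegative, nonincreasing, continuous and integrable weights on `(0, ∞)`. -/
structure IsWeight (p : ℝ → ℝ) : Prop where
  cont : ContinuousOn p (Ioi 0)
  anti : AntitoneOn p (Ioi 0)
  nonneg : ∀ s, 0 < s → 0 ≤ p s
  integrable : IntegrableOn p (Ioi 0)

namespace IsMemoryKernel

variable {c : ℝ} {g : ℝ → ℝ}

theorem deriv_nonpos (hg : IsMemoryKernel c g) {s : ℝ} (hs : 0 < s) : deriv g s ≤ 0 := by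
  obtain ⟨ζ, hζ, h⟩ := hg.decay
  have := mul_nonneg hζ.le (hg.nonneg s hs)
  linarith [h s hs]

theorem continuousOn (hg : IsMemoryKernel c g) : ContinuousOn g (Ioi 0) := fun s hs =>
  (hg.differentiable s hs).continuousAt.continuousWithinAt

theorem continuousOn_deriv (hg : IsMemoryKernel c g) : ContinuousOn (deriv g) (Ioi 0) := by
  intro s hs
  have hs' : 0 < s := hs
  have h := (hg.absCont_deriv (s / 2) (2 * s) (by positivity) (by linarith)).continuousOn
  rw [uIcc_of_le (by linarith)] at h
  exact (h.continuousAt (Icc_mem_nhds (by linarith) (by linarith))).continuousWithinAt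

theorem monotoneOn_deriv (hg : IsMemoryKernel c g) : MonotoneOn (deriv g) (Ioi 0) := by
  intro p hp q _ hpq
  have h := (hg.absCont_deriv p q hp hpq).integral_deriv_eq_sub
  have : 0 ≤ ∫ x in p..q, deriv (deriv g) x := by
    refine intervalIntegral.integral_nonneg_of_ae_restrict hpq ?_
    refine ae_restrict_of_ae_restrict_of_subset ?_ hg.second_deriv_nonneg
    intro x hx
    exact lt_of_lt_of_le hp hx.1
  linarith

theorem antitoneOn (hg : IsMemoryKernel c g) : AntitoneOn g (Ioi 0) := by
  refine antitoneOn_of_deriv_nonpos (convex_Ioi 0) hg.continuousOn ?_ ?_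
  · rw [interior_Ioi]
    exact fun s hs => (hg.differentiable s hs).differentiableWithinAt
  · rw [interior_Ioi]
    exact fun s hs => hg.deriv_nonpos hs

theorem isWeight (hg : IsMemoryKernel c g) : IsWeight g :=
  ⟨hg.continuousOn, hg.antitoneOn, hg.nonneg, hg.integrable⟩

theorem isWeight_deriv (hg : IsMemoryKernel c g) : IsWeight fun s => -deriv g s :=
  ⟨hg.continuousOn_deriv.neg, hg.monotoneOn_deriv.neg,
    fun _ hs => neg_nonneg.2 (hg.deriv_nonpos hs), hg.integrable_deriv.neg⟩

theorem deriv_eq_zero (hg : IsMemoryKernel c g) {s : ℝ} (hs : 0 < s) (h : g s = 0) :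
    deriv g s = 0 := by
  refine IsLocalMin.deriv_eq_zero ?_
  filter_upwards [lt_mem_nhds hs] with r hr
  rw [h]
  exact hg.nonneg r hr

theorem exists_deriv_eq (hg : IsMemoryKernel c g) {s h : ℝ} (hs : 0 < s) (hh : 0 < h) :
    ∃ r, s < r ∧ r < s + h ∧ g (s + h) - g s = h * deriv g r := by
  obtain ⟨r, hr, h1⟩ := exists_deriv_eq_slope g (a := s) (b := s + h) (by linarith)
    (hg.continuousOn.mono fun x hx => lt_of_lt_of_le hs hx.1)
    (fun x hx => (hg.differentiable x (hs.trans hx.1)).differentiableWithinAt)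
  refine ⟨r, hr.1, hr.2, ?_⟩
  rw [h1, add_sub_cancel_left, mul_div_cancel₀ _ hh.ne']

theorem apply_add_le (hg : IsMemoryKernel c g) {s h : ℝ} (hs : 0 < s) (hh : 0 < h) :
    g (s + h) ≤ g s - h * -deriv g (s + h) := by
  obtain ⟨r, h1, h2, h3⟩ := hg.exists_deriv_eq hs hh
  have := mul_le_mul_of_nonneg_left (hg.monotoneOn_deriv (show r ∈ Ioi 0 from hs.trans h1)
    (show s + h ∈ Ioi 0 from (hs.trans h1).trans h2) h2.le) hh.le
  linarith

theorem abs_slope_le (hg : IsMemoryKernel c g) {s h : ℝ} (hs : 0 < s) (hh : 0 < h) :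
    |h⁻¹ * (g (s + h) - g s)| ≤ -deriv g s := by
  obtain ⟨r, h1, h2, h3⟩ := hg.exists_deriv_eq hs hh
  rw [h3, inv_mul_cancel_left₀ hh.ne', abs_of_nonpos (hg.deriv_nonpos (hs.trans h1))]
  exact neg_le_neg (hg.monotoneOn_deriv hs (hs.trans h1) h1.le)

end IsMemoryKernel

/-! ### Integrals of shifted weights -/

theorem integral_Ioi_eq_add_shift {E : Type*} [NormedAddCommGroup E] [NormedSpace ℝ E]
    {f : ℝ → E} {h : ℝ} (hh : 0 ≤ h) (hf : IntegrableOn f (Ioi 0)) :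
    ∫ s in Ioi 0, f s = (∫ s in Ioc 0 h, f s) + ∫ s in Ioi 0, f (s + h) := by
  have h0 : ∫ s in Ioi 0, f s = (∫ s in Ioc 0 h, f s) + ∫ s in Ioi h, f s := by
    rw [← setIntegral_union (by simp) measurableSet_Ioi (hf.mono_set Ioc_subset_Ioi_self) (hf.mono_set (Ioi_subset_Ioi hh)),
      Ioc_union_Ioi_eq_Ioi hh]
  rw [h0]
  congr 1
  have h1 := (measurePreserving_add_right volume h).setIntegral_preimage_emb
    (measurableEmbedding_addRight h) f (Ioi h)
  rw [← h1]
  congr 2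
  ext s
  simp

namespace IsWeight

variable {p : ℝ → ℝ} {E : Type*} [NormedAddCommGroup E] [NormedSpace ℝ E] {f : ℝ → E}

theorem continuousOn_shift (hp : IsWeight p) {h : ℝ} (hh : 0 ≤ h) :
    ContinuousOn (fun s => p (s + h)) (Ioi 0) :=
  hp.cont.comp (by fun_prop) fun s hs => add_pos_of_pos_of_nonneg hs hh

theorem shift_le (hp : IsWeight p) {h s : ℝ} (hh : 0 ≤ h) (hs : 0 < s) : p (s + h) ≤ p s :=
  hp.anti hs (show 0 < s + h by linarith) (by linarith)

theorem shift_nonneg (hp : IsWeight p) {h s : ℝ} (hh : 0 ≤ h) (hs : 0 < s) : 0 ≤ p (s + h) :=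
  hp.nonneg _ (by linarith)

theorem shift (hp : IsWeight p) {h : ℝ} (hh : 0 ≤ h) : IsWeight fun s => p (s + h) where
  cont := hp.continuousOn_shift hh
  anti := fun x hx y hy hxy => hp.anti (show 0 < x + h from add_pos_of_pos_of_nonneg hx hh)
    (show 0 < y + h from add_pos_of_pos_of_nonneg hy hh) (by linarith)
  nonneg := fun s hs => hp.shift_nonneg hh hs
  integrable := by
    refine Integrable.mono hp.integrable ((hp.continuousOn_shift hh).aestronglyMeasurable measurableSet_Ioi) ?_
    filter_upwards [ae_restrict_mem measurableSet_Ioi] with s hs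
    rw [Real.norm_of_nonneg (hp.shift_nonneg hh hs), Real.norm_of_nonneg (hp.nonneg s hs)]
    exact hp.shift_le hh hs

theorem integrableOn_shift_smul (hp : IsWeight p) {h : ℝ} (hh : 0 ≤ h)
    (hf : AEStronglyMeasurable f (volume.restrict (Ioi 0)))
    (hi : IntegrableOn (fun s => p s • f s) (Ioi 0)) :
    IntegrableOn (fun s => p (s + h) • f s) (Ioi 0) := by
  refine Integrable.mono hi
    (((hp.continuousOn_shift hh).aestronglyMeasurable measurableSet_Ioi).smul hf) ?_
  filter_upwards [ae_restrict_mem measurableSet_Ioi] with s hs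
  rw [norm_smul, norm_smul, Real.norm_of_nonneg (hp.shift_nonneg hh hs),
    Real.norm_of_nonneg (hp.nonneg s hs)]
  exact mul_le_mul_of_nonneg_right (hp.shift_le hh hs) (norm_nonneg _)

theorem tendsto_integral_shift_smul (hp : IsWeight p)
    (hf : AEStronglyMeasurable f (volume.restrict (Ioi 0)))
    (hi : IntegrableOn (fun s => p s • f s) (Ioi 0)) :
    Tendsto (fun h => ∫ s in Ioi 0, p (s + h) • f s) (𝓝[>] 0) (𝓝 (∫ s in Ioi 0, p s • f s)) := by
  refine tendsto_integral_filter_of_dominated_convergence (fun s => ‖p s • f s‖) ?_ ?_ hi.norm ?_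
  · filter_upwards [self_mem_nhdsWithin] with h hh
    exact (hp.integrableOn_shift_smul (le_of_lt hh) hf hi).aestronglyMeasurable
  · filter_upwards [self_mem_nhdsWithin] with h (hh : 0 < h)
    filter_upwards [ae_restrict_mem measurableSet_Ioi] with s hs
    rw [norm_smul, norm_smul, Real.norm_of_nonneg (hp.shift_nonneg hh.le hs),
      Real.norm_of_nonneg (hp.nonneg s hs)]
    exact mul_le_mul_of_nonneg_right (hp.shift_le hh.le hs) (norm_nonneg _)
  · filter_upwards [ae_restrict_mem measurableSet_Ioi] with s hs
    have h1 : ContinuousAt p s := hp.cont.continuousAt (Ioi_mem_nhds hs)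
    have h2 : Tendsto (fun h : ℝ => s + h) (𝓝[>] 0) (𝓝 s) := by
      have : Tendsto (fun h : ℝ => s + h) (𝓝 0) (𝓝 (s + 0)) := by
        exact (continuous_const.add continuous_id).tendsto 0
      rw [add_zero] at this
      exact this.mono_left nhdsWithin_le_nhds
    exact (h1.tendsto.comp h2).smul_const _

theorem tendsto_setIntegral_Ioc (hp : IsWeight p) :
    Tendsto (fun h => ∫ s in Ioc 0 h, p s) (𝓝[>] 0) (𝓝 0) := by
  have h1 := (hp.tendsto_integral_shift_smul (f := fun _ => (1 : ℝ)) aestronglyMeasurable_const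
    (by simpa using hp.integrable)).const_sub (∫ s in Ioi 0, p s)
  simp only [smul_eq_mul, mul_one, sub_self] at h1
  refine h1.congr' ?_
  filter_upwards [self_mem_nhdsWithin] with h (hh : 0 < h)
  rw [integral_Ioi_eq_add_shift hh.le hp.integrable]
  ring

variable {X : Type*} [NormedAddCommGroup X] [InnerProductSpace ℝ X] {q : ℝ → X}

theorem integrableOn_smul (hp : IsWeight p) (hq : AEStronglyMeasurable q (volume.restrict (Ioi 0)))
    (hi : IntegrableOn (fun s => p s * ‖q s‖ ^ 2) (Ioi 0)) :
    IntegrableOn (fun s => p s • q s) (Ioi 0) := by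
  refine Integrable.mono' (hp.integrable.add hi)
    ((hp.cont.aestronglyMeasurable measurableSet_Ioi).smul hq) ?_
  filter_upwards [ae_restrict_mem measurableSet_Ioi] with s hs
  rw [norm_smul, Real.norm_of_nonneg (hp.nonneg s hs), Pi.add_apply]
  nlinarith [hp.nonneg s hs, sq_nonneg (‖q s‖ - 1), mul_nonneg (hp.nonneg s hs)
    (sq_nonneg (‖q s‖ - 1)), mul_nonneg (hp.nonneg s hs) (sq_nonneg (‖q s‖))]

theorem integrableOn_norm_add_sq [CompleteSpace X] (hp : IsWeight p)
    (hq : AEStronglyMeasurable q (volume.restrict (Ioi 0)))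
    (hi : IntegrableOn (fun s => p s * ‖q s‖ ^ 2) (Ioi 0)) (δ : X) :
    IntegrableOn (fun s => p s * ‖q s + δ‖ ^ 2) (Ioi 0) ∧
    ∫ s in Ioi 0, p s * ‖q s + δ‖ ^ 2 = (∫ s in Ioi 0, p s * ‖q s‖ ^ 2)
      + 2 * ⟪∫ s in Ioi 0, p s • q s, δ⟫ + (∫ s in Ioi 0, p s) * ‖δ‖ ^ 2 := by
  have h1 := hp.integrableOn_smul hq hi
  have h2 : IntegrableOn (fun s => ⟪p s • q s, δ⟫) (Ioi 0) := h1.inner_const δ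
  have h3 : (fun s => p s * ‖q s + δ‖ ^ 2)
      = fun s => p s * ‖q s‖ ^ 2 + 2 * ⟪p s • q s, δ⟫ + p s * ‖δ‖ ^ 2 := by
    ext s
    rw [norm_add_sq_real, real_inner_smul_left]
    ring
  have h4 := (hi.add (h2.const_mul 2))
  have h5 := Integrable.mul_const hp.integrable (‖δ‖ ^ 2)
  rw [h3]
  refine ⟨h4.add h5, ?_⟩
  have e1 := integral_add h4 h5
  have e2 := integral_add hi (h2.const_mul 2)
  simp only [Pi.add_apply] at e1
  rw [e1, e2, integral_const_mul, integral_mul_const]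
  congr 3
  have := integral_inner (𝕜 := ℝ) h1 δ
  simp only [real_inner_comm δ] at this ⊢
  exact this

theorem norm_integral_smul_sq_le [CompleteSpace X] (hp : IsWeight p)
    (hq : AEStronglyMeasurable q (volume.restrict (Ioi 0)))
    (hi : IntegrableOn (fun s => p s * ‖q s‖ ^ 2) (Ioi 0)) :
    ‖∫ s in Ioi 0, p s • q s‖ ^ 2 ≤ (∫ s in Ioi 0, p s) * ∫ s in Ioi 0, p s * ‖q s‖ ^ 2 := by
  set G := ∫ s in Ioi 0, p s with hG
  set m := ∫ s in Ioi 0, p s • q s with hm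
  set P := ∫ s in Ioi 0, p s * ‖q s‖ ^ 2
  have hG0 : 0 ≤ G := setIntegral_nonneg measurableSet_Ioi fun s hs => hp.nonneg s hs
  have key : ∀ r : ℝ, 0 ≤ P + 2 * (r * ‖m‖ ^ 2) + G * (r ^ 2 * ‖m‖ ^ 2) := by
    intro r
    have h := (hp.integrableOn_norm_add_sq hq hi (r • m)).2
    rw [real_inner_smul_right, ← hm, real_inner_self_eq_norm_sq, norm_smul, mul_pow,
      Real.norm_eq_abs, sq_abs] at h
    rw [← h]
    exact setIntegral_nonneg measurableSet_Ioi fun s hs =>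
      mul_nonneg (hp.nonneg s hs) (sq_nonneg _)
  rcases hG0.eq_or_lt with h0 | h0
  · have hm0 : m = 0 := by
      have h1 : (fun s => p s) =ᵐ[volume.restrict (Ioi 0)] 0 :=
        (setIntegral_eq_zero_iff_of_nonneg_ae (by
          filter_upwards [ae_restrict_mem measurableSet_Ioi] with s hs using hp.nonneg s hs)
          hp.integrable).1 h0.symm
      rw [hm]
      refine integral_eq_zero_of_ae ?_
      filter_upwards [h1] with s hs
      simp only [Pi.zero_apply] at hs ⊢
      rw [hs, zero_smul]
    rw [hm0, ← h0]; simp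
  · have := key (-G⁻¹)
    have h3 : P + 2 * (-G⁻¹ * ‖m‖ ^ 2) + G * ((-G⁻¹) ^ 2 * ‖m‖ ^ 2) = P - ‖m‖ ^ 2 / G := by
      field_simp
      ring
    rw [h3, sub_nonneg, div_le_iff₀ h0] at this
    linarith

end IsWeight

end JMGT
end

noncomputable section

namespace JMGT

local notation "⟪" x ", " y "⟫" => inner ℝ x y

/-! ### Histories -/

theorem upperRightDerivLE_of_slope_le {f R : ℝ → ℝ} {a t : ℝ} (hR : Tendsto R (𝓝[>] t) (𝓝 a))
    (h : ∀ᶠ z in 𝓝[>] t, slope f t z ≤ R z) : UpperRightDerivLE f a t := fun r hr => by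
  filter_upwards [h, hR.eventually (gt_mem_nhds hr)] with z h1 h2 using h1.trans_lt h2

section History

variable {X : Type*} [NormedAddCommGroup X] [InnerProductSpace ℝ X]

/-- The history `η(t, s)` generated by `y = Y'` through `η_t = y - η_s`, `η(t, 0) = 0`, where the
kernel `g` is positive. -/
structure IsHistory (g : ℝ → ℝ) (T : ℝ) (η : ℝ → ℝ → X) (Y y : ℝ → X) : Prop where
  aesm : ∀ t, AEStronglyMeasurable (η t) (volume.restrict (Ioi 0))
  integrable : ∀ t, IntegrableOn (fun s => -deriv g s * ‖η t s‖ ^ 2) (Ioi 0)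
  cont : ∀ t₀, Tendsto (fun t => ∫ s in Ioi 0, -deriv g s * ‖η t s - η t₀ s‖ ^ 2) (𝓝 t₀) (𝓝 0)
  hasDeriv : ∀ t ∈ Ico 0 T, HasDerivWithinAt Y (y t) (Ici t) t
  lip : ∃ M, ∀ t ∈ Icc 0 T, ∀ s ∈ Icc 0 T, ‖Y t - Y s‖ ≤ M * |t - s|
  near : ∀ t ∈ Icc 0 T, ∀ᵐ s, 0 < s → 0 < g s → s < t → η t s = Y t - Y (t - s)
  far : ∀ t₀ t, 0 ≤ t₀ → t₀ < t → t ≤ T → ∀ᵐ s, 0 < s → 0 < g (s + (t - t₀)) →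
    η t (s + (t - t₀)) = η t₀ s + (Y t - Y t₀)

theorem continuous_weighted_norm_sq {p : ℝ → ℝ} (hp : IsWeight p) {η : ℝ → ℝ → X}
    (hm : ∀ t, AEStronglyMeasurable (η t) (volume.restrict (Ioi 0)))
    (hi : ∀ t, IntegrableOn (fun s => p s * ‖η t s‖ ^ 2) (Ioi 0))
    (hc : ∀ t₀, Tendsto (fun t => ∫ s in Ioi 0, p s * ‖η t s - η t₀ s‖ ^ 2) (𝓝 t₀) (𝓝 0)) :
    Continuous fun t => ∫ s in Ioi 0, p s * ‖η t s‖ ^ 2 := by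
  have hq : ∀ f : ℝ → X, ∫ s in Ioi 0, ‖√(p s) • f s‖ ^ 2 = ∫ s in Ioi 0, p s * ‖f s‖ ^ 2 :=
    fun f => setIntegral_congr_fun measurableSet_Ioi fun s hs => by
      simp only [norm_smul, mul_pow, Real.norm_eq_abs, sq_abs, Real.sq_sqrt (hp.nonneg s hs)]
  have hsm : AEStronglyMeasurable (fun s => √(p s)) (volume.restrict (Ioi 0)) :=
    (hp.cont.sqrt).aestronglyMeasurable measurableSet_Ioi
  have hL : ∀ t, MemLp (fun s => √(p s) • η t s) 2 (volume.restrict (Ioi 0)) := by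
    intro t
    refine (memLp_two_iff_integrable_sq_norm (f := fun s => √(p s) • η t s) (hsm.smul (hm t))).2 ?_
    refine (integrableOn_congr_fun (fun s hs => ?_) measurableSet_Ioi).1 (hi t)
    simp only [norm_smul, mul_pow, Real.norm_eq_abs, sq_abs, Real.sq_sqrt (hp.nonneg s hs)]
  have hn : ∀ (f : ℝ → X) (h : MemLp f 2 (volume.restrict (Ioi 0))),
      ‖h.toLp f‖ ^ 2 = ∫ s in Ioi 0, ‖f s‖ ^ 2 := by
    intro f h
    rw [← real_inner_self_eq_norm_sq, L2.inner_def]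
    refine integral_congr_ae ?_
    filter_upwards [h.coeFn_toLp] with s hs
    rw [hs, real_inner_self_eq_norm_sq]
  have hcont : Continuous fun t => (hL t).toLp := by
    rw [continuous_iff_continuousAt]
    intro t₀
    rw [ContinuousAt, tendsto_iff_norm_sub_tendsto_zero]
    have h1 := (hc t₀).sqrt
    rw [Real.sqrt_zero] at h1
    refine h1.congr fun t => ?_
    rw [← MemLp.toLp_sub, ← Real.sqrt_sq (norm_nonneg (MemLp.toLp _ _)), hn, ← hq]
    simp only [Pi.sub_apply, smul_sub]
  refine (hcont.norm.pow 2).congr fun t => ?_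
  rw [Pi.pow_apply, hn, hq]

theorem IsMemoryKernel.integrable_weight {c : ℝ} {g : ℝ → ℝ} (hg : IsMemoryKernel c g) {ζ : ℝ} (hζ : 0 < ζ)
    (hd : ∀ s, 0 < s → deriv g s ≤ -ζ * g s) {f : ℝ → X}
    (hf : AEStronglyMeasurable f (volume.restrict (Ioi 0)))
    (hi : IntegrableOn (fun s => -deriv g s * ‖f s‖ ^ 2) (Ioi 0)) :
    IntegrableOn (fun s => g s * ‖f s‖ ^ 2) (Ioi 0) ∧
      ζ * ∫ s in Ioi 0, g s * ‖f s‖ ^ 2 ≤ ∫ s in Ioi 0, -deriv g s * ‖f s‖ ^ 2 := by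
  have h1 : ∀ s, 0 < s → ζ * (g s * ‖f s‖ ^ 2) ≤ -deriv g s * ‖f s‖ ^ 2 := fun s hs => by
    rw [← mul_assoc]
    exact mul_le_mul_of_nonneg_right (by linarith [hd s hs]) (sq_nonneg _)
  have h2 : IntegrableOn (fun s => g s * ‖f s‖ ^ 2) (Ioi 0) := by
    refine (Integrable.const_mul hi ζ⁻¹).mono' ((hg.continuousOn.aestronglyMeasurable
      measurableSet_Ioi).mul (hf.norm.pow 2)) ?_
    filter_upwards [ae_restrict_mem measurableSet_Ioi] with s hs
    rw [Real.norm_of_nonneg (mul_nonneg (hg.nonneg s hs) (sq_nonneg _)), ← div_eq_inv_mul,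
      le_div_iff₀' hζ]
    exact h1 s hs
  refine ⟨h2, ?_⟩
  rw [← integral_const_mul]
  exact setIntegral_mono_on (h2.const_mul ζ) hi measurableSet_Ioi h1

theorem continuous_weighted_integral [CompleteSpace X] {p : ℝ → ℝ} (hp : IsWeight p) {η : ℝ → ℝ → X}
    (hm : ∀ t, AEStronglyMeasurable (η t) (volume.restrict (Ioi 0)))
    (hi : ∀ t, IntegrableOn (fun s => p s * ‖η t s‖ ^ 2) (Ioi 0))
    (hc : ∀ t₀, Tendsto (fun t => ∫ s in Ioi 0, p s * ‖η t s - η t₀ s‖ ^ 2) (𝓝 t₀) (𝓝 0)) :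
    Continuous fun t => ∫ s in Ioi 0, p s • η t s := by
  rw [continuous_iff_continuousAt]
  intro t₀
  rw [ContinuousAt, tendsto_iff_norm_sub_tendsto_zero]
  have h1 := ((hc t₀).const_mul (∫ s in Ioi 0, p s)).sqrt
  rw [mul_zero, Real.sqrt_zero] at h1
  refine squeeze_zero (fun _ => norm_nonneg _) (fun t => ?_) h1
  refine Real.le_sqrt_of_sq_le ?_
  rw [← integral_sub (hp.integrableOn_smul (hm t) (hi t)) (hp.integrableOn_smul (hm t₀) (hi t₀))]
  simp only [← smul_sub]
  refine hp.norm_integral_smul_sq_le ((hm t).sub (hm t₀)) ?_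
  have h2 : Integrable (fun s => 2 * (p s * ‖η t s‖ ^ 2) + 2 * (p s * ‖η t₀ s‖ ^ 2))
      (volume.restrict (Ioi 0)) := ((hi t).const_mul 2).add ((hi t₀).const_mul 2)
  refine h2.mono' ((hp.cont.aestronglyMeasurable measurableSet_Ioi).mul
    (((hm t).sub (hm t₀)).norm.pow 2)) ?_
  filter_upwards [ae_restrict_mem measurableSet_Ioi] with s hs
  have h3 := hp.nonneg s hs
  simp only [norm_mul, norm_pow, norm_norm, Real.norm_of_nonneg h3]
  have h4 := parallelogram_law_with_norm ℝ (η t s) (η t₀ s)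
  nlinarith [mul_nonneg h3 (sq_nonneg ‖η t s + η t₀ s‖)]

namespace IsHistory

variable {c T : ℝ} {g : ℝ → ℝ} {η : ℝ → ℝ → X} {Y y : ℝ → X}

theorem weight_increment (hη : IsHistory g T η Y y) (hg : IsMemoryKernel c g) {p : ℝ → ℝ}
    (hp0 : ∀ s, 0 < s → g s = 0 → p s = 0)
    {E : Type*} [NormedAddCommGroup E] [NormedSpace ℝ E] {Φ : X → E}
    (hi : ∀ t, IntegrableOn (fun s => p s • Φ (η t s)) (Ioi 0)) {t₀ t : ℝ} (h0 : 0 ≤ t₀)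
    (h1 : t₀ < t) (h2 : t ≤ T) :
    ∫ s in Ioi 0, p s • Φ (η t s) = (∫ s in Ioc 0 (t - t₀), p s • Φ (Y t - Y (t - s)))
      + ∫ s in Ioi 0, p (s + (t - t₀)) • Φ (η t₀ s + (Y t - Y t₀)) := by
  rw [integral_Ioi_eq_add_shift (sub_nonneg.2 h1.le) (hi t)]
  congr 1
  · rw [integral_Ioc_eq_integral_Ioo, integral_Ioc_eq_integral_Ioo]
    refine setIntegral_congr_ae measurableSet_Ioo ?_
    filter_upwards [hη.near t ⟨h0.trans h1.le, h2⟩] with s hs hs'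
    rcases (hg.nonneg s hs'.1).eq_or_lt with h | h
    · rw [hp0 s hs'.1 h.symm, zero_smul, zero_smul]
    · rw [hs hs'.1 h (by linarith [hs'.2])]
  · refine setIntegral_congr_ae measurableSet_Ioi ?_
    filter_upwards [hη.far t₀ t h0 h1 h2] with s hs (hs' : 0 < s)
    rcases (hg.nonneg (s + (t - t₀)) (by linarith)).eq_or_lt with h | h
    · rw [hp0 _ (by linarith) h.symm, zero_smul, zero_smul]
    · rw [hs hs' h]

theorem norm_sq_increment_le (hη : IsHistory g T η Y y) (hg : IsMemoryKernel c g) {p : ℝ → ℝ}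
    (hp : IsWeight p) (hp0 : ∀ s, 0 < s → g s = 0 → p s = 0)
    (hi : ∀ t, IntegrableOn (fun s => p s * ‖η t s‖ ^ 2) (Ioi 0)) {M : ℝ}
    (hM : ∀ t ∈ Icc 0 T, ∀ s ∈ Icc 0 T, ‖Y t - Y s‖ ≤ M * |t - s|) {t₀ t : ℝ} (h0 : 0 ≤ t₀)
    (h1 : t₀ < t) (h2 : t ≤ T) :
    ∫ s in Ioi 0, p s * ‖η t s‖ ^ 2 ≤ (∫ s in Ioi 0, p s) * (M * (t - t₀)) ^ 2
      + ∫ s in Ioi 0, p (s + (t - t₀)) * ‖η t₀ s + (Y t - Y t₀)‖ ^ 2 := by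
  have := hη.weight_increment hg hp0 (Φ := fun x => ‖x‖ ^ 2) hi h0 h1 h2
  simp only [smul_eq_mul] at this
  rw [this]
  gcongr
  have h3 : ∀ s ∈ Ioc 0 (t - t₀), p s * ‖Y t - Y (t - s)‖ ^ 2 ≤ p s * (M * (t - t₀)) ^ 2 := by
    intro s hs
    refine mul_le_mul_of_nonneg_left ?_ (hp.nonneg s hs.1)
    have h4 := hM t ⟨by linarith, h2⟩ (t - s) ⟨by linarith [hs.2], by linarith [hs.1]⟩
    rw [sub_sub_cancel, abs_of_pos hs.1] at h4
    have h5 : 0 ≤ M * s := (norm_nonneg _).trans h4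
    have h6 : 0 ≤ M := nonneg_of_mul_nonneg_left h5 hs.1
    exact pow_le_pow_left₀ (norm_nonneg _) (h4.trans (mul_le_mul_of_nonneg_left hs.2 h6)) 2
  have h7 : IntegrableOn (fun s => p s * (M * (t - t₀)) ^ 2) (Ioi 0) :=
    Integrable.mul_const hp.integrable _
  refine (integral_mono_of_nonneg ?_ (h7.mono_set Ioc_subset_Ioi_self) ?_).trans ?_
  · filter_upwards [ae_restrict_mem measurableSet_Ioc] with s hs
    exact mul_nonneg (hp.nonneg s hs.1) (sq_nonneg _)
  · filter_upwards [ae_restrict_mem measurableSet_Ioc] with s hs using h3 s hs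
  · rw [← integral_mul_const]
    refine setIntegral_mono_set h7 ?_ (ae_of_all _ Ioc_subset_Ioi_self)
    filter_upwards [ae_restrict_mem measurableSet_Ioi] with s hs
    exact mul_nonneg (hp.nonneg s hs) (sq_nonneg _)

theorem tendsto_slope (hη : IsHistory g T η Y y) {t₀ : ℝ} (ht : t₀ ∈ Ico 0 T) :
    Tendsto (fun t => slope Y t₀ t) (𝓝[>] t₀) (𝓝 (y t₀)) := by
  have := hasDerivWithinAt_iff_tendsto_slope.1 (hη.hasDeriv t₀ ht)
  rwa [Ici_sdiff_left] at this

theorem tendsto_sub (hη : IsHistory g T η Y y) {t₀ : ℝ} (ht : t₀ ∈ Ico 0 T) :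
    Tendsto (fun t => Y t - Y t₀) (𝓝[>] t₀) (𝓝 0) := by
  rw [← tendsto_sub_nhds_zero_iff] 
  simpa using ((hη.hasDeriv t₀ ht).continuousWithinAt.tendsto.mono_left
    (nhdsWithin_mono _ Ioi_subset_Ici_self)).sub_const (Y t₀)

theorem tendsto_sub_nhdsGT (t₀ : ℝ) : Tendsto (fun t => t - t₀) (𝓝[>] t₀) (𝓝[>] 0) := by
  refine tendsto_nhdsWithin_iff.2 ⟨?_, ?_⟩
  · have : Tendsto (fun t : ℝ => t - t₀) (𝓝 t₀) (𝓝 (t₀ - t₀)) :=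
      (continuous_id.sub continuous_const).tendsto t₀
    rw [sub_self] at this
    exact this.mono_left nhdsWithin_le_nhds
  · filter_upwards [self_mem_nhdsWithin] with t (ht : t₀ < t)
    exact sub_pos.2 ht

theorem norm_sub_sq_le {M : ℝ} (hM : ∀ t ∈ Icc 0 T, ∀ s ∈ Icc 0 T, ‖Y t - Y s‖ ≤ M * |t - s|)
    {t₀ t : ℝ} (h0 : 0 ≤ t₀) (h1 : t₀ < t) (h2 : t ≤ T) :
    ‖Y t - Y t₀‖ ^ 2 ≤ (M * (t - t₀)) ^ 2 := by
  have := hM t ⟨h0.trans h1.le, h2⟩ t₀ ⟨h0, h1.le.trans h2⟩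
  rw [abs_of_pos (sub_pos.2 h1)] at this
  exact pow_le_pow_left₀ (norm_nonneg _) this 2

theorem upperRightDerivLE_deriv [CompleteSpace X] (hη : IsHistory g T η Y y)
    (hg : IsMemoryKernel c g) {t₀ : ℝ} (ht : t₀ ∈ Ico 0 T) :
    UpperRightDerivLE (fun t => ∫ s in Ioi 0, -deriv g s * ‖η t s‖ ^ 2)
      (2 * ⟪∫ s in Ioi 0, -deriv g s • η t₀ s, y t₀⟫) t₀ := by
  obtain ⟨M, hM⟩ := hη.lip
  have hp := hg.isWeight_deriv
  set I := ∫ s in Ioi 0, -deriv g s with hI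
  set n₀ := ∫ s in Ioi 0, -deriv g s • η t₀ s with hn₀
  have hI0 : 0 ≤ I := setIntegral_nonneg measurableSet_Ioi fun s hs => hp.nonneg s hs
  refine upperRightDerivLE_of_slope_le
    (R := fun t => 2 * I * M ^ 2 * (t - t₀) + 2 * ⟪n₀, slope Y t₀ t⟫) ?_ ?_
  · have h1 := ((tendsto_sub_nhdsGT t₀).mono_right nhdsWithin_le_nhds).const_mul (2 * I * M ^ 2)
    have h2 := ((tendsto_const_nhds (x := n₀)).inner (hη.tendsto_slope ht) (𝕜 := ℝ)).const_mul 2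
    simpa using h1.add h2
  · filter_upwards [Ioc_mem_nhdsGT ht.2] with t h
    have hh : 0 < t - t₀ := sub_pos.2 h.1
    have h1 := hη.norm_sq_increment_le hg hp (fun s hs h0 => by rw [hg.deriv_eq_zero hs h0, neg_zero])
      hη.integrable hM ht.1 h.1 h.2
    have h2 := hp.integrableOn_norm_add_sq (hη.aesm t₀) (hη.integrable t₀) (Y t - Y t₀)
    have h3 : ∫ s in Ioi 0, -deriv g (s + (t - t₀)) * ‖η t₀ s + (Y t - Y t₀)‖ ^ 2
        ≤ ∫ s in Ioi 0, -deriv g s * ‖η t₀ s + (Y t - Y t₀)‖ ^ 2 := by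
      refine setIntegral_mono_on ?_ h2.1 measurableSet_Ioi fun s hs =>
        mul_le_mul_of_nonneg_right (hp.shift_le hh.le hs) (sq_nonneg _)
      exact hp.integrableOn_shift_smul hh.le
        (((hη.aesm t₀).add aestronglyMeasurable_const).norm.pow 2) h2.1
    have h4 := mul_le_mul_of_nonneg_left (norm_sub_sq_le hM ht.1 h.1 h.2) hI0
    rw [h2.2, ← hn₀, ← hI] at h3
    rw [← hI] at h1
    have h5 : ⟪n₀, Y t - Y t₀⟫ = (t - t₀) * ⟪n₀, slope Y t₀ t⟫ := by
      rw [slope, vsub_eq_sub, real_inner_smul_right, mul_inv_cancel_left₀ hh.ne']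
    rw [slope_def_field, div_le_iff₀ hh]
    rw [h5] at h3
    linarith

theorem upperRightDerivLE_kernel [CompleteSpace X] (hη : IsHistory g T η Y y)
    (hg : IsMemoryKernel c g) {t₀ : ℝ} (ht : t₀ ∈ Ico 0 T) :
    UpperRightDerivLE (fun t => ∫ s in Ioi 0, g s * ‖η t s‖ ^ 2)
      (2 * ⟪∫ s in Ioi 0, g s • η t₀ s, y t₀⟫ - ∫ s in Ioi 0, -deriv g s * ‖η t₀ s‖ ^ 2) t₀ := by
  obtain ⟨M, hM⟩ := hη.lip
  obtain ⟨ζ, hζ, hd⟩ := hg.decay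
  have hi := fun t => (hg.integrable_weight hζ hd (hη.aesm t) (hη.integrable t)).1
  have hp := hg.isWeight
  have hp' := hg.isWeight_deriv
  set G := ∫ s in Ioi 0, g s with hG
  set m₀ := ∫ s in Ioi 0, g s • η t₀ s with hm₀
  have hG0 : 0 ≤ G := setIntegral_nonneg measurableSet_Ioi fun s hs => hp.nonneg s hs
  refine upperRightDerivLE_of_slope_le
    (R := fun t => 2 * G * M ^ 2 * (t - t₀) + 2 * ⟪m₀, slope Y t₀ t⟫
      - ((∫ s in Ioi 0, -deriv g (s + (t - t₀)) • ‖η t₀ s‖ ^ 2)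
        + 2 * ⟪∫ s in Ioi 0, -deriv g (s + (t - t₀)) • η t₀ s, Y t - Y t₀⟫)) ?_ ?_
  · have h1 := ((tendsto_sub_nhdsGT t₀).mono_right nhdsWithin_le_nhds).const_mul (2 * G * M ^ 2)
    have h2 := ((tendsto_const_nhds (x := m₀)).inner (hη.tendsto_slope ht) (𝕜 := ℝ)).const_mul 2
    have h3 := (hp'.tendsto_integral_shift_smul ((hη.aesm t₀).norm.pow 2)
      (hη.integrable t₀)).comp (tendsto_sub_nhdsGT t₀)
    have h4 := (hp'.tendsto_integral_shift_smul (hη.aesm t₀)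
      (hp'.integrableOn_smul (hη.aesm t₀) (hη.integrable t₀))).comp (tendsto_sub_nhdsGT t₀)
    have h5 := (h4.inner (hη.tendsto_sub ht) (𝕜 := ℝ)).const_mul 2
    simpa using (h1.add h2).sub (h3.add h5)
  · filter_upwards [Ioc_mem_nhdsGT ht.2] with t h
    have hh : 0 < t - t₀ := sub_pos.2 h.1
    have h1 := hη.norm_sq_increment_le hg hp (fun s hs h0 => h0) hi hM ht.1 h.1 h.2
    have h2 := hp.integrableOn_norm_add_sq (hη.aesm t₀) (hi t₀) (Y t - Y t₀)
    have ha := ((hη.aesm t₀).add (aestronglyMeasurable_const (b := Y t - Y t₀))).norm.pow 2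
    have h6 := (hp'.shift hh.le).integrableOn_norm_add_sq (hη.aesm t₀)
      (hp'.integrableOn_shift_smul hh.le ((hη.aesm t₀).norm.pow 2) (hη.integrable t₀)) (Y t - Y t₀)
    have h3 : ∫ s in Ioi 0, g (s + (t - t₀)) * ‖η t₀ s + (Y t - Y t₀)‖ ^ 2
        ≤ ∫ s in Ioi 0, (g s * ‖η t₀ s + (Y t - Y t₀)‖ ^ 2
          - (t - t₀) * (-deriv g (s + (t - t₀)) * ‖η t₀ s + (Y t - Y t₀)‖ ^ 2)) := by
      refine setIntegral_mono_on ?_ (h2.1.sub (h6.1.const_mul _)) measurableSet_Ioi fun s hs => ?_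
      · exact hp.integrableOn_shift_smul hh.le ha h2.1
      · rw [← mul_assoc, ← sub_mul]
        exact mul_le_mul_of_nonneg_right (hg.apply_add_le hs hh) (sq_nonneg _)
    have h7 : 0 ≤ (∫ s in Ioi 0, -deriv g (s + (t - t₀))) * ‖Y t - Y t₀‖ ^ 2 :=
      mul_nonneg (setIntegral_nonneg measurableSet_Ioi fun s hs => hp'.shift_nonneg hh.le hs)
        (sq_nonneg _)
    have h4 := mul_le_mul_of_nonneg_left (norm_sub_sq_le hM ht.1 h.1 h.2) hG0
    rw [integral_sub h2.1 (h6.1.const_mul _), integral_const_mul, h2.2, h6.2, ← hm₀, ← hG] at h3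
    rw [← hG] at h1
    have h5 : ⟪m₀, Y t - Y t₀⟫ = (t - t₀) * ⟪m₀, slope Y t₀ t⟫ := by
      rw [slope, vsub_eq_sub, real_inner_smul_right, mul_inv_cancel_left₀ hh.ne']
    rw [slope_def_field, div_le_iff₀ hh]
    rw [h5] at h3
    have h8 := mul_nonneg hh.le h7
    simp only [smul_eq_mul]
    linarith

theorem hasDerivWithinAt_integral [CompleteSpace X] (hη : IsHistory g T η Y y)
    (hg : IsMemoryKernel c g) {t₀ : ℝ} (ht : t₀ ∈ Ico 0 T) :
    HasDerivWithinAt (fun t => ∫ s in Ioi 0, g s • η t s)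
      ((∫ s in Ioi 0, g s) • y t₀ - ∫ s in Ioi 0, -deriv g s • η t₀ s) (Ici t₀) t₀ := by
  obtain ⟨M, hM⟩ := hη.lip
  obtain ⟨ζ, hζ, hd⟩ := hg.decay
  have hi := fun t => (hg.integrable_weight hζ hd (hη.aesm t) (hη.integrable t)).1
  have hp := hg.isWeight
  have hp' := hg.isWeight_deriv
  have hi1 := fun t => hp.integrableOn_smul (hη.aesm t) (hi t)
  have hi2 := fun t => hp'.integrableOn_smul (hη.aesm t) (hη.integrable t)
  rw [hasDerivWithinAt_iff_tendsto_slope, Ici_sdiff_left]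
  have l1 : Tendsto (fun t => (t - t₀)⁻¹ • ∫ s in Ioc 0 (t - t₀), g s • (Y t - Y (t - s)))
      (𝓝[>] t₀) (𝓝 0) := by
    rw [tendsto_zero_iff_norm_tendsto_zero]
    have h1 := (hp.tendsto_setIntegral_Ioc.comp (tendsto_sub_nhdsGT t₀)).mul_const M
    rw [zero_mul] at h1
    refine squeeze_zero' (Eventually.of_forall fun _ => norm_nonneg _) ?_ h1
    filter_upwards [Ioc_mem_nhdsGT ht.2] with t h
    have hh : 0 < t - t₀ := sub_pos.2 h.1
    rw [norm_smul, norm_inv, Real.norm_of_nonneg hh.le, inv_mul_le_iff₀ hh, Function.comp_apply,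
      ← integral_mul_const, ← integral_const_mul]
    refine norm_integral_le_of_norm_le ?_ ?_
    · exact ((hp.integrable.mono_set Ioc_subset_Ioi_self).mul_const M).const_mul _
    · filter_upwards [ae_restrict_mem measurableSet_Ioc] with s hs
      have h4 := hM t ⟨by linarith [ht.1], h.2⟩ (t - s) ⟨by linarith [hs.2, ht.1], by linarith [hs.1, h.2]⟩
      rw [sub_sub_cancel, abs_of_pos hs.1] at h4
      have h5 : 0 ≤ M * s := (norm_nonneg _).trans h4
      have h6 : 0 ≤ M := nonneg_of_mul_nonneg_left h5 hs.1
      have h7 := hp.nonneg s hs.1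
      rw [norm_smul, Real.norm_of_nonneg h7]
      calc g s * ‖Y t - Y (t - s)‖ ≤ g s * (M * (t - t₀)) := mul_le_mul_of_nonneg_left
            (h4.trans (mul_le_mul_of_nonneg_left hs.2 h6)) h7
        _ = _ := by ring
  have l2 : Tendsto (fun h => ∫ s in Ioi 0, (h⁻¹ * (g (s + h) - g s)) • η t₀ s)
      (𝓝[>] 0) (𝓝 (∫ s in Ioi 0, deriv g s • η t₀ s)) := by
    refine tendsto_integral_filter_of_dominated_convergence (fun s => ‖-deriv g s • η t₀ s‖) ?_ ?_
      (hi2 t₀).norm ?_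
    · filter_upwards [self_mem_nhdsWithin] with h (hh : 0 < h)
      exact (((((hp.continuousOn_shift hh.le).sub hp.cont).const_smul h⁻¹).aestronglyMeasurable
        measurableSet_Ioi)).smul (hη.aesm t₀)
    · filter_upwards [self_mem_nhdsWithin] with h (hh : 0 < h)
      filter_upwards [ae_restrict_mem measurableSet_Ioi] with s hs
      rw [norm_smul, norm_smul, Real.norm_of_nonneg (hp'.nonneg s hs)]
      exact mul_le_mul_of_nonneg_right (hg.abs_slope_le hs hh) (norm_nonneg _)
    · filter_upwards [ae_restrict_mem measurableSet_Ioi] with s hs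
      have := (hg.differentiable s hs).hasDerivAt.tendsto_slope_zero_right
      exact this.smul_const _
  have l3 : Tendsto (fun h => ∫ s in Ioi 0, g (s + h)) (𝓝[>] 0) (𝓝 (∫ s in Ioi 0, g s)) := by
    simpa using hp.tendsto_integral_shift_smul (f := fun _ => (1 : ℝ)) aestronglyMeasurable_const
      (by simpa using hp.integrable)
  have l4 := (l1.add (l2.comp (tendsto_sub_nhdsGT t₀))).add
    ((l3.comp (tendsto_sub_nhdsGT t₀)).smul (hη.tendsto_slope ht))
  have e : (0 + ∫ s in Ioi 0, deriv g s • η t₀ s) + (∫ s in Ioi 0, g s) • y t₀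
      = (∫ s in Ioi 0, g s) • y t₀ - ∫ s in Ioi 0, -deriv g s • η t₀ s := by
    simp only [neg_smul, integral_neg]
    abel
  rw [e] at l4
  refine l4.congr' ?_
  filter_upwards [Ioc_mem_nhdsGT ht.2] with t h
  have hh : 0 < t - t₀ := sub_pos.2 h.1
  have hs1 := hp.integrableOn_shift_smul hh.le (hη.aesm t₀) (hi1 t₀)
  have h1 := hη.weight_increment hg (fun s hs h0 => h0) (Φ := fun x => x) hi1 ht.1 h.1 h.2
  have h2 : ∫ s in Ioi 0, g (s + (t - t₀)) • (η t₀ s + (Y t - Y t₀))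
      = (∫ s in Ioi 0, g (s + (t - t₀)) • η t₀ s) + (∫ s in Ioi 0, g (s + (t - t₀))) • (Y t - Y t₀) := by
    simp only [smul_add]
    rw [integral_add hs1 ((hp.shift hh.le).integrable.smul_const _), integral_smul_const]
  have h3 : ∫ s in Ioi 0, ((t - t₀)⁻¹ * (g (s + (t - t₀)) - g s)) • η t₀ s
      = (t - t₀)⁻¹ • ((∫ s in Ioi 0, g (s + (t - t₀)) • η t₀ s) - ∫ s in Ioi 0, g s • η t₀ s) := by
    rw [← integral_sub hs1 (hi1 t₀), ← integral_smul]
    simp only [mul_smul, sub_smul]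
  simp only [Function.comp_apply, h3, slope, vsub_eq_sub, h1, h2]
  simp only [smul_sub, smul_add]
  rw [smul_comm (∫ s in Ioi 0, g (s + (t - t₀))) ((t - t₀)⁻¹) (Y t),
    smul_comm (∫ s in Ioi 0, g (s + (t - t₀))) ((t - t₀)⁻¹) (Y t₀)]
  abel

/-- The differential inequality for the memory part of the energy. -/
theorem upperRightDerivLE_memory [CompleteSpace X] (hη : IsHistory g T η Y y)
    (hg : IsMemoryKernel c g) {τ : ℝ} (hτ : 0 < τ) {y' : ℝ → X}
    (hy : ∀ t ∈ Ico 0 T, HasDerivWithinAt y (y' t) (Ici t) t) {t₀ : ℝ} (ht : t₀ ∈ Ico 0 T) :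
    UpperRightDerivLE (fun t => τ * (∫ s in Ioi 0, -deriv g s * ‖η t s‖ ^ 2)
        + (∫ s in Ioi 0, g s * ‖η t s‖ ^ 2) + 2 * τ * ⟪∫ s in Ioi 0, g s • η t s, y t⟫)
      (2 * ⟪∫ s in Ioi 0, g s • η t₀ s, y t₀⟫ - (∫ s in Ioi 0, -deriv g s * ‖η t₀ s‖ ^ 2)
        + 2 * τ * (∫ s in Ioi 0, g s) * ‖y t₀‖ ^ 2
        + 2 * τ * ⟪∫ s in Ioi 0, g s • η t₀ s, y' t₀⟫) t₀ := by
  have h1 := (((hη.upperRightDerivLE_deriv hg ht).const_mul hτ).add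
    (hη.upperRightDerivLE_kernel hg ht)).add (upperRightDerivLE_of_hasDerivWithinAt
      (((hη.hasDerivWithinAt_integral hg ht).inner ℝ (hy t₀ ht)).const_mul (2 * τ)))
  refine UpperRightDerivLE.mono h1 (le_of_eq ?_)
  rw [inner_sub_left, real_inner_smul_left, real_inner_self_eq_norm_sq]
  ring

end IsHistory
end History
end JMGT
end

noncomputable section

namespace JMGT

variable {n : ℕ}

/-! ### Test functions and weak derivatives -/

/-- The classical partial derivative. -/
def pd (i : Fin n) (φ : Rn n → ℝ) : Rn n → ℝ :=
  fun x => fderiv ℝ φ x (EuclideanSpace.single i 1)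

theorem contDiff_pd {φ : Rn n → ℝ} (hφ : ContDiff ℝ ∞ φ) (i : Fin n) : ContDiff ℝ ∞ (pd i φ) :=
  (hφ.fderiv_right (m := ∞) (by simp)).clm_apply contDiff_const

theorem pd_mul {φ χ : Rn n → ℝ} (hφ : ContDiff ℝ ∞ φ) (hχ : ContDiff ℝ ∞ χ) (i : Fin n)
    (x : Rn n) : pd i (fun x => φ x * χ x) x = φ x * pd i χ x + pd i φ x * χ x := by
  have h1 := (hφ.differentiable (by simp)) x
  have h2 := (hχ.differentiable (by simp)) x
  simp only [pd]
  rw [fderiv_fun_mul h1 h2]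
  simp only [add_apply, smul_apply, smul_eq_mul]
  ring

theorem pd_comm {φ : Rn n → ℝ} (hφ : ContDiff ℝ ∞ φ) (i l : Fin n) (x : Rn n) :
    pd i (pd l φ) x = pd l (pd i φ) x := by
  have h : ∀ a b : Fin n, pd a (pd b φ) x
      = fderiv ℝ (fderiv ℝ φ) x (EuclideanSpace.single a 1) (EuclideanSpace.single b 1) := by
    intro a b
    have h1 : DifferentiableAt ℝ (fderiv ℝ φ) x :=
      ((hφ.fderiv_right (m := ∞) (by simp)).differentiable (by simp)) x
    change fderiv ℝ (fun y => fderiv ℝ φ y (EuclideanSpace.single b 1)) x _ = _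
    rw [fderiv_clm_apply h1 (differentiableAt_const _)]
    simp
  rw [h, h]
  exact ((contDiff_infty.1 hφ 2).contDiffAt.isSymmSndFDerivAt (n := 2) (by simp)) _ _

theorem laplacian_eq_sum_pd {φ : Rn n → ℝ} (hφ : ContDiff ℝ ∞ φ) (x : Rn n) :
    (Δ φ) x = ∑ i, pd i (pd i φ) x := by
  rw [InnerProductSpace.laplacian_eq_iteratedFDeriv_orthonormalBasis φ
    (EuclideanSpace.basisFun (Fin n) ℝ)]
  refine Finset.sum_congr rfl fun i _ => ?_
  have h1 : DifferentiableAt ℝ (fderiv ℝ φ) x :=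
    ((hφ.fderiv_right (m := ∞) (by simp)).differentiable (by simp)) x
  change _ = fderiv ℝ (fun y => fderiv ℝ φ y (EuclideanSpace.single i 1)) x _
  rw [iteratedFDeriv_two_apply, fderiv_clm_apply h1 (differentiableAt_const _)]
  simp

namespace IsTestFunction

variable {φ χ : Rn n → ℝ}

theorem continuous (hφ : IsTestFunction φ) : Continuous φ := hφ.1.continuous

theorem pd (hφ : IsTestFunction φ) (i : Fin n) : IsTestFunction (pd i φ) :=
  ⟨contDiff_pd hφ.1 i, hφ.2.fderiv_apply ℝ _⟩

theorem mul (hφ : IsTestFunction φ) (hχ : ContDiff ℝ ∞ χ) :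
    IsTestFunction fun x => χ x * φ x :=
  ⟨hχ.mul hφ.1, hφ.2.mul_left⟩

theorem laplacian (hφ : IsTestFunction φ) : IsTestFunction (Δ φ) := by
  have h : (Δ φ) = fun x => ∑ i, JMGT.pd i (JMGT.pd i φ) x :=
    funext fun x => laplacian_eq_sum_pd hφ.1 x
  rw [h]
  refine ⟨ContDiff.sum fun i _ => ((hφ.pd i).pd i).1, ?_⟩
  have : ∀ s : Finset (Fin n), HasCompactSupport fun x => ∑ i ∈ s, JMGT.pd i (JMGT.pd i φ) x := by
    intro s
    classical
    induction s using Finset.induction_on with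
    | empty => simpa using! HasCompactSupport.zero
    | insert a s ha ih =>
      simp only [Finset.sum_insert ha]
      exact ((hφ.pd a).pd a).2.add ih
  exact this _

theorem memLp (hφ : IsTestFunction φ) (p : ℝ≥0∞) : MemLp φ p volume :=
  hφ.continuous.memLp_of_hasCompactSupport hφ.2

theorem integrable_mul (hφ : IsTestFunction φ) {f : Rn n → ℝ} (hf : LocallyIntegrable f volume) :
    Integrable (fun x => f x * φ x) volume :=
  hf.integrable_smul_right_of_hasCompactSupport hφ.continuous hφ.2

end IsTestFunction

theorem ae_eq_of_integral_test {f f' : Rn n → ℝ} (hf : LocallyIntegrable f volume)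
    (hf' : LocallyIntegrable f' volume)
    (h : ∀ φ, IsTestFunction φ → ∫ x, f x * φ x = ∫ x, f' x * φ x) : f =ᵐ[volume] f' := by
  refine ae_eq_of_integral_contDiff_smul_eq hf hf' fun φ h1 h2 => ?_
  simpa only [smul_eq_mul, mul_comm] using h φ ⟨h1, h2⟩

namespace IsWeakPartial

variable {i : Fin n} {f f' h h' : Rn n → ℝ}

theorem integral_pd (h1 : IsWeakPartial i f f') {φ : Rn n → ℝ} (hφ : IsTestFunction φ) :
    ∫ x, f x * pd i φ x = -∫ x, f' x * φ x := h1.2.2 φ hφ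

theorem unique (h1 : IsWeakPartial i f f') (h2 : IsWeakPartial i f h') : f' =ᵐ[volume] h' :=
  ae_eq_of_integral_test h1.2.1 h2.2.1 fun φ hφ => by
    have a := h1.2.2 φ hφ
    have b := h2.2.2 φ hφ
    linarith

theorem congr_right (h1 : IsWeakPartial i f f') (h2 : f' =ᵐ[volume] h') : IsWeakPartial i f h' := by
  refine ⟨h1.1, h1.2.1.congr h2, fun φ hφ => ?_⟩
  rw [h1.2.2 φ hφ]
  congr 1
  exact integral_congr_ae (h2.mono fun x hx => by simp only [hx])

theorem congr_left (h1 : IsWeakPartial i f f') (h2 : f =ᵐ[volume] h) : IsWeakPartial i h f' := by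
  refine ⟨h1.1.congr h2, h1.2.1, fun φ hφ => ?_⟩
  rw [← h1.2.2 φ hφ]
  exact integral_congr_ae (h2.mono fun x hx => by simp only [hx])

theorem add (h1 : IsWeakPartial i f f') (h2 : IsWeakPartial i h h') :
    IsWeakPartial i (f + h) (f' + h') := by
  refine ⟨h1.1.add h2.1, h1.2.1.add h2.2.1, fun φ hφ => ?_⟩
  have e1 := h1.integral_pd hφ
  have e2 := h2.integral_pd hφ
  change ∫ x, (f + h) x * pd i φ x = _
  simp only [Pi.add_apply, add_mul]
  rw [integral_add ((hφ.pd i).integrable_mul h1.1) ((hφ.pd i).integrable_mul h2.1),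
    integral_add (hφ.integrable_mul h1.2.1) (hφ.integrable_mul h2.2.1), e1, e2]
  ring

theorem smul (h1 : IsWeakPartial i f f') (r : ℝ) : IsWeakPartial i (r • f) (r • f') := by
  refine ⟨h1.1.smul r, h1.2.1.smul r, fun φ hφ => ?_⟩
  simp only [Pi.smul_apply, smul_eq_mul, mul_assoc, integral_const_mul]
  rw [h1.2.2 φ hφ]
  ring

theorem smooth_mul (h1 : IsWeakPartial i f f') {χ : Rn n → ℝ} (hχ : ContDiff ℝ ∞ χ) :
    IsWeakPartial i (fun x => f x * χ x) (fun x => f' x * χ x + f x * pd i χ x) := by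
  have c1 := hχ.continuous
  have c2 := (contDiff_pd hχ i).continuous
  have l1 := LocallyIntegrable.mul_continuous c1 h1.1
  have l2 := LocallyIntegrable.mul_continuous c1 h1.2.1
  have l3 := LocallyIntegrable.mul_continuous c2 h1.1
  refine ⟨l1, l2.add l3, fun φ hφ => ?_⟩
  have h2 := h1.integral_pd (hφ.mul hχ)
  have e : ∀ x, f x * χ x * fderiv ℝ φ x (EuclideanSpace.single i 1)
      = f x * pd i (fun x => χ x * φ x) x - f x * pd i χ x * φ x := fun x => by
    rw [pd_mul hχ hφ.1]
    simp only [pd]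
    ring
  simp only [e, add_mul]
  rw [integral_sub (((hφ.mul hχ).pd i).integrable_mul h1.1) (hφ.integrable_mul l3),
    integral_add (hφ.integrable_mul l2) (hφ.integrable_mul l3)]
  have h3 : ∫ x, f x * pd i (fun x => χ x * φ x) x = -∫ x, f' x * χ x * φ x := by
    simpa only [mul_assoc] using h2
  rw [h3]
  ring

theorem weakPartial_spec (h1 : ∃ f', IsWeakPartial i f f') :
    IsWeakPartial i f (weakPartial i f) := by
  rw [weakPartial, dif_pos h1]
  exact h1.choose_spec

theorem weakPartial_ae_eq (h1 : IsWeakPartial i f f') : weakPartial i f =ᵐ[volume] f' :=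
  (weakPartial_spec ⟨f', h1⟩).unique h1

theorem comm {l : Fin n} {a b c d : Rn n → ℝ} (h1 : IsWeakPartial i f a) (h2 : IsWeakPartial l f b)
    (h3 : IsWeakPartial l a c) (h4 : IsWeakPartial i b d) : c =ᵐ[volume] d := by
  refine ae_eq_of_integral_test h3.2.1 h4.2.1 fun φ hφ => ?_
  have e1 := h3.2.2 φ hφ
  have e2 := h1.2.2 _ (hφ.pd l)
  have e3 := h4.2.2 φ hφ
  have e4 := h2.2.2 _ (hφ.pd i)
  have e5 : ∫ x, f x * fderiv ℝ (JMGT.pd l φ) x (EuclideanSpace.single i 1)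
      = ∫ x, f x * fderiv ℝ (JMGT.pd i φ) x (EuclideanSpace.single l 1) := by
    refine integral_congr_ae (ae_of_all _ fun x => ?_)
    have := pd_comm hφ.1 i l x
    simp only [pd] at this ⊢
    rw [this]
  simp only [pd] at e1 e2 e3 e4 e5
  linarith

end IsWeakPartial

theorem weakPartial_congr {f h : Rn n → ℝ} (hfh : f =ᵐ[volume] h) (i : Fin n) :
    weakPartial i f = weakPartial i h := by
  have : IsWeakPartial i f = IsWeakPartial i h :=
    funext fun f' => propext ⟨fun h1 => h1.congr_left hfh, fun h1 => h1.congr_left hfh.symm⟩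
  unfold weakPartial
  rw [this]

/-! ### Mollification -/

section Mollify

open scoped Convolution

theorem eLpNorm_convolution_le {ρ f : Rn n → ℝ} (hρ : ContDiff ℝ ∞ ρ) (hρc : HasCompactSupport ρ)
    (hρ0 : ∀ x, 0 ≤ ρ x) (hρ1 : ∫ x, ρ x = 1) (hf : MemLp f 2 volume) :
    eLpNorm (ρ ⋆[ContinuousLinearMap.lsmul ℝ ℝ, volume] f) 2 volume ≤ eLpNorm f 2 volume := by
  wlog hm : Measurable f generalizing f
  · have h1 := hf.1.ae_eq_mk
    have h2 := this (hf.ae_eq h1) hf.1.stronglyMeasurable_mk.measurable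
    rwa [← convolution_congr _ (EventuallyEq.refl _ _) h1, ← eLpNorm_congr_ae h1] at h2
  set ν : Measure (Rn n) := volume.withDensity fun x => ENNReal.ofReal (ρ x) with hν
  have hρm : Measurable fun x => ENNReal.ofReal (ρ x) := hρ.continuous.measurable.ennreal_ofReal
  have hρi : Integrable ρ volume := hρ.continuous.integrable_of_hasCompactSupport hρc
  have hprob : IsProbabilityMeasure ν := by
    refine ⟨?_⟩
    rw [hν, withDensity_apply _ MeasurableSet.univ, setLIntegral_univ,
      ← ofReal_integral_eq_lintegral_ofReal hρi (ae_of_all _ hρ0), hρ1, ENNReal.ofReal_one]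
  have hpt : ∀ x, ‖(ρ ⋆[ContinuousLinearMap.lsmul ℝ ℝ, volume] f) x‖ₑ ^ 2
      ≤ ∫⁻ t, ‖f (x - t)‖ₑ ^ 2 ∂ν := by
    intro x
    have hmx : Measurable fun t => f (x - t) := hm.comp (measurable_const.sub measurable_id)
    have h1 : ‖(ρ ⋆[ContinuousLinearMap.lsmul ℝ ℝ, volume] f) x‖ₑ
        ≤ eLpNorm (fun t => f (x - t)) 1 ν := by
      rw [eLpNorm_one_eq_lintegral_enorm, hν, lintegral_withDensity_eq_lintegral_mul _ hρm
        hmx.enorm]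
      refine (enorm_integral_le_lintegral_enorm _).trans (lintegral_mono fun t => ?_)
      simp only [ContinuousLinearMap.lsmul_apply, Pi.mul_apply, enorm_smul]
      rw [Real.enorm_of_nonneg (hρ0 t)]
    have h2 := h1.trans (eLpNorm_le_eLpNorm_of_exponent_le (μ := ν) (p := 1) (q := 2) (by norm_num)
      hmx.aestronglyMeasurable)
    refine (pow_le_pow_left' h2 2).trans (le_of_eq ?_)
    rw [eLpNorm_eq_lintegral_rpow_enorm_toReal (by norm_num) (by norm_num)]
    rw [← ENNReal.rpow_natCast, ← ENNReal.rpow_mul]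
    norm_num
  have hsq : ∀ u : Rn n → ℝ, eLpNorm u 2 volume = (∫⁻ x, ‖u x‖ₑ ^ 2) ^ (1 / 2 : ℝ) := by
    intro u
    rw [eLpNorm_eq_lintegral_rpow_enorm_toReal (by norm_num) (by norm_num)]
    norm_num
  rw [hsq, hsq]
  refine ENNReal.rpow_le_rpow ?_ (by norm_num)
  refine (lintegral_mono hpt).trans ?_
  rw [lintegral_lintegral_swap]
  · have : ∀ t : Rn n, ∫⁻ x, ‖f (x - t)‖ₑ ^ 2 = ∫⁻ x, ‖f x‖ₑ ^ 2 := fun t =>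
      lintegral_sub_right_eq_self (fun x => ‖f x‖ₑ ^ 2) t
    simp only [this, lintegral_const, measure_univ, mul_one, le_refl]
  · exact ((hm.comp (measurable_fst.sub measurable_snd)).enorm.pow_const 2).aemeasurable

/-- Mollification by a smooth density commutes with weak derivatives. -/
theorem pd_convolution {ρ f f' : Rn n → ℝ} {i : Fin n} (hρ : IsTestFunction ρ)
    (hf : IsWeakPartial i f f') :
    pd i (ρ ⋆[ContinuousLinearMap.lsmul ℝ ℝ, volume] f)
      = ρ ⋆[ContinuousLinearMap.lsmul ℝ ℝ, volume] f' := by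
  ext x
  have h1 := hρ.2.hasFDerivAt_convolution_left (𝕜 := ℝ) (ContinuousLinearMap.lsmul ℝ ℝ)
    (hρ.1.of_le (by simp)) hf.1 (μ := volume) x
  have hint : Integrable (fun t => (ContinuousLinearMap.precompL (Rn n)
      (ContinuousLinearMap.lsmul ℝ ℝ : ℝ →L[ℝ] ℝ →L[ℝ] ℝ)) (fderiv ℝ ρ t) (f (x - t))) volume :=
    (hρ.2.fderiv ℝ).convolutionExists_left _ (hρ.1.continuous_fderiv (by simp)) hf.1 x
  have hφ : IsTestFunction fun y => ρ (x - y) :=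
    ⟨hρ.1.comp (contDiff_const.sub contDiff_id), by
      simpa using! hρ.2.comp_homeomorph (Homeomorph.subLeft x)⟩
  have hpd : ∀ y, pd i (fun y => ρ (x - y)) y = -pd i ρ (x - y) := by
    intro y
    have h2 : HasFDerivAt (fun y => ρ (x - y)) ((fderiv ℝ ρ (x - y)).comp
        (-ContinuousLinearMap.id ℝ (Rn n))) y :=
      ((hρ.1.differentiable (by simp)) (x - y)).hasFDerivAt.comp y
        ((hasFDerivAt_id y).const_sub x)
    simp only [pd, h2.fderiv]
    simp
  have h3 := hf.integral_pd hφ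
  simp only [hpd, mul_neg, integral_neg, neg_inj] at h3
  have h4 : pd i (ρ ⋆[ContinuousLinearMap.lsmul ℝ ℝ, volume] f) x = ∫ t, pd i ρ t * f (x - t) := by
    rw [pd, h1.fderiv, convolution, ContinuousLinearMap.integral_apply hint]
    rfl
  rw [h4, convolution_def]
  simp only [ContinuousLinearMap.lsmul_apply, smul_eq_mul]
  rw [← integral_sub_left_eq_self (fun t => pd i ρ t * f (x - t)) volume x,
    ← integral_sub_left_eq_self (fun t => ρ t * f' (x - t)) volume x]
  simp only [sub_sub_cancel]
  simpa only [mul_comm] using h3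

/-- A sequence of mollifiers. -/
theorem exists_mollifier (n : ℕ) : ∃ φ : ℕ → ContDiffBump (0 : Rn n),
    Tendsto (fun k => (φ k).rOut) atTop (𝓝 0) :=
  ⟨fun k => ⟨1 / (2 * (k + 1)), 1 / (k + 1), by positivity,
    one_div_lt_one_div_of_lt (by positivity) (by linarith [(Nat.cast_nonneg k : (0 : ℝ) ≤ k)])⟩,
    tendsto_one_div_add_atTop_nhds_zero_nat⟩

theorem isTestFunction_normed (φ : ContDiffBump (0 : Rn n)) :
    IsTestFunction (φ.normed volume) :=
  ⟨φ.contDiff_normed, φ.hasCompactSupport_normed⟩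

theorem tendsto_eLpNorm_convolution_sub {φ : ℕ → ContDiffBump (0 : Rn n)}
    (hφ : Tendsto (fun k => (φ k).rOut) atTop (𝓝 0)) {f : Rn n → ℝ} (hf : MemLp f 2 volume) :
    Tendsto (fun k => eLpNorm (((φ k).normed volume
      ⋆[ContinuousLinearMap.lsmul ℝ ℝ, volume] f) - f) 2 volume) atTop (𝓝 0) := by
  rw [ENNReal.tendsto_nhds_zero]
  intro ε hε
  rcases eq_or_ne ε ⊤ with rfl | hε'
  · simp
  have hε3 : 0 < (ε / 3).toReal :=
    ENNReal.toReal_pos (ENNReal.div_pos hε.ne' (by simp)).ne' (ENNReal.div_ne_top hε' (by simp))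
  obtain ⟨u, hu1, hu2, hu3⟩ := hf.exist_eLpNorm_sub_le (by simp) (by norm_num) hε3
  rw [ENNReal.ofReal_toReal (ENNReal.div_ne_top hε' (by simp))] at hu3
  have hum : MemLp u 2 volume := hu2.continuous.memLp_of_hasCompactSupport hu1
  -- the smooth function
  set S := Metric.cthickening 1 (tsupport u) with hS
  have hSc : IsCompact S := IsCompact.cthickening hu1
  have hSv : volume S ^ (1 / (2 : ℝ≥0∞).toReal) ≠ ⊤ :=
    ENNReal.rpow_ne_top_of_nonneg (by positivity) hSc.measure_lt_top.ne
  obtain ⟨d, hd0, hd⟩ : ∃ d : ℝ, 0 < d ∧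
      ENNReal.ofReal d * volume S ^ (1 / (2 : ℝ≥0∞).toReal) ≤ ε / 3 := by
    have : Tendsto (fun d : ℝ => ENNReal.ofReal d * volume S ^ (1 / (2 : ℝ≥0∞).toReal)) (𝓝[>] 0)
        (𝓝 (ENNReal.ofReal 0 * volume S ^ (1 / (2 : ℝ≥0∞).toReal))) :=
      ENNReal.Tendsto.mul_const ((ENNReal.continuous_ofReal.tendsto 0).mono_left
        nhdsWithin_le_nhds) (Or.inr hSv)
    rw [ENNReal.ofReal_zero, zero_mul] at this
    obtain ⟨d, h1, h2⟩ := ((this.eventually (Iic_mem_nhds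
      (ENNReal.div_pos hε.ne' (by simp : (3 : ℝ≥0∞) ≠ ⊤)))).and self_mem_nhdsWithin).exists
    exact ⟨d, h2, h1⟩
  have huc := hu1.uniformContinuous_of_continuous hu2.continuous
  obtain ⟨r, hr0, hr⟩ := Metric.uniformContinuous_iff.1 huc d hd0
  filter_upwards [hφ.eventually (gt_mem_nhds (lt_min hr0 one_pos))] with k hk
  have hk1 : (φ k).rOut < r := hk.trans_le (min_le_left _ _)
  have hk2 : (φ k).rOut < 1 := hk.trans_le (min_le_right _ _)
  set ρ := (φ k).normed volume with hρ
  have hρt : IsTestFunction ρ := isTestFunction_normed _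
  have hsupp : Function.support (ρ ⋆[ContinuousLinearMap.lsmul ℝ ℝ, volume] u) ⊆ S := by
    refine (support_convolution_subset _).trans ?_
    rintro x ⟨a, ha, b, hb, rfl⟩
    rw [hρ, (φ k).support_normed_eq] at ha
    refine Metric.mem_cthickening_of_dist_le _ b _ _ (subset_tsupport _ hb) ?_
    simp only [dist_eq_norm, add_sub_cancel_right]
    rw [mem_ball_zero_iff] at ha
    linarith
  have h1 : eLpNorm ((ρ ⋆[ContinuousLinearMap.lsmul ℝ ℝ, volume] u) - u) 2 volume ≤ ε / 3 := by
    refine (eLpNorm_sub_le_of_dist_bdd volume (by simp) hSc.measurableSet hd0.le (fun x => ?_)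
      hsupp ?_).trans hd
    · refine ContDiffBump.dist_normed_convolution_le hu2.continuous.aestronglyMeasurable
        fun y hy => (hr ?_).le
      exact (Metric.mem_ball.1 hy).trans hk1
    · exact (subset_tsupport u).trans (Metric.self_subset_cthickening _)
  have h2 : eLpNorm (ρ ⋆[ContinuousLinearMap.lsmul ℝ ℝ, volume] (f - u)) 2 volume ≤ ε / 3 :=
    (eLpNorm_convolution_le hρt.1 hρt.2 (fun x => (φ k).nonneg_normed x)
      (φ k).integral_normed (hf.sub hum)).trans hu3
  have hloc : ∀ v : Rn n → ℝ, MemLp v 2 volume →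
      ConvolutionExists ρ v (ContinuousLinearMap.lsmul ℝ ℝ) volume := fun v hv =>
    hρt.2.convolutionExists_left _ hρt.continuous (hv.locallyIntegrable (by norm_num))
  have hcont : ∀ v : Rn n → ℝ, MemLp v 2 volume →
      AEStronglyMeasurable (ρ ⋆[ContinuousLinearMap.lsmul ℝ ℝ, volume] v) volume := fun v hv =>
    (hρt.2.contDiff_convolution_left (n := ⊤) (ContinuousLinearMap.lsmul ℝ ℝ) hρt.1
      (hv.locallyIntegrable (by norm_num))).continuous.aestronglyMeasurable
  have e : (ρ ⋆[ContinuousLinearMap.lsmul ℝ ℝ, volume] f) - f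
      = (ρ ⋆[ContinuousLinearMap.lsmul ℝ ℝ, volume] (f - u))
        + ((ρ ⋆[ContinuousLinearMap.lsmul ℝ ℝ, volume] u) - u) + (u - f) := by
    have : f = (f - u) + u := by simp
    conv_lhs => rw [this, ConvolutionExists.distrib_add (hloc _ (hf.sub hum)) (hloc _ hum)]
    ext x
    simp only [Pi.add_apply, Pi.sub_apply]
    ring
  rw [e]
  refine (eLpNorm_add_le ((hcont _ (hf.sub hum)).add ((hcont _ hum).sub hum.1)) (hum.1.sub hf.1)
    (by norm_num)).trans ?_
  refine (add_le_add_left (eLpNorm_add_le (hcont _ (hf.sub hum)) ((hcont _ hum).sub hum.1)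
    (by norm_num)) _).trans ?_
  rw [eLpNorm_sub_comm u f]
  calc _ ≤ ε / 3 + ε / 3 + ε / 3 := add_le_add (add_le_add h2 h1) hu3
    _ = ε := ENNReal.add_thirds ε

end Mollify

end JMGT
end

noncomputable section

namespace JMGT

variable {n : ℕ}

/-! ### Square integrable functions with square integrable gradient -/

theorem eLpNorm_two_eq {X F : Type*} [MeasurableSpace X] [NormedAddCommGroup F] (μ : Measure X)
    (u : X → F) : eLpNorm u 2 μ = (∫⁻ x, ‖u x‖ₑ ^ 2 ∂μ) ^ (1 / 2 : ℝ) := by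
  rw [eLpNorm_eq_lintegral_rpow_enorm_toReal (by norm_num) (by norm_num)]
  norm_num

theorem tendsto_eLpNorm_two_of_dominated {F : ℕ → Rn n → ℝ} {b : Rn n → ℝ}
    (hF : ∀ k, AEStronglyMeasurable (F k) volume) (hb : MemLp b 2 volume)
    (hle : ∀ k x, ‖F k x‖ ≤ ‖b x‖) (h0 : ∀ x, Tendsto (fun k => F k x) atTop (𝓝 0)) :
    Tendsto (fun k => eLpNorm (F k) 2 volume) atTop (𝓝 0) := by
  simp only [eLpNorm_two_eq]
  have h1 : Tendsto (fun k => ∫⁻ x, ‖F k x‖ₑ ^ 2) atTop (𝓝 (∫⁻ _ : Rn n, 0)) := by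
    refine tendsto_lintegral_of_dominated_convergence' (fun x => ‖b x‖ₑ ^ 2)
      (fun k => (hF k).enorm.pow_const 2) (fun k => ae_of_all _ fun x => ?_) ?_
      (ae_of_all _ fun x => ?_)
    · exact pow_le_pow_left' (enorm_le_iff_norm_le.2 (hle k x)) 2
    · have := hb.2
      rw [eLpNorm_two_eq] at this
      exact ((ENNReal.rpow_lt_top_iff_of_pos (by norm_num)).1 this).ne
    · have := ((continuous_enorm.tendsto _).comp (h0 x))
      have h2 := ENNReal.Tendsto.pow (n := 2) this
      simpa using h2
  rw [lintegral_zero] at h1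
  have := (ENNReal.continuous_rpow_const (y := 1 / 2)).tendsto 0 |>.comp h1
  simpa [Function.comp_def] using this

theorem tendsto_integral_mul_of_tendsto_eLpNorm {a f : Rn n → ℝ} {F : ℕ → Rn n → ℝ}
    (ha : MemLp a 2 volume) (hf : MemLp f 2 volume) (hF : ∀ k, MemLp (F k) 2 volume)
    (h : Tendsto (fun k => eLpNorm (F k - f) 2 volume) atTop (𝓝 0)) :
    Tendsto (fun k => ∫ x, a x * F k x) atTop (𝓝 (∫ x, a x * f x)) := by
  refine tendsto_integral_of_L1' _ (ha.integrable_mul hf).aestronglyMeasurable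
    (Eventually.of_forall fun k => ha.integrable_mul (hF k)) ?_
  have h1 : Tendsto (fun k => eLpNorm a 2 volume * eLpNorm (F k - f) 2 volume) atTop (𝓝 0) := by
    simpa using ENNReal.Tendsto.const_mul h (Or.inr ha.2.ne)
  refine tendsto_of_tendsto_of_tendsto_of_le_of_le tendsto_const_nhds h1 (fun _ => zero_le)
    fun k => ?_
  have := eLpNorm_smul_le_mul_eLpNorm (p := 2) (q := 2) (r := 1) ((hF k).sub hf).1 ha.1
  refine le_trans (le_of_eq ?_) this
  congr 1
  ext x
  simp only [Pi.sub_apply, Pi.mul_apply, Pi.smul_apply', smul_eq_mul]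
  ring

/-- `f` is square integrable and has the square integrable weak gradient `F`. -/
structure HasL2Grad (f : Rn n → ℝ) (F : Fin n → Rn n → ℝ) : Prop where
  memLp : MemLp f 2 volume
  grad_memLp : ∀ i, MemLp (F i) 2 volume
  weak : ∀ i, IsWeakPartial i f (F i)

/-- A smooth cutoff function at scale `R`. -/
def cutoff (n : ℕ) (R : ℝ) : Rn n → ℝ := fun x =>
  (⟨1, 2, one_pos, one_lt_two⟩ : ContDiffBump (0 : Rn n)) (R⁻¹ • x)

theorem isTestFunction_cutoff {R : ℝ} (hR : 0 < R) : IsTestFunction (cutoff n R) := by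
  refine ⟨(ContDiffBump.contDiff _).comp (contDiff_const_smul _), ?_⟩
  exact (ContDiffBump.hasCompactSupport _).comp_smul (inv_ne_zero hR.ne')

theorem abs_cutoff_sub_one_le (R : ℝ) (x : Rn n) : |cutoff n R x - 1| ≤ 1 := by
  have h1 := ContDiffBump.nonneg (⟨1, 2, one_pos, one_lt_two⟩ : ContDiffBump (0 : Rn n))
    (x := R⁻¹ • x)
  have h2 := ContDiffBump.le_one (⟨1, 2, one_pos, one_lt_two⟩ : ContDiffBump (0 : Rn n))
    (x := R⁻¹ • x)
  rw [abs_le]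
  constructor <;> simp only [cutoff] <;> linarith

theorem cutoff_eq_one {R : ℝ} (hR : 0 < R) {x : Rn n} (hx : ‖x‖ ≤ R) : cutoff n R x = 1 := by
  refine ContDiffBump.one_of_mem_closedBall _ ?_
  rw [mem_closedBall_zero_iff, norm_smul, norm_inv, Real.norm_of_nonneg hR.le,
    inv_mul_le_iff₀ hR, mul_one]
  exact hx

theorem exists_abs_pd_cutoff_le (i : Fin n) :
    ∃ C, 0 ≤ C ∧ ∀ R, 1 ≤ R → ∀ x, |pd i (cutoff n R) x| ≤ C / R := by
  set χ : ContDiffBump (0 : Rn n) := ⟨1, 2, one_pos, one_lt_two⟩ with hχ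
  have ht : IsTestFunction (χ : Rn n → ℝ) := ⟨χ.contDiff, χ.hasCompactSupport⟩
  obtain ⟨C, hC⟩ := (ht.pd i).2.exists_bound_of_continuous (ht.pd i).continuous
  have hC0 : 0 ≤ C := (norm_nonneg _).trans (hC 0)
  refine ⟨C, hC0, fun R hR x => ?_⟩
  have hR0 : 0 < R := one_pos.trans_le hR
  have h2 : HasFDerivAt (cutoff n R) ((fderiv ℝ χ (R⁻¹ • x)).comp
      (R⁻¹ • ContinuousLinearMap.id ℝ (Rn n))) x :=
    ((ht.1.differentiable (by simp)) (R⁻¹ • x)).hasFDerivAt.comp x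
      ((hasFDerivAt_id x).const_smul R⁻¹)
  have h3 : pd i (cutoff n R) x = R⁻¹ * pd i χ (R⁻¹ • x) := by
    simp only [pd, h2.fderiv]
    simp
  rw [h3, abs_mul, abs_inv, abs_of_pos hR0, div_eq_inv_mul]
  exact mul_le_mul_of_nonneg_left (hC _) (by positivity)

namespace HasL2Grad

variable {f h : Rn n → ℝ} {F Hh : Fin n → Rn n → ℝ}

theorem mul_cutoff (hf : HasL2Grad f F) {R : ℝ} (hR : 0 < R) :
    HasL2Grad (fun x => f x * cutoff n R x)
      (fun i x => F i x * cutoff n R x + f x * pd i (cutoff n R) x) := by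
  have ht := isTestFunction_cutoff (n := n) hR
  have hm : ∀ {u : Rn n → ℝ} {χ : Rn n → ℝ}, MemLp u 2 volume → IsTestFunction χ →
      MemLp (fun x => u x * χ x) 2 volume := fun {u χ} hu hχ => by
    obtain ⟨C, hC⟩ := hχ.2.exists_bound_of_continuous hχ.continuous
    refine (hu.norm.const_mul C).mono (hu.1.mul hχ.continuous.aestronglyMeasurable)
      (ae_of_all _ fun x => ?_)
    rw [norm_mul, norm_mul, norm_norm, mul_comm]
    exact mul_le_mul_of_nonneg_right ((hC x).trans (le_abs_self C)) (norm_nonneg _)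
  exact ⟨hm hf.memLp ht, fun i => (hm (hf.grad_memLp i) ht).add (hm hf.memLp (ht.pd i)),
    fun i => (hf.weak i).smooth_mul ht.1⟩

theorem tendsto_cutoff_mul {u : Rn n → ℝ} (hu : MemLp u 2 volume) :
    Tendsto (fun k : ℕ => eLpNorm ((fun x => u x * cutoff n (k + 1) x) - u) 2 volume)
      atTop (𝓝 0) := by
  refine tendsto_eLpNorm_two_of_dominated (fun k => ?_) hu (fun k x => ?_) fun x => ?_
  · exact (hu.1.mul (isTestFunction_cutoff (by positivity)).continuous.aestronglyMeasurable).sub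
      hu.1
  · have : u x * cutoff n (k + 1) x - u x = u x * (cutoff n (k + 1) x - 1) := by ring
    rw [Pi.sub_apply, this, norm_mul]
    exact mul_le_of_le_one_right (norm_nonneg _) (abs_cutoff_sub_one_le _ _)
  · refine tendsto_const_nhds.congr' ?_
    obtain ⟨N, hN⟩ := exists_nat_ge ‖x‖
    filter_upwards [eventually_ge_atTop N] with k hk
    have : (N : ℝ) ≤ k := by exact_mod_cast hk
    rw [Pi.sub_apply, cutoff_eq_one (by positivity) (by linarith), mul_one, sub_self]

theorem tendsto_mul_pd_cutoff {u : Rn n → ℝ} (hu : MemLp u 2 volume) (i : Fin n) :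
    Tendsto (fun k : ℕ => eLpNorm (fun x => u x * pd i (cutoff n (k + 1)) x) 2 volume)
      atTop (𝓝 0) := by
  obtain ⟨C, hC0, hC⟩ := exists_abs_pd_cutoff_le i
  refine tendsto_eLpNorm_two_of_dominated (b := fun x => C * u x) (fun k => ?_) (hu.const_mul C)
    (fun k x => ?_) fun x => ?_
  · exact (hu.1.mul
      ((isTestFunction_cutoff (by positivity)).pd i).continuous.aestronglyMeasurable)
  · rw [norm_mul, norm_mul, mul_comm, Real.norm_of_nonneg hC0]
    refine mul_le_mul_of_nonneg_right ((hC _ (by linarith [(Nat.cast_nonneg k : (0 : ℝ) ≤ k)]) x).trans ?_)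
      (norm_nonneg _)
    exact div_le_self hC0 (by linarith [(Nat.cast_nonneg k : (0 : ℝ) ≤ k)])
  · have h1 : Tendsto (fun k : ℕ => ‖u x‖ * (C / ((k : ℝ) + 1))) atTop (𝓝 0) := by
      have := (tendsto_one_div_add_atTop_nhds_zero_nat (𝕜 := ℝ)).const_mul (‖u x‖ * C)
      rw [mul_zero] at this
      refine this.congr fun k => ?_
      ring
    refine squeeze_zero_norm (fun k => ?_) h1
    rw [norm_mul]
    exact mul_le_mul_of_nonneg_left (hC _ (by linarith [(Nat.cast_nonneg k : (0 : ℝ) ≤ k)]) x)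
      (norm_nonneg _)

open scoped Convolution in
theorem exists_test_le_of_hasCompactSupport (hf : HasL2Grad f F) (hc : HasCompactSupport f)
    {ε : ℝ≥0∞} (hε : 0 < ε) :
    ∃ φ, IsTestFunction φ ∧ eLpNorm (φ - f) 2 volume ≤ ε ∧
      ∀ i, eLpNorm (pd i φ - F i) 2 volume ≤ ε := by
  obtain ⟨ρ, hρ⟩ := exists_mollifier n
  have h1 := ENNReal.tendsto_nhds_zero.1 (tendsto_eLpNorm_convolution_sub hρ hf.memLp) ε hε
  have h2 : ∀ i, _ := fun i =>
    ENNReal.tendsto_nhds_zero.1 (tendsto_eLpNorm_convolution_sub hρ (hf.grad_memLp i)) ε hε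
  obtain ⟨k, hk1, hk2⟩ := (h1.and (eventually_all.2 h2)).exists
  have ht := isTestFunction_normed (ρ k)
  refine ⟨(ρ k).normed volume ⋆[ContinuousLinearMap.lsmul ℝ ℝ, volume] f, ⟨?_, ?_⟩, hk1,
    fun i => ?_⟩
  · exact ht.2.contDiff_convolution_left (n := ⊤) _ ht.1 (hf.memLp.locallyIntegrable (by norm_num))
  · exact ht.2.convolution _ hc
  · rw [pd_convolution ht (hf.weak i)]
    exact hk2 i

theorem exists_test_le (hf : HasL2Grad f F) {ε : ℝ≥0∞} (hε : 0 < ε) :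
    ∃ φ, IsTestFunction φ ∧ eLpNorm (φ - f) 2 volume ≤ ε ∧
      ∀ i, eLpNorm (pd i φ - F i) 2 volume ≤ ε := by
  have hε2 : 0 < ε / 2 := ENNReal.div_pos hε.ne' (by simp)
  have h1 := ENNReal.tendsto_nhds_zero.1 (tendsto_cutoff_mul hf.memLp) _ hε2
  have h2 : ∀ i, ∀ᶠ k : ℕ in atTop, eLpNorm ((fun x => F i x * cutoff n (k + 1) x
      + f x * pd i (cutoff n (k + 1)) x) - F i) 2 volume ≤ ε / 2 := fun i => by
    have h3 := (tendsto_cutoff_mul (hf.grad_memLp i)).add (tendsto_mul_pd_cutoff hf.memLp i)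
    rw [add_zero] at h3
    filter_upwards [ENNReal.tendsto_nhds_zero.1 h3 _ hε2] with k hk
    have hg := (hf.mul_cutoff (R := k + 1) (by positivity))
    have hR : (0 : ℝ) < k + 1 := by positivity
    have ht := isTestFunction_cutoff (n := n) hR
    refine le_trans ?_ hk
    refine le_trans (le_of_eq ?_) (eLpNorm_add_le
      (((hf.grad_memLp i).1.mul ht.continuous.aestronglyMeasurable).sub (hf.grad_memLp i).1)
      (hf.memLp.1.mul (ht.pd i).continuous.aestronglyMeasurable) (by norm_num))
    congr 1
    ext x
    simp only [Pi.sub_apply, Pi.add_apply]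
    ring
  obtain ⟨k, hk1, hk2⟩ := (h1.and (eventually_all.2 h2)).exists
  have hR : (0 : ℝ) < k + 1 := by positivity
  have hg := hf.mul_cutoff hR
  obtain ⟨φ, hφ, h4, h5⟩ := hg.exists_test_le_of_hasCompactSupport
    (isTestFunction_cutoff (n := n) hR).2.mul_left hε2
  have htri : ∀ {a b c : Rn n → ℝ}, MemLp a 2 volume → MemLp b 2 volume → MemLp c 2 volume →
      eLpNorm (a - b) 2 volume ≤ ε / 2 → eLpNorm (b - c) 2 volume ≤ ε / 2 →
      eLpNorm (a - c) 2 volume ≤ ε := fun {a b c} ha hb hc h6 h7 => by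
    have : a - c = (a - b) + (b - c) := by abel
    rw [this]
    refine (eLpNorm_add_le (ha.sub hb).1 (hb.sub hc).1 (by norm_num)).trans ?_
    exact (add_le_add h6 h7).trans (ENNReal.add_halves ε).le
  exact ⟨φ, hφ, htri (hφ.memLp 2) hg.memLp hf.memLp h4 hk1,
    fun i => htri ((hφ.pd i).memLp 2) (hg.grad_memLp i) (hf.grad_memLp i) (h5 i) (hk2 i)⟩

/-- Test functions are dense in `H¹`. -/
theorem exists_seq_test (hf : HasL2Grad f F) :
    ∃ φ : ℕ → Rn n → ℝ, (∀ k, IsTestFunction (φ k)) ∧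
      Tendsto (fun k => eLpNorm (φ k - f) 2 volume) atTop (𝓝 0) ∧
      ∀ i, Tendsto (fun k => eLpNorm (pd i (φ k) - F i) 2 volume) atTop (𝓝 0) := by
  have h1 : ∀ k : ℕ, (0 : ℝ≥0∞) < ((k : ℝ≥0∞) + 1)⁻¹ := fun k => by simp
  choose φ h2 h3 h4 using fun k => hf.exists_test_le (h1 k)
  have h5 : Tendsto (fun k : ℕ => ((k : ℝ≥0∞) + 1)⁻¹) atTop (𝓝 0) := by
    have := (tendsto_add_atTop_iff_nat 1).2 ENNReal.tendsto_inv_nat_nhds_zero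
    simpa using this
  exact ⟨φ, h2, tendsto_of_tendsto_of_tendsto_of_le_of_le tendsto_const_nhds h5 (fun _ => zero_le)
    h3, fun i => tendsto_of_tendsto_of_tendsto_of_le_of_le tendsto_const_nhds h5 (fun _ => zero_le)
    fun k => h4 k i⟩

/-- Integration by parts in `H¹`. -/
theorem integral_mul_grad (hh : HasL2Grad h Hh) {a a' : Rn n → ℝ} {i : Fin n}
    (ha : MemLp a 2 volume) (ha' : MemLp a' 2 volume) (hw : IsWeakPartial i a a') :
    ∫ x, a x * Hh i x = -∫ x, a' x * h x := by
  obtain ⟨φ, h1, h2, h3⟩ := hh.exists_seq_test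
  have t1 := tendsto_integral_mul_of_tendsto_eLpNorm ha (hh.grad_memLp i)
    (fun k => ((h1 k).pd i).memLp 2) (h3 i)
  have t2 := (tendsto_integral_mul_of_tendsto_eLpNorm ha' hh.memLp
    (fun k => (h1 k).memLp 2) h2).neg
  refine tendsto_nhds_unique (t1.congr fun k => ?_) t2
  exact hw.integral_pd (h1 k)

theorem integral_grad_mul_grad_comm (hf : HasL2Grad f F) (hh : HasL2Grad h Hh) (i l : Fin n) :
    ∫ x, Hh i x * F l x = ∫ x, Hh l x * F i x := by
  obtain ⟨φ, h1, h2, h3⟩ := hf.exists_seq_test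
  have t : ∀ i l, Tendsto (fun k => ∫ x, Hh i x * pd l (φ k) x) atTop
      (𝓝 (∫ x, Hh i x * F l x)) := fun i l =>
    tendsto_integral_mul_of_tendsto_eLpNorm (hh.grad_memLp i) (hf.grad_memLp l)
      (fun k => ((h1 k).pd l).memLp 2) (h3 l)
  refine tendsto_nhds_unique ((t i l).congr fun k => ?_) (t l i)
  have e1 := (hh.weak i).integral_pd ((h1 k).pd l)
  have e2 := (hh.weak l).integral_pd ((h1 k).pd i)
  have e3 : ∀ x, pd i (pd l (φ k)) x = pd l (pd i (φ k)) x := pd_comm (h1 k).1 i l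
  simp only [e3] at e1
  linarith

/-- The product rule. -/
theorem isWeakPartial_mul (hf : HasL2Grad f F) (hh : HasL2Grad h Hh) (i : Fin n) :
    IsWeakPartial i (fun x => f x * h x) (fun x => F i x * h x + f x * Hh i x) := by
  have l1 := (hf.memLp.integrable_mul hh.memLp).locallyIntegrable
  have l2 := ((hf.grad_memLp i).integrable_mul hh.memLp)
  have l3 := (hf.memLp.integrable_mul (hh.grad_memLp i))
  refine ⟨l1, (l2.add l3).locallyIntegrable, fun χ hχ => ?_⟩
  obtain ⟨φ, h1, h2, h3⟩ := hh.exists_seq_test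
  have hm : ∀ {u χ : Rn n → ℝ}, MemLp u 2 volume → IsTestFunction χ →
      MemLp (fun x => u x * χ x) 2 volume := fun {u χ} hu hχ => by
    obtain ⟨C, hC⟩ := hχ.2.exists_bound_of_continuous hχ.continuous
    refine (hu.norm.const_mul C).mono (hu.1.mul hχ.continuous.aestronglyMeasurable)
      (ae_of_all _ fun x => ?_)
    rw [norm_mul, norm_mul, norm_norm, mul_comm]
    exact mul_le_mul_of_nonneg_right ((hC x).trans (le_abs_self C)) (norm_nonneg _)
  have t1 := tendsto_integral_mul_of_tendsto_eLpNorm (hm hf.memLp (hχ.pd i)) hh.memLp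
    (fun k => (h1 k).memLp 2) h2
  have t2 := tendsto_integral_mul_of_tendsto_eLpNorm (hm (hf.grad_memLp i) hχ) hh.memLp
    (fun k => (h1 k).memLp 2) h2
  have t3 := tendsto_integral_mul_of_tendsto_eLpNorm (hm hf.memLp hχ) (hh.grad_memLp i)
    (fun k => ((h1 k).pd i).memLp 2) (h3 i)
  have e : ∀ k, ∫ x, f x * pd i χ x * φ k x
      = -((∫ x, F i x * χ x * φ k x) + ∫ x, f x * χ x * pd i (φ k) x) := fun k => by
    have h4 := ((hf.weak i).smooth_mul (h1 k).1).integral_pd hχ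
    have i1 : Integrable (fun x => F i x * χ x * φ k x) volume :=
      (hm (hf.grad_memLp i) hχ).integrable_mul ((h1 k).memLp 2)
    have i2 : Integrable (fun x => f x * χ x * pd i (φ k) x) volume :=
      (hm hf.memLp hχ).integrable_mul (((h1 k).pd i).memLp 2)
    rw [← integral_add i1 i2]
    refine Eq.trans ?_ (h4.trans ?_)
    · exact integral_congr_ae (ae_of_all _ fun x => by ring)
    · exact congrArg _ (integral_congr_ae (ae_of_all _ fun x => by ring))
  have h5 := tendsto_nhds_unique t1 ((t2.add t3).neg.congr fun k => (e k).symm)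
  have i1 : Integrable (fun x => F i x * χ x * h x) volume :=
    (hm (hf.grad_memLp i) hχ).integrable_mul hh.memLp
  have i2 : Integrable (fun x => f x * χ x * Hh i x) volume :=
    (hm hf.memLp hχ).integrable_mul (hh.grad_memLp i)
  rw [← integral_add i1 i2] at h5
  refine Eq.trans ?_ (h5.trans ?_)
  · exact integral_congr_ae (ae_of_all _ fun x => by simp only [pd]; ring)
  · exact congrArg _ (integral_congr_ae (ae_of_all _ fun x => by ring))

theorem norm_fderiv_le_sum (φ : Rn n → ℝ) (x : Rn n) : ‖fderiv ℝ φ x‖ ≤ ∑ i, |pd i φ x| := by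
  refine ContinuousLinearMap.opNorm_le_bound _ (Finset.sum_nonneg fun i _ => abs_nonneg _) fun y => ?_
  have h1 : fderiv ℝ φ x y = ∑ i, y i * pd i φ x := by
    conv_lhs => rw [← (EuclideanSpace.basisFun (Fin n) ℝ).sum_repr y, map_sum]
    refine Finset.sum_congr rfl fun i _ => ?_
    simp [pd]
  rw [h1, Finset.sum_mul]
  refine (norm_sum_le _ _).trans (Finset.sum_le_sum fun i _ => ?_)
  rw [norm_mul, mul_comm, Real.norm_eq_abs (pd i φ x)]
  exact mul_le_mul_of_nonneg_left (PiLp.norm_apply_le y i) (abs_nonneg _)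

/-- The Gagliardo-Nirenberg-Sobolev inequality in `H¹`. -/
theorem exists_eLpNorm_le (hn : 3 ≤ n) : ∃ C : ℝ≥0, ∀ (f : Rn n → ℝ) (F : Fin n → Rn n → ℝ),
    HasL2Grad f F → eLpNorm f ((2 * n / (n - 2) : ℝ≥0) : ℝ≥0∞) volume
      ≤ C * ∑ i, eLpNorm (F i) 2 volume := by
  set p' : ℝ≥0 := 2 * n / (n - 2) with hp'
  refine ⟨SNormLESNormFDerivOfEqConst ℝ (volume : Measure (Rn n)) ((2 : ℝ≥0) : ℝ), fun f F hf => ?_⟩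
  set C := SNormLESNormFDerivOfEqConst ℝ (volume : Measure (Rn n)) ((2 : ℝ≥0) : ℝ)
  obtain ⟨φ, h1, h2, h3⟩ := hf.exists_seq_test
  have hp'' : (p' : ℝ)⁻¹ = ((2 : ℝ≥0) : ℝ)⁻¹ - (Module.finrank ℝ (Rn n) : ℝ)⁻¹ := by
    have h4 : (2 : ℝ≥0) ≤ n := by exact_mod_cast (by omega : 2 ≤ n)
    have h5 : (3 : ℝ) ≤ n := by exact_mod_cast hn
    rw [hp', finrank_euclideanSpace_fin]
    push_cast [NNReal.coe_sub h4]
    have : (n : ℝ) - 2 ≠ 0 := by linarith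
    field_simp
  have key : ∀ k, eLpNorm (φ k) p' volume ≤ C * ∑ i, eLpNorm (pd i (φ k)) 2 volume := fun k => by
    refine (eLpNorm_le_eLpNorm_fderiv_of_eq volume ((h1 k).1.of_le (by simp)) (h1 k).2
      (p := 2) (by norm_num) (by rw [finrank_euclideanSpace_fin]; omega) hp'').trans ?_
    refine mul_le_mul_right ?_ _
    refine (eLpNorm_mono_real (norm_fderiv_le_sum (φ k))).trans ?_
    have h6 := eLpNorm_sum_le (μ := (volume : Measure (Rn n))) (p := 2) (s := Finset.univ)
      (f := fun i x => |pd i (φ k) x|)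
      (fun i _ => ((h1 k).pd i).continuous.abs.aestronglyMeasurable) (by norm_num)
    refine le_trans (le_of_eq ?_) (h6.trans (le_of_eq ?_))
    · congr 1
      ext x
      simp
    · refine Finset.sum_congr rfl fun i _ => ?_
      exact eLpNorm_norm (pd i (φ k))
  obtain ⟨ns, hns, hae⟩ := (tendstoInMeasure_of_tendsto_eLpNorm (by norm_num)
    (fun k => ((h1 k).memLp 2).1) hf.memLp.1 h2).exists_seq_tendsto_ae
  refine (Lp.eLpNorm_lim_le_liminf_eLpNorm (fun k => ((h1 (ns k)).memLp 2).1) f hae).trans ?_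
  have lim : Tendsto (fun k => (C : ℝ≥0∞) * ∑ i, (eLpNorm (pd i (φ (ns k)) - F i) 2 volume
      + eLpNorm (F i) 2 volume)) atTop (𝓝 (C * ∑ i, (0 + eLpNorm (F i) 2 volume))) := by
    refine ENNReal.Tendsto.const_mul (tendsto_finsetSum _ fun i _ =>
      ((h3 i).comp hns.tendsto_atTop).add_const _) (Or.inr ENNReal.coe_ne_top)
  simp only [zero_add] at lim
  rw [← lim.liminf_eq]
  refine liminf_le_liminf (Eventually.of_forall fun k => (key (ns k)).trans ?_)
  refine mul_le_mul_right (Finset.sum_le_sum fun i _ => ?_) _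
  have h7 := eLpNorm_add_le (p := 2) (μ := volume) ((((h1 (ns k)).pd i).memLp 2).sub
    (hf.grad_memLp i)).1 (hf.grad_memLp i).1 (by norm_num)
  rwa [sub_add_cancel] at h7

end HasL2Grad

end JMGT
end

noncomputable section

namespace JMGT

local notation "⟪" x ", " y "⟫" => inner ℝ x y

variable {n : ℕ}

/-! ### Functions as elements of `L²` -/

/-- The Hilbert space `L²(ℝⁿ)`. -/
abbrev L2 (n : ℕ) : Type := Lp ℝ 2 (volume : Measure (Rn n))

/-- The Hilbert space of square integrable vector fields. -/
abbrev L2Vec (n : ℕ) : Type := PiLp 2 fun _ : Fin n => L2 n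

open Classical in
/-- The class of `f` in `L²(ℝⁿ)` (zero if `f` is not square integrable). -/
def toL2 (f : Rn n → ℝ) : L2 n :=
  if h : MemLp f 2 volume then h.toLp f else 0

/-- The weak gradient as an element of `L²`. -/
def gradL2 (f : Rn n → ℝ) : L2Vec n := WithLp.toLp 2 fun i => toL2 (weakPartial i f)

/-- The weak Laplacian as an element of `L²`. -/
def lapL2 (f : Rn n → ℝ) : L2 n := ∑ i, toL2 (weakPartial i (weakPartial i f))

section ToL2

variable {f h : Rn n → ℝ}

theorem toL2_of_memLp (hf : MemLp f 2 volume) : toL2 f = hf.toLp f := dif_pos hf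

theorem toL2_coeFn (hf : MemLp f 2 volume) : toL2 f =ᵐ[volume] f := by
  rw [toL2_of_memLp hf]
  exact hf.coeFn_toLp

theorem toL2_congr (hf : MemLp f 2 volume) (hfh : f =ᵐ[volume] h) : toL2 f = toL2 h := by
  rw [toL2_of_memLp hf, toL2_of_memLp (hf.ae_eq hfh), MemLp.toLp_eq_toLp_iff]
  exact hfh

theorem toL2_add (hf : MemLp f 2 volume) (hh : MemLp h 2 volume) :
    toL2 (f + h) = toL2 f + toL2 h := by
  rw [toL2_of_memLp hf, toL2_of_memLp hh, toL2_of_memLp (hf.add hh), MemLp.toLp_add]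

theorem toL2_sub (hf : MemLp f 2 volume) (hh : MemLp h 2 volume) :
    toL2 (f - h) = toL2 f - toL2 h := by
  rw [toL2_of_memLp hf, toL2_of_memLp hh, toL2_of_memLp (hf.sub hh), MemLp.toLp_sub]

theorem toL2_smul (hf : MemLp f 2 volume) (r : ℝ) : toL2 (r • f) = r • toL2 f := by
  rw [toL2_of_memLp hf, toL2_of_memLp (hf.const_smul r), MemLp.toLp_const_smul]

theorem inner_toL2 (hf : MemLp f 2 volume) (hh : MemLp h 2 volume) :
    ⟪toL2 f, toL2 h⟫ = ∫ x, f x * h x := by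
  rw [L2.inner_def]
  refine integral_congr_ae ?_
  filter_upwards [toL2_coeFn hf, toL2_coeFn hh] with x h1 h2
  rw [h1, h2]
  simp [mul_comm]

theorem enorm_toL2 (hf : MemLp f 2 volume) : ‖toL2 f‖ₑ = eLpNorm f 2 volume := by
  rw [toL2_of_memLp hf, Lp.enorm_toLp]

theorem eq_of_inner_test {a b : L2 n}
    (hab : ∀ φ, IsTestFunction φ → ⟪a, toL2 φ⟫ = ⟪b, toL2 φ⟫) : a = b := by
  have hd := Lp.dense_hasCompactSupport_contDiff (E := Rn n) (F := ℝ) (p := 2)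
    (μ := volume) (by simp)
  refine hd.eq_of_inner_left (𝕜 := ℝ) fun u hu => ?_
  obtain ⟨φ, h1, h2, h3⟩ := hu
  have hφ : IsTestFunction φ := ⟨h3, h2⟩
  have : u = toL2 φ := by
    refine Lp.ext (h1.trans (toL2_coeFn (hφ.memLp 2)).symm)
  rw [this]
  exact hab φ hφ

end ToL2

/-! ### Spaces of integer order -/

theorem MemH.memLp {j : ℕ} {f : Rn n → ℝ} (hf : MemH j f) : MemLp f 2 volume := by
  cases j with
  | zero => exact hf
  | succ j => exact hf.1

theorem MemH.of_succ {j : ℕ} {f : Rn n → ℝ} (hf : MemH (j + 1) f) : MemH j f := by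
  induction j generalizing f with
  | zero => exact hf.1
  | succ j ih => exact ⟨hf.1, fun i => ⟨(hf.2 i).1, ih (hf.2 i).2⟩⟩

theorem normHSq_le_succ (j : ℕ) (f : Rn n → ℝ) : normHSq j f ≤ normHSq (j + 1) f := by
  induction j generalizing f with
  | zero => exact le_self_add
  | succ j ih => exact add_le_add_right (Finset.sum_le_sum fun i _ => ih _) _

theorem MemH.mono {i j : ℕ} (hij : i ≤ j) {f : Rn n → ℝ} (hf : MemH j f) : MemH i f := by
  induction hij with
  | refl => exact hf
  | step _ ih => exact ih hf.of_succ

theorem normHSq_mono {i j : ℕ} (hij : i ≤ j) (f : Rn n → ℝ) : normHSq i f ≤ normHSq j f :=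
  monotone_nat_of_le_succ (f := fun j => normHSq j f) (fun j => normHSq_le_succ j f) hij

theorem GradMemH.mono {i j : ℕ} (hij : i ≤ j) {f : Rn n → ℝ} (hf : GradMemH j f) :
    GradMemH i f := fun l => ⟨(hf l).1, (hf l).2.mono hij⟩

theorem gradNormHSq_mono {i j : ℕ} (hij : i ≤ j) (f : Rn n → ℝ) :
    gradNormHSq i f ≤ gradNormHSq j f := Finset.sum_le_sum fun _ _ => normHSq_mono hij _

theorem memNormSq_mono (g : ℝ → ℝ) {i j : ℕ} (hij : i ≤ j) (η : ℝ → Rn n → ℝ) :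
    memNormSq g i η ≤ memNormSq g j η := lintegral_mono fun _ => gradNormHSq_mono hij _

theorem MemPhase.mono {g : ℝ → ℝ} {i j : ℕ} (hij : i ≤ j) {Ψ : State n} (h : MemPhase g j Ψ) :
    MemPhase g i Ψ :=
  ⟨h.1.mono hij, h.2.1.mono (by omega), h.2.2.1.mono hij, h.2.2.2.1,
    h.2.2.2.2.1.mono fun _ hs => hs.mono hij, (memNormSq_mono g hij _).trans_lt h.2.2.2.2.2⟩

theorem phaseNormSq_mono (g : ℝ → ℝ) {i j : ℕ} (hij : i ≤ j) (Ψ : State n) :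
    phaseNormSq g i Ψ ≤ phaseNormSq g j Ψ :=
  add_le_add (add_le_add (add_le_add (gradNormHSq_mono hij _) (normHSq_mono (by omega) _))
    (normHSq_mono hij _)) (memNormSq_mono g hij _)

theorem IsSolution.mono {τ b c k T : ℝ} {g : ℝ → ℝ} {i j : ℕ} (hij : i ≤ j) {Ψ : ℝ → State n}
    (h : IsSolution τ b c k g j T Ψ) : IsSolution τ b c k g i T Ψ where
  mem t ht := (h.mem t ht).mono hij
  cont t₀ ht := tendsto_of_tendsto_of_tendsto_of_le_of_le tendsto_const_nhds (h.cont t₀ ht)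
    (fun _ => zero_le) fun _ => phaseNormSq_mono g hij _
  eq_ψ := h.eq_ψ
  eq_v := h.eq_v
  eq_w := h.eq_w
  eq_η := h.eq_η

namespace GradMemH

variable {f h : Rn n → ℝ} {j : ℕ}

theorem isWeakPartial (hf : GradMemH j f) (i : Fin n) : IsWeakPartial i f (weakPartial i f) :=
  IsWeakPartial.weakPartial_spec (hf i).1

theorem memLp (hf : GradMemH j f) (i : Fin n) : MemLp (weakPartial i f) 2 volume := (hf i).2.memLp

theorem grad (hf : GradMemH (j + 1) f) (i : Fin n) : GradMemH j (weakPartial i f) := (hf i).2.2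

theorem hasL2Grad (hf : GradMemH j f) (h0 : MemLp f 2 volume) :
    HasL2Grad f fun i => weakPartial i f := ⟨h0, hf.memLp, hf.isWeakPartial⟩

theorem congr (hf : GradMemH j f) (hfh : f =ᵐ[volume] h) : GradMemH j h := fun i => by
  rw [← weakPartial_congr hfh i]
  exact ⟨⟨_, (hf.isWeakPartial i).congr_left hfh⟩, (hf i).2⟩

end GradMemH

theorem MemH.congr {f h : Rn n → ℝ} {j : ℕ} (hf : MemH j f) (hfh : f =ᵐ[volume] h) :
    MemH j h := by
  cases j with
  | zero => exact MemLp.ae_eq hfh hf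
  | succ j => exact ⟨hf.1.ae_eq hfh, GradMemH.congr (j := j) hf.2 hfh⟩

section Linear

variable {f h : Rn n → ℝ} {j : ℕ}

theorem weakPartial_add_smul (hf : GradMemH j f) (hh : GradMemH j h) (r : ℝ) (i : Fin n) :
    weakPartial i (f + r • h) =ᵐ[volume] weakPartial i f + r • weakPartial i h :=
  ((hf.isWeakPartial i).add ((hh.isWeakPartial i).smul r)).weakPartial_ae_eq

theorem MemH.add_smul (hf : MemH j f) (hh : MemH j h) (r : ℝ) : MemH j (f + r • h) := by
  induction j generalizing f h with
  | zero => exact MemLp.add hf (MemLp.const_smul hh r)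
  | succ j ih =>
    refine ⟨hf.1.add (hh.1.const_smul r), fun i => ?_⟩
    have hf' : GradMemH j f := hf.2
    have hh' : GradMemH j h := hh.2
    exact ⟨⟨_, (hf'.isWeakPartial i).add ((hh'.isWeakPartial i).smul r)⟩,
      (ih (hf.2 i).2 (hh.2 i).2).congr (weakPartial_add_smul hf' hh' r i).symm⟩

theorem GradMemH.add_smul (hf : GradMemH j f) (hh : GradMemH j h) (r : ℝ) :
    GradMemH j (f + r • h) := fun i =>
  ⟨⟨_, (hf.isWeakPartial i).add ((hh.isWeakPartial i).smul r)⟩,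
    ((hf i).2.add_smul (hh i).2 r).congr (weakPartial_add_smul hf hh r i).symm⟩

theorem gradL2_add_smul (hf : GradMemH j f) (hh : GradMemH j h) (r : ℝ) :
    gradL2 (f + r • h) = gradL2 f + r • gradL2 h := by
  refine PiLp.ext fun i => ?_
  have h1 := (hf.add_smul hh r).memLp i
  simp only [gradL2, PiLp.add_apply, PiLp.smul_apply]
  rw [toL2_congr h1 (weakPartial_add_smul hf hh r i),
    toL2_add (hf.memLp i) ((hh.memLp i).const_smul r), toL2_smul (hh.memLp i)]

theorem lapL2_add_smul (hf : GradMemH 1 f) (hh : GradMemH 1 h) (r : ℝ) :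
    lapL2 (f + r • h) = lapL2 f + r • lapL2 h := by
  simp only [lapL2]
  rw [Finset.smul_sum, ← Finset.sum_add_distrib]
  refine Finset.sum_congr rfl fun i _ => ?_
  have h1 := (hf.grad i).memLp i
  have h2 := (hh.grad i).memLp i
  rw [weakPartial_congr (weakPartial_add_smul hf hh r i), ← toL2_smul h2,
    ← toL2_add h1 (h2.const_smul r)]
  exact toL2_congr (((hf.grad i).add_smul (hh.grad i) r).memLp i)
    (weakPartial_add_smul (hf.grad i) (hh.grad i) r i)

theorem GradMemH.sub (hf : GradMemH j f) (hh : GradMemH j h) : GradMemH j (f - h) := by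
  simpa only [neg_one_smul, ← sub_eq_add_neg] using hf.add_smul hh (-1)

theorem gradL2_sub (hf : GradMemH j f) (hh : GradMemH j h) :
    gradL2 (f - h) = gradL2 f - gradL2 h := by
  simpa only [neg_one_smul, ← sub_eq_add_neg] using gradL2_add_smul hf hh (-1)

theorem lapL2_sub (hf : GradMemH 1 f) (hh : GradMemH 1 h) :
    lapL2 (f - h) = lapL2 f - lapL2 h := by
  simpa only [neg_one_smul, ← sub_eq_add_neg] using lapL2_add_smul hf hh (-1)

end Linear

/-! ### Norms of gradients and Laplacians -/

section Norms

variable {f h : Rn n → ℝ} {j : ℕ}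

theorem lapL2_coeFn (hf : GradMemH 1 f) : lapL2 f =ᵐ[volume] weakLaplacian f := by
  have h1 : ∀ s : Finset (Fin n), (∑ i ∈ s, toL2 (weakPartial i (weakPartial i f)) : L2 n)
      =ᵐ[volume] fun x => ∑ i ∈ s, weakPartial i (weakPartial i f) x := by
    intro s
    classical
    induction s using Finset.induction_on with
    | empty => simpa using! Lp.coeFn_zero ℝ 2 volume
    | insert a s ha ih =>
      simp only [Finset.sum_insert ha]
      refine (Lp.coeFn_add _ _).trans ?_
      filter_upwards [ih, toL2_coeFn ((hf.grad a).memLp a)] with x h2 h3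
      rw [Pi.add_apply, h2, h3]
  exact h1 _

theorem l2Sq_weakLaplacian (hf : GradMemH 1 f) : l2Sq (weakLaplacian f) = ‖lapL2 f‖ₑ ^ 2 := by
  rw [l2Sq, ← eLpNorm_congr_ae (lapL2_coeFn hf), Lp.enorm_def]

theorem enorm_gradL2_sq (hf : GradMemH j f) :
    ‖gradL2 f‖ₑ ^ 2 = ∑ i, eLpNorm (weakPartial i f) 2 volume ^ 2 := by
  have h1 : ‖gradL2 f‖ ^ 2 = ∑ i, ‖toL2 (weakPartial i f)‖ ^ 2 := PiLp.norm_sq_eq_of_L2 _ _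
  rw [← ofReal_norm, ← ENNReal.ofReal_pow (norm_nonneg _), h1,
    ENNReal.ofReal_sum_of_nonneg fun i _ => sq_nonneg _]
  refine Finset.sum_congr rfl fun i _ => ?_
  rw [ENNReal.ofReal_pow (norm_nonneg _), ofReal_norm, enorm_toL2 (hf.memLp i)]

theorem l2Sq_weakGrad (hf : GradMemH j f) : l2Sq (weakGrad f) = ‖gradL2 f‖ₑ ^ 2 := by
  have hsq : ∀ {F : Type} [NormedAddCommGroup F] (u : Rn n → F),
      eLpNorm u 2 volume ^ 2 = ∫⁻ x, ‖u x‖ₑ ^ 2 := fun u => by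
    rw [eLpNorm_two_eq, ← ENNReal.rpow_natCast, ← ENNReal.rpow_mul]
    norm_num
  rw [enorm_gradL2_sq hf, l2Sq, hsq]
  simp only [hsq]
  rw [← lintegral_finsetSum']
  · refine lintegral_congr fun x => ?_
    rw [← ofReal_norm, ← ENNReal.ofReal_pow (norm_nonneg _), EuclideanSpace.norm_sq_eq,
      ENNReal.ofReal_sum_of_nonneg fun i _ => sq_nonneg _]
    refine Finset.sum_congr rfl fun i _ => ?_
    rw [ENNReal.ofReal_pow (norm_nonneg _), ofReal_norm]
    rfl
  · exact fun i _ => (hf.memLp i).1.enorm.pow_const 2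

theorem enorm_gradL2_sq_le (hf : GradMemH j f) : ‖gradL2 f‖ₑ ^ 2 ≤ gradNormHSq j f := by
  rw [enorm_gradL2_sq hf]
  exact Finset.sum_le_sum fun i _ => normHSq_mono (Nat.zero_le j) (weakPartial i f)

theorem enorm_lapL2_sq_le (hf : GradMemH 1 f) :
    ‖lapL2 f‖ₑ ^ 2 ≤ n * gradNormHSq 1 f := by
  have h1 : ‖lapL2 f‖ ^ 2 ≤ n * ∑ i, ‖toL2 (weakPartial i (weakPartial i f))‖ ^ 2 := by
    have h2 := norm_sum_le Finset.univ fun i => toL2 (weakPartial i (weakPartial i f))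
    have h3 := sq_sum_le_card_mul_sum_sq (s := Finset.univ)
      (f := fun i => ‖toL2 (weakPartial i (weakPartial i f))‖)
    rw [Finset.card_univ, Fintype.card_fin] at h3
    exact (pow_le_pow_left₀ (norm_nonneg _) h2 2).trans h3
  rw [← ofReal_norm, ← ENNReal.ofReal_pow (norm_nonneg _)]
  refine (ENNReal.ofReal_le_ofReal h1).trans ?_
  rw [ENNReal.ofReal_mul (Nat.cast_nonneg n), ENNReal.ofReal_natCast,
    ENNReal.ofReal_sum_of_nonneg fun i _ => sq_nonneg _]
  refine mul_le_mul_right (Finset.sum_le_sum fun i _ => ?_) _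
  rw [ENNReal.ofReal_pow (norm_nonneg _), ofReal_norm, enorm_toL2 ((hf.grad i).memLp i)]
  refine le_trans ?_ (le_add_self : _ ≤ normHSq 1 (weakPartial i f))
  exact Finset.single_le_sum (f := fun l => normHSq 0 (weakPartial l (weakPartial i f)))
    (fun _ _ => zero_le) (Finset.mem_univ i)

theorem inner_gradL2 (hf : GradMemH 1 f) (hh : GradMemH j h) (h0 : MemLp h 2 volume) :
    ⟪gradL2 f, gradL2 h⟫ = -⟪lapL2 f, toL2 h⟫ := by
  have h1 : ⟪gradL2 f, gradL2 h⟫ = ∑ i, ⟪toL2 (weakPartial i f), toL2 (weakPartial i h)⟫ :=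
    PiLp.inner_apply _ _
  rw [h1, lapL2, sum_inner, ← Finset.sum_neg_distrib]
  refine Finset.sum_congr rfl fun i _ => ?_
  rw [inner_toL2 (hf.memLp i) (hh.memLp i), inner_toL2 ((hf.grad i).memLp i) h0]
  exact (hh.hasL2Grad h0).integral_mul_grad (hf.memLp i) ((hf.grad i).memLp i)
    ((hf.grad i).isWeakPartial i)

theorem inner_gradL2_test (hf : GradMemH j f) {φ : Rn n → ℝ} (hφ : IsTestFunction φ) (i : Fin n) :
    ⟪gradL2 f i, toL2 φ⟫ = -∫ x, f x * pd i φ x := by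
  change ⟪toL2 (weakPartial i f), toL2 φ⟫ = _
  rw [inner_toL2 (hf.memLp i) (hφ.memLp 2), (hf.isWeakPartial i).integral_pd hφ, neg_neg]

theorem inner_lapL2_test (hf : GradMemH 1 f) {φ : Rn n → ℝ} (hφ : IsTestFunction φ) :
    ⟪lapL2 f, toL2 φ⟫ = ∫ x, f x * (Δ φ) x := by
  rw [lapL2, sum_inner]
  by_cases hn : n = 0
  · subst hn
    simp [laplacian_eq_sum_pd hφ.1]
  have hl : LocallyIntegrable f volume :=
    (hf.isWeakPartial ⟨0, Nat.pos_of_ne_zero hn⟩).1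
  simp only [laplacian_eq_sum_pd hφ.1, Finset.mul_sum]
  rw [integral_finsetSum _ fun i _ => ((hφ.pd i).pd i).integrable_mul hl]
  refine Finset.sum_congr rfl fun i _ => ?_
  rw [inner_toL2 ((hf.grad i).memLp i) (hφ.memLp 2), (hf.isWeakPartial i).integral_pd (hφ.pd i),
    ((hf.grad i).isWeakPartial i).integral_pd hφ, neg_neg]

theorem sum_norm_hess_sq (hf : GradMemH 2 f) :
    ∑ i, ∑ l, ‖toL2 (weakPartial l (weakPartial i f))‖ ^ 2 = ‖lapL2 f‖ ^ 2 := by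
  have h1 : GradMemH 1 f := hf.mono (by norm_num)
  rw [← real_inner_self_eq_norm_sq, lapL2]
  simp only [sum_inner, inner_sum]
  refine Finset.sum_congr rfl fun i _ => Finset.sum_congr rfl fun l _ => ?_
  have g1 := (h1.grad i).hasL2Grad (h1.memLp i)
  have g2 := (h1.grad l).hasL2Grad (h1.memLp l)
  have hc : weakPartial l (weakPartial i f) =ᵐ[volume] weakPartial i (weakPartial l f) :=
    (h1.isWeakPartial i).comm (h1.isWeakPartial l) ((h1.grad i).isWeakPartial l)
      ((h1.grad l).isWeakPartial i)
  have e1 := g1.integral_grad_mul_grad_comm g2 i l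
  have m1 := (h1.grad i).memLp i
  have m2 := (h1.grad l).memLp l
  have m3 := (h1.grad i).memLp l
  have m4 := (h1.grad l).memLp i
  rw [inner_toL2 m2 m1, ← real_inner_self_eq_norm_sq]
  nth_rewrite 1 [toL2_congr m3 hc]
  rw [inner_toL2 m4 m3]
  exact e1

end Norms

end JMGT
end

noncomputable section

namespace JMGT

local notation "⟪" x ", " y "⟫" => inner ℝ x y

variable {n : ℕ}

/-! ### Weak measurability in separable Hilbert spaces -/

section WeakMeasurability

variable {X : Type*} [NormedAddCommGroup X] [InnerProductSpace ℝ X] [CompleteSpace X]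

theorem mem_of_isClosed_of_orthogonal {P : X → Prop} {A : Set X} (hA : ∀ e ∈ A, P e)
    (h0 : P 0) (hadd : ∀ x y, P x → P y → P (x + y)) (hsmul : ∀ (r : ℝ) x, P x → P (r • x))
    (hc : IsClosed {x | P x}) (hsep : ∀ a, (∀ e ∈ A, ⟪a, e⟫ = 0) → a = 0) (x : X) : P x := by
  let V : Submodule ℝ X :=
    { carrier := {x | P x}
      add_mem' := fun {x y} hx hy => hadd x y hx hy
      zero_mem' := h0
      smul_mem' := fun r x hx => hsmul r x hx }
  have hVc : IsClosed (V : Set X) := hc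
  have : CompleteSpace V := hVc.completeSpace_coe
  have hV : V = ⊤ := by
    rw [← Submodule.orthogonal_eq_bot_iff, Submodule.eq_bot_iff]
    refine fun a ha => hsep a fun e he => ?_
    rw [real_inner_comm]
    exact (Submodule.mem_orthogonal V a).1 ha e (hA e he)
  have : x ∈ V := hV ▸ Submodule.mem_top
  exact this

theorem aestronglyMeasurable_of_inner [TopologicalSpace.SeparableSpace X] {α : Type*}
    [MeasurableSpace α] {μ : Measure α} {a : α → X} {A : Set X}
    (hA : ∀ e ∈ A, AEStronglyMeasurable (fun s => ⟪a s, e⟫) μ)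
    (hsep : ∀ a, (∀ e ∈ A, ⟪a, e⟫ = 0) → a = 0) : AEStronglyMeasurable a μ := by
  have hall : ∀ e, AEStronglyMeasurable (fun s => ⟪a s, e⟫) μ := by
    refine mem_of_isClosed_of_orthogonal hA ?_ ?_ ?_ ?_ hsep
    · simpa using aestronglyMeasurable_const
    · intro x y hx hy
      simp only [inner_add_right]
      exact hx.add hy
    · intro r x hx
      simp only [real_inner_smul_right]
      exact hx.const_mul r
    · refine isSeqClosed_iff_isClosed.1 fun u x hu hx => ?_
      exact aestronglyMeasurable_of_tendsto_ae atTop hu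
        (ae_of_all _ fun s => (tendsto_const_nhds.inner hx))
  obtain ⟨w, b, -⟩ := exists_hilbertBasis ℝ X
  have hw : Countable w := by
    have hd : Pairwise (Function.onFun Disjoint fun i => Metric.ball (b i) (1 / 2)) := by
      intro i j hij
      refine Metric.ball_disjoint_ball ?_
      have h1 : ‖b i - b j‖ ^ 2 = 2 := by
        rw [norm_sub_sq_real, b.orthonormal.2 hij, b.orthonormal.1, b.orthonormal.1]
        norm_num
      rw [dist_eq_norm]
      nlinarith [norm_nonneg (b i - b j)]
    exact hd.countable_of_isOpen_disjoint (fun _ => Metric.isOpen_ball)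
      fun i => ⟨b i, Metric.mem_ball_self (by norm_num)⟩
  refine aestronglyMeasurable_of_tendsto_ae (SummationFilter.unconditional w).filter
    (f := fun (I : Finset w) s => ∑ i ∈ I, b.repr (a s) i • b i) (fun I => ?_)
    (ae_of_all _ fun s => b.hasSum_repr (a s))
  refine Finset.aestronglyMeasurable_fun_sum _ fun i _ => ?_
  refine AEStronglyMeasurable.smul ?_ aestronglyMeasurable_const
  refine (hall (b i)).congr (ae_of_all _ fun s => ?_)
  simp only [b.repr_apply_apply, real_inner_comm]

end WeakMeasurability

/-! ### Gradients and Laplacians through test functions -/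

section WeakOperator

variable {X : Type*} [NormedAddCommGroup X] [InnerProductSpace ℝ X]

/-- A linear operator `A` on functions, with values in a Hilbert space, whose components are
determined by integration against test functions. -/
structure IsWeakOperator (A : (Rn n → ℝ) → X) (L : Set (X × (Rn n → ℝ))) : Prop where
  test : ∀ p ∈ L, IsTestFunction p.2
  inner_eq : ∀ f, GradMemH 1 f → ∀ p ∈ L, ⟪A f, p.1⟫ = ∫ x, f x * p.2 x
  sep : ∀ a, (∀ p ∈ L, ⟪a, p.1⟫ = 0) → a = 0
  sub : ∀ f h, GradMemH 1 f → GradMemH 1 h → A (f - h) = A f - A h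
  bound : ∃ C : ℝ≥0, ∀ f, GradMemH 1 f → ‖A f‖ₑ ^ 2 ≤ C * gradNormHSq 1 f

theorem IsWeakOperator.ext {A : (Rn n → ℝ) → X} {L : Set (X × (Rn n → ℝ))}
    (hA : IsWeakOperator A L) {a b : X} (h : ∀ p ∈ L, ⟪a, p.1⟫ = ⟪b, p.1⟫) : a = b :=
  sub_eq_zero.1 (hA.sep _ fun p hp => by rw [inner_sub_left, h p hp, sub_self])

/-- The test functions for `gradL2`. -/
def gradTests (n : ℕ) : Set (L2Vec n × (Rn n → ℝ)) :=
  {p | ∃ (i : Fin n) (φ : Rn n → ℝ), IsTestFunction φ ∧ p = (WithLp.toLp 2 (Pi.single i (toL2 φ)), -pd i φ)}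

/-- The test functions for `lapL2`. -/
def lapTests (n : ℕ) : Set (L2 n × (Rn n → ℝ)) :=
  {p | ∃ φ, IsTestFunction φ ∧ p = (toL2 φ, Δ φ)}

theorem inner_toLp_single (a : L2Vec n) (i : Fin n) (e : L2 n) :
    ⟪a, (WithLp.toLp 2 (Pi.single i e) : L2Vec n)⟫ = ⟪a i, e⟫ := by
  rw [PiLp.inner_apply, Finset.sum_eq_single i]
  · simp
  · intro l _ hl
    simp [Pi.single_eq_of_ne hl]
  · simp

theorem isWeakOperator_gradL2 : IsWeakOperator (gradL2 (n := n)) (gradTests n) where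
  test := by
    rintro _ ⟨i, φ, hφ, rfl⟩
    exact ⟨(hφ.pd i).1.neg, (hφ.pd i).2.neg⟩
  inner_eq := by
    rintro f hf _ ⟨i, φ, hφ, rfl⟩
    rw [inner_toLp_single, inner_gradL2_test hf hφ, ← integral_neg]
    simp
  sep := by
    intro a ha
    refine PiLp.ext fun i => eq_of_inner_test fun φ hφ => ?_
    have := ha (WithLp.toLp 2 (Pi.single i (toL2 φ)), -pd i φ) ⟨i, φ, hφ, rfl⟩
    rw [inner_toLp_single] at this
    simpa using this
  sub := fun f h hf hh => gradL2_sub hf hh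
  bound := ⟨1, fun f hf => by simpa using enorm_gradL2_sq_le hf⟩

theorem isWeakOperator_lapL2 : IsWeakOperator (lapL2 (n := n)) (lapTests n) where
  test := by
    rintro _ ⟨φ, hφ, rfl⟩
    exact hφ.laplacian
  inner_eq := by
    rintro f hf _ ⟨φ, hφ, rfl⟩
    exact inner_lapL2_test hf hφ
  sep := by
    intro a ha
    refine eq_of_inner_test fun φ hφ => ?_
    simpa using ha _ ⟨φ, hφ, rfl⟩
  sub := fun f h hf hh => lapL2_sub hf hh
  bound := ⟨n, fun f hf => by simpa using enorm_lapL2_sq_le hf⟩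

end WeakOperator

/-! ### Solutions extended to all times -/

/-- A solution on `[0,T]`, extended continuously to all times. -/
structure IsExtendedSolution (τ b c k : ℝ) (g : ℝ → ℝ) (T : ℝ) (Ψ : ℝ → State n) : Prop
    extends IsSolution τ b c k g 2 T Ψ where
  mem_all : ∀ t, MemPhase g 2 (Ψ t)
  cont_all : ∀ t₀, Tendsto (fun t => phaseNormSq g 2 ((Ψ t).diff (Ψ t₀))) (𝓝 t₀) (𝓝 0)

theorem IsSolution.extend {τ b c k T : ℝ} {g : ℝ → ℝ} {Ψ : ℝ → State n}
    (h : IsSolution τ b c k g 2 T Ψ) {t : ℝ} (ht0 : 0 ≤ t) (htT : t ≤ T) :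
    IsExtendedSolution τ b c k g t fun s => Ψ (max 0 (min s t)) := by
  have hm : ∀ s, max 0 (min s t) ∈ Icc 0 T := fun s =>
    ⟨le_max_left _ _, max_le (ht0.trans htT) ((min_le_right _ _).trans htT)⟩
  have hid : ∀ s ∈ Icc 0 t, max 0 (min s t) = s := fun s hs => by
    rw [min_eq_left hs.2, max_eq_right hs.1]
  have hsub : Icc 0 t ⊆ Icc 0 T := Icc_subset_Icc_right htT
  have h0 : max 0 (min 0 t) = 0 := hid 0 ⟨le_rfl, ht0⟩
  have hint : ∀ s ∈ Icc 0 t, ∀ F : ℝ → ℝ,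
      ∫ σ in (0 : ℝ)..s, F σ = ∫ σ in (0 : ℝ)..s, F (max 0 (min σ t)) := fun s hs F =>
    intervalIntegral.integral_congr fun σ hσ => by
      rw [uIcc_of_le hs.1] at hσ
      simp only [hid σ ⟨hσ.1, hσ.2.trans hs.2⟩]
  have hc : ∀ t₀, Tendsto (fun s => phaseNormSq g 2
      ((Ψ (max 0 (min s t))).diff (Ψ (max 0 (min t₀ t))))) (𝓝 t₀) (𝓝 0) := fun t₀ => by
    refine (h.cont _ (hm t₀)).comp (f := fun s => max 0 (min s t)) ?_
    exact tendsto_nhdsWithin_iff.2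
      ⟨(continuous_const.max (continuous_id.min continuous_const)).continuousAt,
        Eventually.of_forall hm⟩
  exact
    { mem := fun s _ => h.mem _ (hm s)
      cont := fun t₀ _ => (hc t₀).mono_left nhdsWithin_le_nhds
      eq_ψ := fun s hs φ hφ => by
        simp only [h0, hid s hs]
        rw [h.eq_ψ s (hsub hs) φ hφ, hint s hs]
      eq_v := fun s hs φ hφ => by
        simp only [h0, hid s hs]
        rw [h.eq_v s (hsub hs) φ hφ, hint s hs]
      eq_w := fun s hs φ hφ => by
        simp only [h0, hid s hs]
        rw [h.eq_w s (hsub hs) φ hφ, hint s hs]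
      eq_η := fun s hs φ hφ χ h1 h2 h3 => by
        simp only [h0, hid s hs]
        rw [h.eq_η s (hsub hs) φ hφ χ h1 h2 h3, hint s hs]
      mem_all := fun s => h.mem _ (hm s)
      cont_all := hc }

theorem hasDerivWithinAt_of_eq_add_integral {X : Type*} [NormedAddCommGroup X] [NormedSpace ℝ X]
    [CompleteSpace X] {a b : ℝ → X} {T : ℝ} (hb : Continuous b)
    (h : ∀ t ∈ Icc 0 T, a t = a 0 + ∫ σ in (0 : ℝ)..t, b σ) :
    ∀ t ∈ Ico 0 T, HasDerivWithinAt a (b t) (Ici t) t := by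
  intro t ht
  have h1 : HasDerivAt (fun t => a 0 + ∫ σ in (0 : ℝ)..t, b σ) (b t) t :=
    ((hb.integral_hasStrictDerivAt 0 t).hasDerivAt).const_add _
  refine h1.hasDerivWithinAt.congr_of_eventuallyEq ?_ (h t ⟨ht.1, ht.2.le⟩)
  filter_upwards [Icc_mem_nhdsGE ht.2] with s hs using h s ⟨ht.1.trans hs.1, hs.2⟩

theorem tendsto_of_enorm_sq_le {X : Type*} [NormedAddCommGroup X] {a : ℝ → X} {q : ℝ → ℝ≥0∞}
    {t₀ : ℝ} {C : ℝ≥0} (hq : Tendsto q (𝓝 t₀) (𝓝 0))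
    (h : ∀ t, ‖a t - a t₀‖ₑ ^ 2 ≤ C * q t) : ContinuousAt a t₀ := by
  have h1 : Tendsto (fun t => (C : ℝ≥0∞) * q t) (𝓝 t₀) (𝓝 0) := by
    simpa using ENNReal.Tendsto.const_mul hq (Or.inr ENNReal.coe_ne_top)
  have h2 : Tendsto (fun t => ‖a t - a t₀‖ₑ ^ 2) (𝓝 t₀) (𝓝 0) :=
    tendsto_of_tendsto_of_tendsto_of_le_of_le tendsto_const_nhds h1 (fun _ => zero_le) h
  have h3 : Tendsto (fun t => ‖a t - a t₀‖ₑ) (𝓝 t₀) (𝓝 0) := by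
    have := ((ENNReal.continuous_rpow_const (y := 1 / 2)).tendsto 0).comp h2
    simp only [Function.comp_def, ← ENNReal.rpow_natCast, ← ENNReal.rpow_mul] at this
    norm_num at this
    exact this
  have h4 := (ENNReal.tendsto_toReal ENNReal.zero_ne_top).comp h3
  rw [ContinuousAt, tendsto_iff_norm_sub_tendsto_zero]
  simpa [Function.comp_def] using h4

namespace IsExtendedSolution

variable {τ b c k T : ℝ} {g : ℝ → ℝ} {Ψ : ℝ → State n}

theorem gradMemH_ψ (X : IsExtendedSolution τ b c k g T Ψ) (t : ℝ) : GradMemH 2 (Ψ t).ψ :=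
  (X.mem_all t).1

theorem gradMemH_v (X : IsExtendedSolution τ b c k g T Ψ) (t : ℝ) : GradMemH 2 (Ψ t).v :=
  (X.mem_all t).2.1.2

theorem gradMemH_w (X : IsExtendedSolution τ b c k g T Ψ) (t : ℝ) : GradMemH 1 (Ψ t).w :=
  (X.mem_all t).2.2.1.2

theorem memLp_v (X : IsExtendedSolution τ b c k g T Ψ) (t : ℝ) : MemLp (Ψ t).v 2 volume :=
  (X.mem_all t).2.1.1

theorem memLp_w (X : IsExtendedSolution τ b c k g T Ψ) (t : ℝ) : MemLp (Ψ t).w 2 volume :=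
  (X.mem_all t).2.2.1.1

section Operator

variable {E : Type*} [NormedAddCommGroup E] [InnerProductSpace ℝ E] [CompleteSpace E]
  {A : (Rn n → ℝ) → E} {L : Set (E × (Rn n → ℝ))}

theorem continuous_operator (X : IsExtendedSolution τ b c k g T Ψ) (hA : IsWeakOperator A L)
    {p : State n → Rn n → ℝ} (hp : ∀ t, GradMemH 1 (p (Ψ t)))
    (hd : ∀ s t, p ((Ψ s).diff (Ψ t)) = p (Ψ s) - p (Ψ t))
    (hb : ∀ Φ : State n, gradNormHSq 1 (p Φ) ≤ phaseNormSq g 2 Φ) :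
    Continuous fun t => A (p (Ψ t)) := by
  obtain ⟨C, hC⟩ := hA.bound
  refine continuous_iff_continuousAt.2 fun t₀ => tendsto_of_enorm_sq_le (C := C) (X.cont_all t₀)
    fun t => ?_
  rw [← hA.sub _ _ (hp t) (hp t₀)]
  refine (hC _ ((hp t).sub (hp t₀))).trans (mul_le_mul_right ?_ _)
  rw [← hd]
  exact hb _

theorem continuous_operator_ψ (X : IsExtendedSolution τ b c k g T Ψ) (hA : IsWeakOperator A L) :
    Continuous fun t => A (Ψ t).ψ :=
  X.continuous_operator hA (p := State.ψ) (fun t => (X.gradMemH_ψ t).mono (by norm_num))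
    (fun _ _ => rfl) fun Φ => (gradNormHSq_mono (by norm_num) _).trans
      (le_self_add.trans (le_self_add.trans le_self_add))

theorem continuous_operator_v (X : IsExtendedSolution τ b c k g T Ψ) (hA : IsWeakOperator A L) :
    Continuous fun t => A (Ψ t).v :=
  X.continuous_operator hA (p := State.v) (fun t => (X.gradMemH_v t).mono (by norm_num))
    (fun _ _ => rfl) fun Φ => (gradNormHSq_mono (i := 1) (j := 2) (by norm_num) _).trans
      ((le_add_self : gradNormHSq 2 Φ.v ≤ normHSq 3 Φ.v).trans
        (le_add_self.trans (le_self_add.trans le_self_add)))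

theorem continuous_operator_w (X : IsExtendedSolution τ b c k g T Ψ) (hA : IsWeakOperator A L) :
    Continuous fun t => A (Ψ t).w :=
  X.continuous_operator hA (p := State.w) (fun t => X.gradMemH_w t)
    (fun _ _ => rfl) fun Φ =>
      (le_add_self : gradNormHSq 1 Φ.w ≤ normHSq 2 Φ.w).trans (le_add_self.trans le_self_add)

theorem continuous_toL2 (X : IsExtendedSolution τ b c k g T Ψ)
    {p : State n → Rn n → ℝ} (hp : ∀ t, MemLp (p (Ψ t)) 2 volume)
    (hd : ∀ s t, p ((Ψ s).diff (Ψ t)) = p (Ψ s) - p (Ψ t))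
    (hb : ∀ Φ : State n, eLpNorm (p Φ) 2 volume ^ 2 ≤ phaseNormSq g 2 Φ) :
    Continuous fun t => toL2 (p (Ψ t)) := by
  refine continuous_iff_continuousAt.2 fun t₀ => tendsto_of_enorm_sq_le (C := 1) (X.cont_all t₀)
    fun t => ?_
  rw [← toL2_sub (hp t) (hp t₀), enorm_toL2 ((hp t).sub (hp t₀)), ← hd, ENNReal.coe_one, one_mul]
  exact hb _

theorem continuous_toL2_v (X : IsExtendedSolution τ b c k g T Ψ) :
    Continuous fun t => toL2 (Ψ t).v :=
  X.continuous_toL2 (p := State.v) X.memLp_v (fun _ _ => rfl) fun Φ =>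
    (le_self_add : _ ≤ normHSq 3 Φ.v).trans (le_add_self.trans (le_self_add.trans le_self_add))

theorem continuous_toL2_w (X : IsExtendedSolution τ b c k g T Ψ) :
    Continuous fun t => toL2 (Ψ t).w :=
  X.continuous_toL2 (p := State.w) X.memLp_w (fun _ _ => rfl) fun Φ =>
    (le_self_add : _ ≤ normHSq 2 Φ.w).trans (le_add_self.trans le_self_add)

theorem inner_integral_right {a : ℝ → E} (ha : Continuous a) (e : E) (s t : ℝ) :
    ⟪∫ σ in s..t, a σ, e⟫ = ∫ σ in s..t, ⟪a σ, e⟫ := by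
  have := (innerSL ℝ e).intervalIntegral_comp_comm (ha.intervalIntegrable (μ := volume) s t)
  simp only [innerSL_apply_apply] at this
  simpa only [real_inner_comm e] using this.symm

theorem operator_ψ_eq (X : IsExtendedSolution τ b c k g T Ψ) (hA : IsWeakOperator A L) :
    ∀ t ∈ Icc 0 T, A (Ψ t).ψ = A (Ψ 0).ψ + ∫ σ in (0 : ℝ)..t, A (Ψ σ).v := by
  intro t ht
  refine hA.ext fun p hp => ?_
  rw [inner_add_left, inner_integral_right (X.continuous_operator_v hA),
    hA.inner_eq _ ((X.gradMemH_ψ _).mono (by norm_num)) p hp,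
    hA.inner_eq _ ((X.gradMemH_ψ _).mono (by norm_num)) p hp, X.eq_ψ t ht _ (hA.test p hp)]
  simp only [fun σ => hA.inner_eq _ ((X.gradMemH_v σ).mono (by norm_num)) p hp]

theorem operator_v_eq (X : IsExtendedSolution τ b c k g T Ψ) (hA : IsWeakOperator A L) :
    ∀ t ∈ Icc 0 T, A (Ψ t).v = A (Ψ 0).v + ∫ σ in (0 : ℝ)..t, A (Ψ σ).w := by
  intro t ht
  refine hA.ext fun p hp => ?_
  rw [inner_add_left, inner_integral_right (X.continuous_operator_w hA),
    hA.inner_eq _ ((X.gradMemH_v _).mono (by norm_num)) p hp,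
    hA.inner_eq _ ((X.gradMemH_v _).mono (by norm_num)) p hp, X.eq_v t ht _ (hA.test p hp)]
  simp only [fun σ => hA.inner_eq _ (X.gradMemH_w σ) p hp]

end Operator

theorem toL2_v_eq (X : IsExtendedSolution τ b c k g T Ψ) :
    ∀ t ∈ Icc 0 T, toL2 (Ψ t).v = toL2 (Ψ 0).v + ∫ σ in (0 : ℝ)..t, toL2 (Ψ σ).w := by
  intro t ht
  refine eq_of_inner_test fun φ hφ => ?_
  rw [inner_add_left, inner_integral_right X.continuous_toL2_w,
    inner_toL2 (X.memLp_v t) (hφ.memLp 2), inner_toL2 (X.memLp_v 0) (hφ.memLp 2), X.eq_v t ht _ hφ]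
  simp only [fun σ => inner_toL2 (X.memLp_w σ) (hφ.memLp 2)]

end IsExtendedSolution

end JMGT
end

noncomputable section

namespace JMGT

/-! ### The transport equation on a half line -/

section Transport

variable {E : Type*} [NormedAddCommGroup E] [NormedSpace ℝ E]

theorem continuous_integral_shift_smul {q : ℝ} {p : ℝ → ℝ → E} {χ : ℝ → ℝ} (hχ : Continuous χ)
    (hχc : HasCompactSupport χ) (hp : ∀ t, IntegrableOn (p t) (Ioc 0 q))
    (hc : ∀ t₀, Tendsto (fun t => ∫ s in Ioc 0 q, ‖p t s - p t₀ s‖) (𝓝 t₀) (𝓝 0)) (r : ℝ) :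
    Continuous fun z : ℝ × ℝ => ∫ s in Ioc 0 q, χ (s + r - z.1) • p z.2 s := by
  obtain ⟨M, hM⟩ := hχc.exists_bound_of_continuous hχ
  have hχm : ∀ σ, AEStronglyMeasurable (fun s => χ (s + r - σ)) (volume.restrict (Ioc 0 q)) :=
    fun σ => (by fun_prop : Continuous fun s => χ (s + r - σ)).aestronglyMeasurable
  have hi : ∀ σ (f : ℝ → E), IntegrableOn f (Ioc 0 q) →
      IntegrableOn (fun s => χ (s + r - σ) • f s) (Ioc 0 q) := fun σ f hf =>
    (hf.norm.const_mul M).mono' ((hχm σ).smul hf.1) (ae_of_all _ fun s => by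
      rw [norm_smul]
      exact mul_le_mul_of_nonneg_right (hM _) (norm_nonneg _))
  refine continuous_iff_continuousAt.2 fun z₀ => ?_
  have h1 : Continuous fun z : ℝ × ℝ => ∫ s in Ioc 0 q, χ (s + r - z.1) • p z₀.2 s :=
    continuous_of_dominated (fun z => (hi z.1 _ (hp z₀.2)).1)
      (fun z => ae_of_all _ fun s => by
        rw [norm_smul]
        exact mul_le_mul_of_nonneg_right (hM _) (norm_nonneg _))
      ((hp z₀.2).norm.const_mul M) (ae_of_all _ fun s => by fun_prop)
  have h2 : Tendsto (fun z : ℝ × ℝ => ∫ s in Ioc 0 q, χ (s + r - z.1) • (p z.2 s - p z₀.2 s))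
      (𝓝 z₀) (𝓝 0) := by
    have h3 : Tendsto (fun z : ℝ × ℝ => M * ∫ s in Ioc 0 q, ‖p z.2 s - p z₀.2 s‖) (𝓝 z₀) (𝓝 0) := by
      simpa using ((hc z₀.2).comp continuous_snd.continuousAt).const_mul M
    refine squeeze_zero_norm (fun z => ?_) h3
    rw [← integral_const_mul]
    refine norm_integral_le_of_norm_le (((hp z.2).sub (hp z₀.2)).norm.const_mul M)
      (ae_of_all _ fun s => ?_)
    rw [norm_smul]
    exact mul_le_mul_of_nonneg_right (hM _) (norm_nonneg _)
  have h3 := (h1.tendsto z₀).add h2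
  rw [ContinuousAt]
  simp only [add_zero] at h3
  refine h3.congr fun z => ?_
  have h4 := integral_add (hi z.1 _ (hp z₀.2)) (hi z.1 _ ((hp z.2).sub (hp z₀.2)))
  simp only [← smul_add, Pi.sub_apply, add_sub_cancel] at h4
  exact h4.symm

variable [CompleteSpace E]

/-- `p(t, s)` solves `p_t = y - p_s`, `p(t, 0) = 0` for `0 < s < q` and `0 ≤ t ≤ T`. -/
structure IsTransport (q T : ℝ) (p : ℝ → ℝ → E) (y : ℝ → E) : Prop where
  integrable : ∀ t, IntegrableOn (p t) (Ioc 0 q)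
  cont : ∀ t₀, Tendsto (fun t => ∫ s in Ioc 0 q, ‖p t s - p t₀ s‖) (𝓝 t₀) (𝓝 0)
  cont_source : Continuous y
  eq : ∀ t ∈ Icc 0 T, ∀ χ : ℝ → ℝ, ContDiff ℝ ∞ χ → HasCompactSupport χ → tsupport χ ⊆ Iio q →
    ∫ s in Ioc 0 q, χ s • p t s = (∫ s in Ioc 0 q, χ s • p 0 s) +
      ∫ σ in (0 : ℝ)..t, ((∫ s in Ioc 0 q, χ s) • y σ + ∫ s in Ioc 0 q, deriv χ s • p σ s)

namespace IsTransport

variable {q T : ℝ} {p : ℝ → ℝ → E} {y : ℝ → E}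

theorem integral_characteristic (h : IsTransport q T p y) {t₀ t : ℝ} (h0 : 0 ≤ t₀) (h1 : t₀ < t)
    (h2 : t ≤ T) {χ : ℝ → ℝ} (hχ : ContDiff ℝ ∞ χ) (hχc : HasCompactSupport χ)
    (hχq : tsupport χ ⊆ Iio q) :
    ∫ s in Ioc 0 q, χ s • p t s = (∫ s in Ioc 0 q, χ (s + t - t₀) • p t₀ s)
      + ∫ σ in t₀..t, (∫ s in Ioc 0 q, χ (s + t - σ)) • y σ := by
  have hd : Continuous (deriv χ) := hχ.continuous_deriv (by simp)
  have hdc : HasCompactSupport (deriv χ) := hχc.deriv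
  obtain ⟨M, hM⟩ := hdc.exists_bound_of_continuous hd
  obtain ⟨M₀, hM₀⟩ := hχc.exists_bound_of_continuous hχ.continuous
  set f : ℝ → ℝ → E := fun σ r => ∫ s in Ioc 0 q, χ (s + t - σ) • p r s with hf
  set K : ℝ → ℝ → E := fun σ r => ∫ s in Ioc 0 q, deriv χ (s + t - σ) • p r s with hK
  set m : ℝ → ℝ := fun σ => ∫ s in Ioc 0 q, χ (s + t - σ) with hm
  have cf : Continuous fun z : ℝ × ℝ => f z.1 z.2 :=
    continuous_integral_shift_smul hχ.continuous hχc h.integrable h.cont t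
  have cK : Continuous fun z : ℝ × ℝ => K z.1 z.2 :=
    continuous_integral_shift_smul hd hdc h.integrable h.cont t
  have cm : Continuous m := by
    have := continuous_integral_shift_smul (E := ℝ) (q := q) (p := fun _ _ => 1) hχ.continuous hχc
      (fun _ => by simp) (fun _ => by simp) t
    simpa [hm, Function.comp_def] using
      this.comp (continuous_id.prodMk (continuous_const (y := (0 : ℝ))))
  have cK2 : ∀ σ, Continuous (K σ) := fun σ =>
    cK.comp (continuous_const.prodMk continuous_id)
  have d1 : ∀ σ r, HasDerivAt (fun σ => f σ r) (-K σ r) σ := by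
    intro σ r
    have := (hasDerivAt_integral_of_dominated_loc_of_deriv_le (μ := volume.restrict (Ioc 0 q))
      (F := fun σ s => χ (s + t - σ) • p r s) (F' := fun σ s => -(deriv χ (s + t - σ) • p r s))
      (bound := fun s => M * ‖p r s‖) (x₀ := σ) (s := univ) univ_mem
      (Eventually.of_forall fun σ => (by have := hχ.continuous; fun_prop :
        Continuous fun s => χ (s + t - σ)).aestronglyMeasurable.smul (h.integrable r).1)
      ?_ ?_ ?_ ((h.integrable r).norm.const_mul M) ?_).2
    · rw [integral_neg] at this
      exact this
    · refine ((h.integrable r).norm.const_mul M₀).mono' ((by have := hχ.continuous; fun_prop :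
        Continuous fun s => χ (s + t - σ)).aestronglyMeasurable.smul (h.integrable r).1)
        (ae_of_all _ fun s => ?_)
      rw [norm_smul]
      exact mul_le_mul_of_nonneg_right (hM₀ _) (norm_nonneg _)
    · exact ((by fun_prop : Continuous fun s =>
        deriv χ (s + t - σ)).aestronglyMeasurable.smul (h.integrable r).1).neg
    · refine ae_of_all _ fun s σ _ => ?_
      rw [norm_neg, norm_smul]
      exact mul_le_mul_of_nonneg_right (hM _) (norm_nonneg _)
    · refine ae_of_all _ fun s σ _ => ?_
      have h3 : HasDerivAt χ (deriv χ (s + t - σ)) (s + t - σ) :=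
        (hχ.differentiable (by simp) _).hasDerivAt
      have h4 := (h3.comp_const_sub (s + t) σ).smul_const (p r s)
      rwa [neg_smul] at h4
  have d2 : ∀ σ < t, ∀ r ∈ Ioo 0 T, HasDerivAt (fun r => f σ r) (m σ • y r + K σ r) r := by
    intro σ hσ r hr
    have h3 : Continuous fun r => m σ • y r + K σ r :=
      (continuous_const.smul h.cont_source).add (cK2 σ)
    have h4 : HasDerivAt (fun r => f σ 0 + ∫ ρ in (0 : ℝ)..r, (m σ • y ρ + K σ ρ))
        (m σ • y r + K σ r) r :=
      ((h3.integral_hasStrictDerivAt 0 r).hasDerivAt).const_add _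
    refine h4.congr_of_eventuallyEq ?_
    filter_upwards [Icc_mem_nhds hr.1 hr.2] with ρ hρ
    have h5 := h.eq ρ hρ (fun s => χ (s + t - σ))
      (hχ.comp ((contDiff_id.add contDiff_const).sub contDiff_const)) ?_ ?_
    · refine h5.trans ?_
      congr 1
      refine intervalIntegral.integral_congr fun ρ _ => ?_
      simp only [hK]
      congr 1
      refine integral_congr_ae (ae_of_all _ fun s => ?_)
      simp only [add_sub_assoc, deriv_comp_add_const]
    · have := hχc.comp_homeomorph (Homeomorph.addRight (t - σ))
      simpa [Function.comp_def, add_sub_assoc] using this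
    · intro s hs
      have h6 : s + t - σ ∈ tsupport χ := by
        have h7 := tsupport_comp_subset_preimage χ
          (f := fun s : ℝ => s + t - σ) (by fun_prop)
        exact h7 hs
      have := hχq h6
      simp only [mem_Iio] at this ⊢
      linarith
  have dJ : ∀ σ ∈ Ioo t₀ t, HasDerivAt (fun σ => f σ σ) (m σ • y σ) σ := by
    intro σ hσ
    have h3 := hasStrictFDerivAt_uncurry_coprod (𝕜 := ℝ) (u := (σ, σ)) (f := f)
      (f₁ := fun σ r => ContinuousLinearMap.toSpanSingleton ℝ (-K σ r))
      (f₂ := fun σ r => ContinuousLinearMap.toSpanSingleton ℝ (m σ • y r + K σ r))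
      (Eventually.of_forall fun v => (d1 v.1 v.2).hasFDerivAt) ?_ ?_ ?_
    · have h4 := HasFDerivAt.comp_hasDerivAt (f := fun x => (x, x)) σ h3.hasFDerivAt
        ((hasDerivAt_id' σ).prodMk (hasDerivAt_id' σ))
      refine h4.congr_deriv ?_
      simp [Function.HasUncurry.uncurry]
    · have h4 : ∀ᶠ v : ℝ × ℝ in 𝓝 (σ, σ), v.1 < t ∧ v.2 ∈ Ioo 0 T :=
        (continuous_fst.continuousAt.eventually (gt_mem_nhds hσ.2)).and
          (continuous_snd.continuousAt.eventually
            (Ioo_mem_nhds (h0.trans_lt hσ.1) (hσ.2.trans_le h2)))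
      filter_upwards [h4] with v hv
      exact (d2 v.1 hv.1 v.2 hv.2).hasFDerivAt
    · exact ((ContinuousLinearMap.toSpanSingletonCLE (𝕜 := ℝ) (E := E)).continuous.comp
        cK.neg).continuousAt
    · have h5 : Continuous fun z : ℝ × ℝ => m z.1 • y z.2 + K z.1 z.2 :=
        ((cm.comp continuous_fst).smul (h.cont_source.comp continuous_snd)).add cK
      exact ((ContinuousLinearMap.toSpanSingletonCLE (𝕜 := ℝ) (E := E)).continuous.comp
        h5).continuousAt
  have h6 := intervalIntegral.integral_eq_sub_of_hasDerivAt_of_le h1.le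
    (f := fun σ => f σ σ) (f' := fun σ => m σ • y σ)
    (cf.comp (continuous_id.prodMk continuous_id)).continuousOn dJ
    ((cm.smul h.cont_source).intervalIntegrable _ _)
  rw [h6]
  simp only [hf, add_sub_cancel_right, add_sub_cancel]

theorem ae_eq (h : IsTransport q T p y) {t₀ t : ℝ} (h0 : 0 ≤ t₀) (h1 : t₀ < t)
    (h2 : t ≤ T) : ∀ᵐ r, r ∈ Ioo 0 q → (Ioc 0 q).indicator (p t) r =
      (Ioc 0 q).indicator (p t₀) (r - (t - t₀))
        + ∫ σ in t₀..t, (Ioc 0 q).indicator (fun _ => y σ) (r - (t - σ)) := by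
  set F : ℝ → ℝ → E := fun σ r => (Ioc 0 q).indicator (fun _ => y σ) (r - (t - σ)) with hF
  have hFm : StronglyMeasurable (Function.uncurry F) := by
    have h3 : Function.uncurry F = ((fun z : ℝ × ℝ => z.2 - (t - z.1)) ⁻¹' Ioc 0 q).indicator
        fun z => y z.1 := by
      ext z
      simp [F, Function.uncurry, indicator]
    rw [h3]
    exact (h.cont_source.comp continuous_fst).stronglyMeasurable.indicator
      ((by fun_prop : Measurable fun z : ℝ × ℝ => z.2 - (t - z.1)) measurableSet_Ioc)
  obtain ⟨M, hM⟩ := isCompact_Icc.exists_bound_of_continuousOn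
    (h.cont_source.continuousOn (s := Icc t₀ t))
  have hFb : ∀ σ ∈ Icc t₀ t, ∀ r, ‖F σ r‖ ≤ M := fun σ hσ r =>
    (norm_indicator_le_norm_self _ _).trans (hM σ hσ)
  have hFi : Integrable (Function.uncurry F)
      ((volume.restrict (uIoc t₀ t)).prod (volume.restrict (Ioc 0 q))) := by
    rw [uIoc_of_le h1.le]
    refine Integrable.of_bound hFm.aestronglyMeasurable M ?_
    rw [Measure.prod_restrict]
    filter_upwards [ae_restrict_mem (measurableSet_Ioc.prod measurableSet_Ioc)] with z hz
    exact hFb _ ⟨hz.1.1.le, hz.1.2⟩ _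
  have hI0 : ∀ t, Integrable ((Ioc 0 q).indicator (p t)) volume := fun t =>
    (integrable_indicator_iff measurableSet_Ioc).2 (h.integrable t)
  have hI1 : Integrable (fun r => (Ioc 0 q).indicator (p t₀) (r - (t - t₀))) volume :=
    (hI0 t₀).comp_sub_right _
  have hI2 : IntegrableOn (fun r => ∫ σ in t₀..t, F σ r) (Ioc 0 q) := by
    have := hFi.integral_prod_right
    simp only [uIoc_of_le h1.le, Function.uncurry] at this
    simp only [intervalIntegral.integral_of_le h1.le]
    exact this
  have key := isOpen_Ioo.ae_eq_zero_of_integral_contDiff_smul_eq_zero (U := Ioo 0 q) (μ := volume)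
    (f := fun r => (Ioc 0 q).indicator (p t) r - (Ioc 0 q).indicator (p t₀) (r - (t - t₀))
      - ∫ σ in t₀..t, F σ r)
    ((((hI0 t).integrableOn.sub hI1.integrableOn).sub
      (hI2.mono_set Ioo_subset_Ioc_self)).locallyIntegrableOn) ?_
  · filter_upwards [key] with r hr hr'
    have := hr hr'
    rw [sub_sub, sub_eq_zero] at this
    exact this
  intro χ hχ hχc hχs
  have hsup : ∀ r, r ∉ Ioc 0 q → χ r = 0 := fun r hr => by
    by_contra hne
    exact hr (Ioo_subset_Ioc_self (hχs (subset_tsupport χ hne)))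
  obtain ⟨M₀, hM₀⟩ := hχc.exists_bound_of_continuous hχ.continuous
  have hres : ∀ f : ℝ → E, ∫ r in Ioc 0 q, χ r • f r = ∫ r, χ r • f r := fun f =>
    setIntegral_eq_integral_of_forall_compl_eq_zero fun r hr => by rw [hsup r hr, zero_smul]
  have hsm : ∀ {μ : Measure ℝ} {f : ℝ → E}, Integrable f μ →
      Integrable (fun r => χ r • f r) μ := fun {μ f} hf =>
    (hf.norm.const_mul M₀).mono' (hχ.continuous.aestronglyMeasurable.smul hf.1)
      (ae_of_all _ fun s => by
        rw [norm_smul]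
        exact mul_le_mul_of_nonneg_right (hM₀ _) (norm_nonneg _))
  have hshift : ∀ (d : ℝ) (f : ℝ → E), ∫ s in Ioc 0 q, χ (s + d) • f s
      = ∫ r in Ioc 0 q, χ r • (Ioc 0 q).indicator f (r - d) := fun d f => by
    rw [hres, ← integral_indicator measurableSet_Ioc,
      ← integral_sub_right_eq_self _ d]
    refine integral_congr_ae (ae_of_all _ fun r => ?_)
    simp only [indicator]
    split_ifs <;> simp
  have e := h.integral_characteristic h0 h1 h2 hχ hχc
    (hχs.trans fun r hr => hr.2)
  have e1 : ∀ σ, (∫ s in Ioc 0 q, χ (s + t - σ)) • y σ = ∫ r in Ioc 0 q, χ r • F σ r := fun σ => by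
    rw [← integral_smul_const]
    simp only [add_sub_assoc]
    exact hshift (t - σ) fun _ => y σ
  have e2 : ∫ σ in t₀..t, ∫ r in Ioc 0 q, χ r • F σ r
      = ∫ r in Ioc 0 q, χ r • ∫ σ in t₀..t, F σ r := by
    rw [intervalIntegral_integral_swap]
    · simp only [intervalIntegral.integral_smul]
    · refine (hFi.norm.const_mul M₀).mono'
        ((hχ.continuous.comp continuous_snd).aestronglyMeasurable.smul hFi.1)
        (ae_of_all _ fun z => ?_)
      simp only [Function.uncurry, norm_smul]
      exact mul_le_mul_of_nonneg_right (hM₀ _) (norm_nonneg _)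
  simp only [e1, e2] at e
  have e3 := hshift (t - t₀) (p t₀)
  simp only [← add_sub_assoc] at e3
  rw [e3] at e
  rw [← hres]
  simp only [smul_sub]
  have j0 := hsm (h.integrable t)
  have j1 := hsm (hI1.integrableOn (s := Ioc 0 q))
  have j2 := hsm hI2
  have e4 : ∫ r in Ioc 0 q, χ r • (Ioc 0 q).indicator (p t) r = ∫ r in Ioc 0 q, χ r • p t r :=
    setIntegral_congr_fun measurableSet_Ioc fun r hr => by
      simp only [indicator_of_mem hr]
  have j3 := hsm ((hI0 t).integrableOn (s := Ioc 0 q))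
  have e5 := integral_sub (j3.sub j1) j2
  simp only [Pi.sub_apply] at e5
  rw [e5, integral_sub j3 j1, e4, e]
  abel

/-- The part of the history created after the initial time. -/
theorem near (h : IsTransport q T p y) {Y : ℝ → E}
    (hY : ∀ t ∈ Icc 0 T, Y t = Y 0 + ∫ σ in (0 : ℝ)..t, y σ) {t : ℝ} (ht : t ∈ Icc 0 T) :
    ∀ᵐ s, s ∈ Ioo 0 q → s < t → p t s = Y t - Y (t - s) := by
  rcases ht.1.eq_or_lt with h0 | h0
  · filter_upwards with s hs hst
    linarith [hs.1]
  filter_upwards [h.ae_eq le_rfl h0 ht.2] with s hs hsq hst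
  have h1 := hs hsq
  rw [indicator_of_mem (Ioo_subset_Ioc_self hsq), indicator_of_notMem (fun h => by
    simp only [sub_zero] at h; linarith [h.1]), zero_add] at h1
  have hi : ∀ a b, IntervalIntegrable y volume a b := fun a b =>
    h.cont_source.intervalIntegrable a b
  rw [h1, hY t ht, hY (t - s) ⟨by linarith, by linarith [hsq.1, ht.2]⟩, add_sub_add_left_eq_sub,
    intervalIntegral.integral_interval_sub_left (hi _ _) (hi _ _),
    intervalIntegral.integral_of_le h0.le, intervalIntegral.integral_of_le (by linarith [hsq.1]),
    ← integral_indicator measurableSet_Ioc, ← integral_indicator measurableSet_Ioc]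
  refine integral_congr_ae (ae_of_all _ fun σ => ?_)
  by_cases hσ : σ ∈ Ioc (t - s) t
  · rw [indicator_of_mem hσ, indicator_of_mem (show σ ∈ Ioc 0 t from ⟨by linarith [hσ.1], hσ.2⟩),
      indicator_of_mem (show _ ∈ Ioc 0 q from
        ⟨by linarith [hσ.1], by linarith [hσ.2, hsq.2]⟩)]
  · rw [indicator_of_notMem hσ]
    by_cases hσ' : σ ∈ Ioc 0 t
    · rw [indicator_of_mem hσ', indicator_of_notMem]
      exact fun h => hσ ⟨by linarith [h.1], hσ'.2⟩
    · rw [indicator_of_notMem hσ']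

/-- The part of the history transported from an earlier time. -/
theorem far (h : IsTransport q T p y) {Y : ℝ → E}
    (hY : ∀ t ∈ Icc 0 T, Y t = Y 0 + ∫ σ in (0 : ℝ)..t, y σ) {t₀ t : ℝ} (h0 : 0 ≤ t₀)
    (h1 : t₀ < t) (h2 : t ≤ T) :
    ∀ᵐ s, 0 < s → s + (t - t₀) < q → p t (s + (t - t₀)) = p t₀ s + (Y t - Y t₀) := by
  have h3 := (measurePreserving_add_right volume (t - t₀)).quasiMeasurePreserving.ae
    (h.ae_eq h0 h1 h2)
  filter_upwards [h3] with s hs hs0 hsq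
  have hm : s + (t - t₀) ∈ Ioo 0 q := ⟨by linarith, hsq⟩
  have h4 := hs hm
  rw [indicator_of_mem (Ioo_subset_Ioc_self hm), add_sub_cancel_right,
    indicator_of_mem (show s ∈ Ioc 0 q from ⟨hs0, by linarith⟩)] at h4
  have hi : ∀ a b, IntervalIntegrable y volume a b := fun a b =>
    h.cont_source.intervalIntegrable a b
  rw [h4, hY t ⟨h0.trans h1.le, h2⟩, hY t₀ ⟨h0, h1.le.trans h2⟩, add_sub_add_left_eq_sub,
    intervalIntegral.integral_interval_sub_left (hi _ _) (hi _ _)]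
  congr 1
  refine intervalIntegral.integral_congr fun σ hσ => ?_
  rw [uIcc_of_le h1.le] at hσ
  exact indicator_of_mem (show _ ∈ Ioc 0 q from
    ⟨by linarith [hσ.1], by linarith [hσ.2]⟩) _

end IsTransport
end Transport

end JMGT
end

noncomputable section

namespace JMGT

local notation "⟪" x ", " y "⟫" => inner ℝ x y

variable {n : ℕ}

/-! ### The weighted space of histories -/

/-- The part of the half line on which the memory kernel does not vanish. -/
def kernelSupport (g : ℝ → ℝ) : Set ℝ := {s | 0 < s ∧ 0 < g s}

section MemMeasure

variable {c : ℝ} {g : ℝ → ℝ}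

theorem IsMemoryKernel.isOpen_kernelSupport (hg : IsMemoryKernel c g) :
    IsOpen (kernelSupport g) :=
  hg.continuousOn.isOpen_inter_preimage isOpen_Ioi (isOpen_Ioi (a := (0 : ℝ)))

theorem IsMemoryKernel.aemeasurable_density (hg : IsMemoryKernel c g) :
    AEMeasurable (fun s => ENNReal.ofReal (-deriv g s)) (volume.restrict (Ioi 0)) :=
  (hg.isWeight_deriv.cont.aestronglyMeasurable measurableSet_Ioi).aemeasurable.ennreal_ofReal

theorem IsMemoryKernel.deriv_neg_iff (hg : IsMemoryKernel c g) {s : ℝ} (hs : 0 < s) :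
    0 < -deriv g s ↔ 0 < g s := by
  obtain ⟨ζ, hζ, hd⟩ := hg.decay
  constructor
  · intro h
    refine (hg.nonneg s hs).lt_of_ne fun h0 => ?_
    rw [hg.deriv_eq_zero hs h0.symm] at h
    simp at h
  · intro h
    have := hd s hs
    have := mul_pos hζ h
    linarith

theorem IsMemoryKernel.ae_memMeasure_iff (hg : IsMemoryKernel c g) {P : ℝ → Prop} :
    (∀ᵐ s ∂memMeasure g, P s) ↔ ∀ᵐ s, s ∈ kernelSupport g → P s := by
  rw [memMeasure, ae_withDensity_iff' hg.aemeasurable_density, ae_restrict_iff' measurableSet_Ioi]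
  refine eventually_congr (Eventually.of_forall fun s => ?_)
  simp only [ne_eq, ENNReal.ofReal_eq_zero, not_le, mem_Ioi]
  exact ⟨fun h hs => h hs.1 ((hg.deriv_neg_iff hs.1).2 hs.2),
    fun h hs hd => h ⟨hs, (hg.deriv_neg_iff hs).1 hd⟩⟩

theorem IsMemoryKernel.restrict_absolutelyContinuous (hg : IsMemoryKernel c g) :
    volume.restrict (kernelSupport g) ≪ memMeasure g := by
  rw [← Measure.ae_le_iff_absolutelyContinuous]
  intro P hP
  exact (ae_restrict_iff' hg.isOpen_kernelSupport.measurableSet).2 (hg.ae_memMeasure_iff.1 hP)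

theorem IsMemoryKernel.lintegral_memMeasure (hg : IsMemoryKernel c g) {E : Type*}
    [NormedAddCommGroup E] {a b : ℝ → E}
    (hb : AEStronglyMeasurable b (volume.restrict (Ioi 0)))
    (hab : ∀ᵐ s, s ∈ kernelSupport g → a s = b s) :
    ∫⁻ s, ‖a s‖ₑ ^ 2 ∂memMeasure g
      = ∫⁻ s in Ioi 0, ENNReal.ofReal (-deriv g s * ‖b s‖ ^ 2) := by
  have h1 : ∫⁻ s, ‖a s‖ₑ ^ 2 ∂memMeasure g = ∫⁻ s, ‖b s‖ₑ ^ 2 ∂memMeasure g := by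
    refine lintegral_congr_ae (hg.ae_memMeasure_iff.2 ?_)
    filter_upwards [hab] with s hs hs'
    rw [hs hs']
  rw [h1, memMeasure, lintegral_withDensity_eq_lintegral_mul₀' hg.aemeasurable_density
    ((hb.enorm.pow_const 2).mono_ac (withDensity_absolutelyContinuous _ _))]
  refine setLIntegral_congr_fun measurableSet_Ioi fun s hs => ?_
  simp only [Pi.mul_apply]
  rw [ENNReal.ofReal_mul (hg.isWeight_deriv.nonneg s hs), ENNReal.ofReal_pow (norm_nonneg _),
    ofReal_norm]

theorem IsMemoryKernel.aestronglyMeasurable_weight (hg : IsMemoryKernel c g) {E : Type*}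
    [NormedAddCommGroup E] {b : ℝ → E} (hb : AEStronglyMeasurable b (volume.restrict (Ioi 0))) :
    AEStronglyMeasurable (fun s => -deriv g s * ‖b s‖ ^ 2) (volume.restrict (Ioi 0)) :=
  (hg.isWeight_deriv.cont.aestronglyMeasurable measurableSet_Ioi).mul (hb.norm.pow 2)

theorem IsMemoryKernel.ae_weight_nonneg (hg : IsMemoryKernel c g) {E : Type*}
    [NormedAddCommGroup E] (b : ℝ → E) :
    0 ≤ᵐ[volume.restrict (Ioi 0)] fun s => -deriv g s * ‖b s‖ ^ 2 := by
  filter_upwards [ae_restrict_mem measurableSet_Ioi] with s hs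
  exact mul_nonneg (hg.isWeight_deriv.nonneg s hs) (sq_nonneg _)

end MemMeasure

/-- The history `η`, seen through `A`, where the memory kernel does not vanish. -/
def hist {E : Type*} [Zero E] (g : ℝ → ℝ) (A : (Rn n → ℝ) → E) (η : ℝ → Rn n → ℝ) : ℝ → E :=
  (kernelSupport g).indicator fun s => A (η s)

section Hist

variable {c : ℝ} {g : ℝ → ℝ} {E : Type*} [NormedAddCommGroup E] [InnerProductSpace ℝ E]
  {A : (Rn n → ℝ) → E} {L : Set (E × (Rn n → ℝ))} {η η' : ℝ → Rn n → ℝ}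

theorem MemHistory.ae_gradMemH (hg : IsMemoryKernel c g) (hη : MemHistory g 2 η) :
    ∀ᵐ s, s ∈ kernelSupport g → GradMemH 1 (η s) :=
  hg.ae_memMeasure_iff.1 (hη.2.1.mono fun _ h => h.mono (by norm_num))

theorem aestronglyMeasurable_hist [CompleteSpace E] [TopologicalSpace.SeparableSpace E]
    (hg : IsMemoryKernel c g) (hA : IsWeakOperator A L)
    (hη : MemHistory g 2 η) : AEStronglyMeasurable (hist g A η) (volume.restrict (Ioi 0)) := by
  have hS := hg.isOpen_kernelSupport.measurableSet
  refine (aestronglyMeasurable_indicator_iff hS).2 ?_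
  rw [Measure.restrict_restrict hS, inter_eq_left.2 fun s hs => hs.1]
  refine aestronglyMeasurable_of_inner (A := Prod.fst '' L) ?_ fun a ha =>
    hA.sep a fun p hp => ha _ ⟨p, hp, rfl⟩
  rintro _ ⟨p, hp, rfl⟩
  have h1 : AEStronglyMeasurable (fun z : ℝ × Rn n => η z.1 z.2 * p.2 z.2)
      ((memMeasure g).prod volume) :=
    hη.1.mul ((hA.test p hp).continuous.comp continuous_snd).aestronglyMeasurable
  refine (h1.integral_prod_right'.mono_ac hg.restrict_absolutelyContinuous).congr ?_
  refine (ae_restrict_iff' hS).2 ?_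
  filter_upwards [hη.ae_gradMemH hg] with s hs hs'
  exact (hA.inner_eq _ (hs hs') p hp).symm

theorem lintegral_memMeasure_operator [CompleteSpace E] [TopologicalSpace.SeparableSpace E]
    (hg : IsMemoryKernel c g) (hA : IsWeakOperator A L) (hη : MemHistory g 2 η) :
    ∫⁻ s, ‖A (η s)‖ₑ ^ 2 ∂memMeasure g < ⊤ ∧
    IntegrableOn (fun s => -deriv g s * ‖hist g A η s‖ ^ 2) (Ioi 0) ∧
    ∫⁻ s, ‖A (η s)‖ₑ ^ 2 ∂memMeasure g
      = ENNReal.ofReal (∫ s in Ioi 0, -deriv g s * ‖hist g A η s‖ ^ 2) := by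
  have hm := aestronglyMeasurable_hist hg hA hη
  have h1 := hg.lintegral_memMeasure (a := fun s => A (η s)) hm
    (ae_of_all _ fun s hs => (indicator_of_mem hs fun s => A (η s)).symm)
  obtain ⟨C, hC⟩ := hA.bound
  have h2 : ∫⁻ s, ‖A (η s)‖ₑ ^ 2 ∂memMeasure g < ⊤ := by
    refine lt_of_le_of_lt (lintegral_mono_ae (g := fun s => C * gradNormHSq 2 (η s)) ?_) ?_
    · filter_upwards [hη.2.1] with s hs
      exact (hC _ (hs.mono (by norm_num))).trans
        (mul_le_mul_right (gradNormHSq_mono (by norm_num) _) _)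
    · rw [lintegral_const_mul' _ _ ENNReal.coe_ne_top]
      exact ENNReal.mul_lt_top ENNReal.coe_lt_top hη.2.2
  have h3 : IntegrableOn (fun s => -deriv g s * ‖hist g A η s‖ ^ 2) (Ioi 0) := by
    refine ⟨hg.aestronglyMeasurable_weight hm, ?_⟩
    rw [hasFiniteIntegral_iff_ofReal (hg.ae_weight_nonneg _), ← h1]
    exact h2
  exact ⟨h2, h3, by rw [h1, ofReal_integral_eq_lintegral_ofReal h3 (hg.ae_weight_nonneg _)]⟩

theorem integral_hist_sub [CompleteSpace E] [TopologicalSpace.SeparableSpace E]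
    (hg : IsMemoryKernel c g) (hA : IsWeakOperator A L)
    (hη : MemHistory g 2 η) (hη' : MemHistory g 2 η') :
    ∫ s in Ioi 0, -deriv g s * ‖hist g A η s - hist g A η' s‖ ^ 2
      = (∫⁻ s, ‖A ((η - η') s)‖ₑ ^ 2 ∂memMeasure g).toReal := by
  have hm := (aestronglyMeasurable_hist hg hA hη).sub (aestronglyMeasurable_hist hg hA hη')
  rw [hg.lintegral_memMeasure (a := fun s => A ((η - η') s)) hm ?_,
    ← integral_eq_lintegral_of_nonneg_ae (hg.ae_weight_nonneg _)
      (hg.aestronglyMeasurable_weight hm)]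
  · simp only [Pi.sub_apply]
  · filter_upwards [hη.ae_gradMemH hg, hη'.ae_gradMemH hg] with s h1 h2 hs
    simp only [Pi.sub_apply, hist, indicator_of_mem hs]
    exact hA.sub _ _ (h1 hs) (h2 hs)

theorem inner_integral_hist [CompleteSpace E] (hg : IsMemoryKernel c g) (hA : IsWeakOperator A L)
    (hη : MemHistory g 2 η) {κ : ℝ → ℝ} {S : Set ℝ} (hS : MeasurableSet S) (hS0 : S ⊆ Ioi 0)
    (hκ : ∀ s, 0 < s → κ s ≠ 0 → s ∈ S ∧ 0 < g s)
    (hi : IntegrableOn (fun s => κ s • hist g A η s) S)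
    {p : E × (Rn n → ℝ)} (hp : p ∈ L) :
    ⟪∫ s in S, κ s • hist g A η s, p.1⟫ = ∫ s in Ioi 0, κ s * ∫ x, η s x * p.2 x := by
  have h1 := integral_inner (𝕜 := ℝ) hi p.1
  rw [real_inner_comm, ← h1, ← integral_indicator hS, ← integral_indicator measurableSet_Ioi]
  refine integral_congr_ae ?_
  filter_upwards [hη.ae_gradMemH hg] with s hs
  by_cases h0 : κ s = 0
  · simp only [indicator, h0, zero_mul, zero_smul, inner_zero_right, ite_self]
  by_cases hs0 : 0 < s
  · obtain ⟨hsS, hgs⟩ := hκ s hs0 h0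
    rw [indicator_of_mem hsS, indicator_of_mem (show s ∈ Ioi 0 from hs0), hist,
      indicator_of_mem (show s ∈ kernelSupport g from ⟨hs0, hgs⟩), real_inner_smul_right,
      real_inner_comm, hA.inner_eq _ (hs ⟨hs0, hgs⟩) p hp]
  · rw [indicator_of_notMem (fun h => hs0 (hS0 h)), indicator_of_notMem (show s ∉ Ioi 0 from hs0)]

end Hist

/-! ### The history of a solution -/

namespace IsExtendedSolution

variable {τ b c k T : ℝ} {g : ℝ → ℝ} {Ψ : ℝ → State n} {E : Type*} [NormedAddCommGroup E]
  [InnerProductSpace ℝ E] [CompleteSpace E] [TopologicalSpace.SeparableSpace E]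
  {A : (Rn n → ℝ) → E} {L : Set (E × (Rn n → ℝ))}

theorem memHistory (X : IsExtendedSolution τ b c k g T Ψ) (t : ℝ) : MemHistory g 2 (Ψ t).η :=
  (X.mem_all t).2.2.2

theorem tendsto_hist (X : IsExtendedSolution τ b c k g T Ψ) (hg : IsMemoryKernel c g)
    (hA : IsWeakOperator A L) (t₀ : ℝ) : Tendsto (fun t => ∫ s in Ioi 0,
      -deriv g s * ‖hist g A (Ψ t).η s - hist g A (Ψ t₀).η s‖ ^ 2) (𝓝 t₀) (𝓝 0) := by
  obtain ⟨C, hC⟩ := hA.bound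
  simp only [fun t => integral_hist_sub hg hA (X.memHistory t) (X.memHistory t₀)]
  have h1 : Tendsto (fun t => (C : ℝ≥0∞) * phaseNormSq g 2 ((Ψ t).diff (Ψ t₀))) (𝓝 t₀) (𝓝 0) := by
    simpa using ENNReal.Tendsto.const_mul (X.cont_all t₀) (Or.inr ENNReal.coe_ne_top)
  rw [← ENNReal.toReal_zero]
  refine (ENNReal.tendsto_toReal ENNReal.zero_ne_top).comp
    (tendsto_of_tendsto_of_tendsto_of_le_of_le tendsto_const_nhds h1 (fun _ => zero_le)
      fun t => ?_)
  refine le_trans (lintegral_mono_ae (g := fun s => C * gradNormHSq 2 (((Ψ t).diff (Ψ t₀)).η s))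
    ?_) ?_
  · filter_upwards [(X.memHistory t).2.1, (X.memHistory t₀).2.1] with s h1 h2
    exact (hC _ ((h1.sub h2).mono (by norm_num))).trans
      (mul_le_mul_right (gradNormHSq_mono (by norm_num) _) _)
  · rw [lintegral_const_mul' _ _ ENNReal.coe_ne_top]
    exact mul_le_mul_right le_add_self _

theorem integrable_hist_sub (X : IsExtendedSolution τ b c k g T Ψ) (hg : IsMemoryKernel c g)
    (hA : IsWeakOperator A L) (t t₀ : ℝ) : IntegrableOn (fun s =>
      -deriv g s * ‖hist g A (Ψ t).η s - hist g A (Ψ t₀).η s‖ ^ 2) (Ioi 0) := by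
  have hdm := (aestronglyMeasurable_hist hg hA (X.memHistory t)).sub
    (aestronglyMeasurable_hist hg hA (X.memHistory t₀))
  have i1 := (lintegral_memMeasure_operator hg hA (X.memHistory t)).2.1
  have i2 := (lintegral_memMeasure_operator hg hA (X.memHistory t₀)).2.1
  refine ((i1.const_mul 2).add (i2.const_mul 2)).mono' (hg.aestronglyMeasurable_weight hdm) ?_
  filter_upwards [ae_restrict_mem measurableSet_Ioi] with s hs
  have h3 := hg.isWeight_deriv.nonneg s hs
  rw [Real.norm_of_nonneg (mul_nonneg h3 (sq_nonneg _)), Pi.add_apply]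
  have h4 := parallelogram_law_with_norm ℝ (hist g A (Ψ t).η s) (hist g A (Ψ t₀).η s)
  nlinarith [mul_nonneg h3 (sq_nonneg ‖hist g A (Ψ t).η s + hist g A (Ψ t₀).η s‖)]

theorem isTransport_hist (X : IsExtendedSolution τ b c k g T Ψ) (hg : IsMemoryKernel c g)
    (hA : IsWeakOperator A L) {q : ℝ} (hq : q ∈ kernelSupport g) :
    IsTransport q T (fun t => hist g A (Ψ t).η) fun t => A (Ψ t).v := by
  obtain ⟨ζ, hζ, hd⟩ := hg.decay
  have hδ : 0 < ζ * g q := mul_pos hζ hq.2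
  have hlow : ∀ s ∈ Ioc 0 q, ζ * g q ≤ -deriv g s := fun s hs => by
    have h1 := hd s hs.1
    have h2 := mul_le_mul_of_nonneg_left (hg.antitoneOn hs.1 hq.1 hs.2) hζ.le
    linarith
  have hbound : ∀ s ∈ Ioc 0 q, ∀ e : E, ‖e‖ ≤ (ζ * g q)⁻¹ * (-deriv g s * ‖e‖) := fun s hs e => by
    rw [← div_eq_inv_mul, le_div_iff₀' hδ]
    exact mul_le_mul_of_nonneg_right (hlow s hs) (norm_nonneg _)
  have hm := fun t => aestronglyMeasurable_hist hg hA (X.memHistory t)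
  have hIoc : Ioc 0 q ⊆ Ioi 0 := fun s hs => hs.1
  have hint : ∀ t, IntegrableOn (hist g A (Ψ t).η) (Ioc 0 q) := fun t => by
    have h1 := hg.isWeight_deriv.integrableOn_smul (hm t)
      (lintegral_memMeasure_operator hg hA (X.memHistory t)).2.1
    refine ((h1.mono_set hIoc).norm.const_mul (ζ * g q)⁻¹).mono' ((hm t).mono_set hIoc) ?_
    filter_upwards [ae_restrict_mem measurableSet_Ioc] with s hs
    rw [norm_smul, Real.norm_of_nonneg (hg.isWeight_deriv.nonneg s hs.1)]
    exact hbound s hs _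
  have hcont : ∀ t₀, Tendsto (fun t => ∫ s in Ioc 0 q,
      ‖hist g A (Ψ t).η s - hist g A (Ψ t₀).η s‖) (𝓝 t₀) (𝓝 0) := fun t₀ => by
    have h1 := (((X.tendsto_hist hg hA t₀).const_mul (∫ s in Ioi 0, -deriv g s)).sqrt).const_mul
      (ζ * g q)⁻¹
    rw [mul_zero, Real.sqrt_zero, mul_zero] at h1
    refine squeeze_zero (fun t => integral_nonneg fun s => norm_nonneg _) (fun t => ?_) h1
    set d := fun s => hist g A (Ψ t).η s - hist g A (Ψ t₀).η s with hdd
    have hdm : AEStronglyMeasurable d (volume.restrict (Ioi 0)) := (hm t).sub (hm t₀)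
    have hdi : IntegrableOn (fun s => -deriv g s * ‖d s‖ ^ 2) (Ioi 0) :=
      X.integrable_hist_sub hg hA t t₀
    have hdi' : IntegrableOn (fun s => -deriv g s * ‖‖d s‖‖ ^ 2) (Ioi 0) := by
      simpa only [norm_norm] using hdi
    have h2 := hg.isWeight_deriv.norm_integral_smul_sq_le hdm.norm hdi'
    have h3 := hg.isWeight_deriv.integrableOn_smul hdm.norm hdi'
    simp only [norm_norm, smul_eq_mul] at h2 h3
    have h4 := Real.le_sqrt_of_sq_le h2
    have h5 : ∫ s in Ioc 0 q, ‖d s‖ ≤ (ζ * g q)⁻¹ * ∫ s in Ioi 0, -deriv g s * ‖d s‖ := by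
      rw [← integral_const_mul]
      refine (setIntegral_mono_on ((hint t).sub (hint t₀)).norm
        ((h3.mono_set hIoc).const_mul _) measurableSet_Ioc fun s hs => hbound s hs _).trans ?_
      refine setIntegral_mono_set (h3.const_mul _) ?_ hIoc.eventuallyLE
      filter_upwards [ae_restrict_mem measurableSet_Ioi] with s hs
      exact mul_nonneg (inv_nonneg.2 hδ.le)
        (mul_nonneg (hg.isWeight_deriv.nonneg s hs) (norm_nonneg _))
    refine h5.trans (mul_le_mul_of_nonneg_left ((le_abs_self _).trans ?_) (inv_nonneg.2 hδ.le))
    exact h4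
  refine ⟨hint, hcont, X.continuous_operator_v hA, fun t ht χ hχ hχc hχq => ?_⟩
  have hd : Continuous (deriv χ) := hχ.continuous_deriv (by simp)
  have hdc : HasCompactSupport (deriv χ) := hχc.deriv
  have hsm : ∀ {κ : ℝ → ℝ}, Continuous κ → HasCompactSupport κ → ∀ t,
      IntegrableOn (fun s => κ s • hist g A (Ψ t).η s) (Ioc 0 q) := fun {κ} hκ hκc t => by
    obtain ⟨M, hM⟩ := hκc.exists_bound_of_continuous hκ
    refine ((hint t).norm.const_mul M).mono' (hκ.aestronglyMeasurable.smul (hint t).1)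
      (ae_of_all _ fun s => ?_)
    rw [norm_smul]
    exact mul_le_mul_of_nonneg_right (hM _) (norm_nonneg _)
  have hpos : ∀ s, 0 < s → s ∈ tsupport χ → s ∈ Ioc 0 q ∧ 0 < g s := fun s hs hsχ =>
    ⟨⟨hs, (hχq hsχ).le⟩, hq.2.trans_le (hg.antitoneOn hs hq.1 (hχq hsχ).le)⟩
  have hin : ∀ {κ : ℝ → ℝ}, Continuous κ → HasCompactSupport κ → Function.support κ ⊆ tsupport χ →
      ∀ t, ∀ p ∈ L, ⟪∫ s in Ioc 0 q, κ s • hist g A (Ψ t).η s, p.1⟫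
        = ∫ s in Ioi 0, κ s * ∫ x, (Ψ t).η s x * p.2 x := fun hκ hκc hκs t p hp =>
    inner_integral_hist hg hA (X.memHistory t) measurableSet_Ioc hIoc
      (fun s hs h => hpos s hs (hκs h)) (hsm hκ hκc t) hp
  have hχ1 : ∫ s in Ioc 0 q, χ s = ∫ s in Ioi 0, χ s := by
    refine (setIntegral_eq_of_subset_of_forall_sdiff_eq_zero measurableSet_Ioi hIoc
      fun s hs => ?_).symm
    by_contra h
    exact hs.2 (hpos s hs.1 (subset_tsupport χ h)).1
  have hK : Continuous fun σ => ∫ s in Ioc 0 q, deriv χ s • hist g A (Ψ σ).η s := by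
    have h1 := continuous_integral_shift_smul hd hdc hint hcont 0
    simpa [Function.comp_def] using h1.comp ((continuous_const (y := (0 : ℝ))).prodMk continuous_id)
  refine hA.ext fun p hp => ?_
  have he := X.eq_η t ht p.2 (hA.test p hp) χ hχ hχc fun s hs hs0 => (hpos s hs0 hs).2
  have hc : Continuous fun σ => (∫ s in Ioc 0 q, χ s) • A (Ψ σ).v
      + ∫ s in Ioc 0 q, deriv χ s • hist g A (Ψ σ).η s :=
    (continuous_const.smul (X.continuous_operator_v hA)).add hK
  rw [inner_add_left, hin hχ.continuous hχc (subset_tsupport χ) t p hp,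
    hin hχ.continuous hχc (subset_tsupport χ) 0 p hp, inner_integral_right hc, he]
  congr 1
  refine intervalIntegral.integral_congr fun σ _ => ?_
  rw [inner_add_left, real_inner_smul_left, hχ1,
    hA.inner_eq _ ((X.gradMemH_v σ).mono (by norm_num)) p hp,
    hin hd hdc (support_deriv_subset) σ p hp]

theorem exists_rat_mem_kernelSupport (hg : IsMemoryKernel c g) {s : ℝ} (hs : s ∈ kernelSupport g) :
    ∃ q : ℚ, s < q ∧ (q : ℝ) ∈ kernelSupport g := by
  obtain ⟨l, u, h1, h2⟩ := mem_nhds_iff_exists_Ioo_subset.1 (hg.isOpen_kernelSupport.mem_nhds hs)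
  obtain ⟨q, hq1, hq2⟩ := exists_rat_btwn h1.2
  exact ⟨q, hq1, h2 ⟨h1.1.trans hq1, hq2⟩⟩

theorem isHistory (X : IsExtendedSolution τ b c k g T Ψ) (hg : IsMemoryKernel c g)
    (hA : IsWeakOperator A L) :
    IsHistory g T (fun t => hist g A (Ψ t).η) (fun t => A (Ψ t).ψ) fun t => A (Ψ t).v where
  aesm t := aestronglyMeasurable_hist hg hA (X.memHistory t)
  integrable t := (lintegral_memMeasure_operator hg hA (X.memHistory t)).2.1
  cont := X.tendsto_hist hg hA
  hasDeriv := hasDerivWithinAt_of_eq_add_integral (X.continuous_operator_v hA)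
    (X.operator_ψ_eq hA)
  lip := by
    have hv := X.continuous_operator_v hA
    obtain ⟨M, hM⟩ := isCompact_Icc.exists_bound_of_continuousOn (hv.continuousOn (s := Icc 0 T))
    refine ⟨M, fun t ht s hs => ?_⟩
    rw [X.operator_ψ_eq hA t ht, X.operator_ψ_eq hA s hs, add_sub_add_left_eq_sub,
      intervalIntegral.integral_interval_sub_left (hv.intervalIntegrable _ _)
        (hv.intervalIntegrable _ _)]
    refine intervalIntegral.norm_integral_le_of_norm_le_const fun σ hσ => hM σ ?_
    exact uIcc_subset_Icc hs ht (uIoc_subset_uIcc hσ)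
  near t ht := by
    have h1 : ∀ᵐ s, ∀ q : ℚ, (q : ℝ) ∈ kernelSupport g → s ∈ Ioo (0 : ℝ) q → s < t →
        hist g A (Ψ t).η s = A (Ψ t).ψ - A (Ψ (t - s)).ψ := ae_all_iff.2 fun q => by
      by_cases hq : (q : ℝ) ∈ kernelSupport g
      · filter_upwards [(X.isTransport_hist hg hA hq).near (X.operator_ψ_eq hA) ht] with s hs _
          using hs
      · exact ae_of_all _ fun s h => absurd h hq
    filter_upwards [h1] with s hs h0 hgs hst
    obtain ⟨q, hq1, hq2⟩ := exists_rat_mem_kernelSupport hg (s := s) ⟨h0, hgs⟩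
    exact hs q hq2 ⟨h0, hq1⟩ hst
  far t₀ t h0 h1 h2 := by
    have h3 : ∀ᵐ s, ∀ q : ℚ, (q : ℝ) ∈ kernelSupport g → 0 < s → s + (t - t₀) < q →
        hist g A (Ψ t).η (s + (t - t₀)) = hist g A (Ψ t₀).η s + (A (Ψ t).ψ - A (Ψ t₀).ψ) :=
      ae_all_iff.2 fun q => by
        by_cases hq : (q : ℝ) ∈ kernelSupport g
        · filter_upwards [(X.isTransport_hist hg hA hq).far (X.operator_ψ_eq hA) h0 h1 h2]
            with s hs _ using hs
        · exact ae_of_all _ fun s h => absurd h hq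
    filter_upwards [h3] with s hs hs0 hgs
    obtain ⟨q, hq1, hq2⟩ := exists_rat_mem_kernelSupport hg (s := s + (t - t₀))
      ⟨by linarith, hgs⟩
    exact hs q hq2 hs0 hq1

end IsExtendedSolution

end JMGT
end

noncomputable section

namespace JMGT

local notation "⟪" x ", " y "⟫" => inner ℝ x y

variable {n : ℕ}

/-! ### Solutions as energy trajectories -/

instance : TopologicalSpace.SeparableSpace (L2 n) := by
  have : Fact ((2 : ℝ≥0∞) ≠ ⊤) := ⟨by simp⟩
  infer_instance

instance : TopologicalSpace.SeparableSpace (L2Vec n) := by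
  have : Fact ((2 : ℝ≥0∞) ≠ ⊤) := ⟨by simp⟩
  have : SecondCountableTopology (L2 n) := inferInstance
  have : SecondCountableTopology (L2Vec n) := PiLp.secondCountableTopology 2 _
  infer_instance

/-- The square of the norm of `hist g A η` for the weight `-g'`. -/
abbrev histNormSq {E : Type*} [NormedAddCommGroup E] (g : ℝ → ℝ) (A : (Rn n → ℝ) → E)
    (η : ℝ → Rn n → ℝ) : ℝ := ∫ s in Ioi 0, -deriv g s * ‖hist g A η s‖ ^ 2

/-- The square of the norm of `hist g A η` for the weight `g`. -/
abbrev histKernelNormSq {E : Type*} [NormedAddCommGroup E] (g : ℝ → ℝ) (A : (Rn n → ℝ) → E)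
    (η : ℝ → Rn n → ℝ) : ℝ := ∫ s in Ioi 0, g s * ‖hist g A η s‖ ^ 2

/-- The memory integral of `hist g A η`. -/
abbrev histIntegral {E : Type*} [NormedAddCommGroup E] [NormedSpace ℝ E] (g : ℝ → ℝ)
    (A : (Rn n → ℝ) → E) (η : ℝ → Rn n → ℝ) : E := ∫ s in Ioi 0, g s • hist g A η s

/-- The nonlinear source. -/
def source (k : ℝ) (Φ : State n) (x : Rn n) : ℝ :=
  2 * (k * Φ.v x * Φ.w x + ⟪weakGrad Φ.ψ x, weakGrad Φ.v x⟫)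

namespace IsExtendedSolution

variable {τ b c k T ζ : ℝ} {g : ℝ → ℝ} {Ψ : ℝ → State n}

section Memory

variable {E : Type*} [NormedAddCommGroup E]
  [InnerProductSpace ℝ E] [CompleteSpace E] [TopologicalSpace.SeparableSpace E]
  {A : (Rn n → ℝ) → E} {L : Set (E × (Rn n → ℝ))}

theorem integrable_kernel_hist (X : IsExtendedSolution τ b c k g T Ψ) (hg : IsMemoryKernel c g)
    (hA : IsWeakOperator A L) (t : ℝ) :
    IntegrableOn (fun s => g s * ‖hist g A (Ψ t).η s‖ ^ 2) (Ioi 0) := by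
  obtain ⟨ζ, hζ, hd⟩ := hg.decay
  exact (hg.integrable_weight hζ hd ((X.isHistory hg hA).aesm t)
    ((X.isHistory hg hA).integrable t)).1

theorem tendsto_kernel_hist (X : IsExtendedSolution τ b c k g T Ψ) (hg : IsMemoryKernel c g)
    (hA : IsWeakOperator A L) (t₀ : ℝ) : Tendsto (fun t => ∫ s in Ioi 0,
      g s * ‖hist g A (Ψ t).η s - hist g A (Ψ t₀).η s‖ ^ 2) (𝓝 t₀) (𝓝 0) := by
  obtain ⟨ζ, hζ, hd⟩ := hg.decay
  have h1 := (X.tendsto_hist hg hA t₀).const_mul ζ⁻¹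
  rw [mul_zero] at h1
  refine squeeze_zero (fun t => setIntegral_nonneg measurableSet_Ioi fun s hs =>
    mul_nonneg (hg.nonneg s hs) (sq_nonneg _)) (fun t => ?_) h1
  rw [← div_eq_inv_mul, le_div_iff₀' hζ]
  exact (hg.integrable_weight hζ hd (((X.isHistory hg hA).aesm t).sub
    ((X.isHistory hg hA).aesm t₀)) (X.integrable_hist_sub hg hA t t₀)).2

theorem continuous_histNormSq (X : IsExtendedSolution τ b c k g T Ψ) (hg : IsMemoryKernel c g)
    (hA : IsWeakOperator A L) : Continuous fun t => histNormSq g A (Ψ t).η :=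
  continuous_weighted_norm_sq hg.isWeight_deriv (X.isHistory hg hA).aesm
    (X.isHistory hg hA).integrable (X.isHistory hg hA).cont

theorem continuous_histKernelNormSq (X : IsExtendedSolution τ b c k g T Ψ)
    (hg : IsMemoryKernel c g) (hA : IsWeakOperator A L) :
    Continuous fun t => histKernelNormSq g A (Ψ t).η :=
  continuous_weighted_norm_sq hg.isWeight (X.isHistory hg hA).aesm
    (X.integrable_kernel_hist hg hA) (X.tendsto_kernel_hist hg hA)

theorem continuous_histIntegral (X : IsExtendedSolution τ b c k g T Ψ) (hg : IsMemoryKernel c g)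
    (hA : IsWeakOperator A L) : Continuous fun t => histIntegral g A (Ψ t).η :=
  continuous_weighted_integral hg.isWeight (X.isHistory hg hA).aesm
    (X.integrable_kernel_hist hg hA) (X.tendsto_kernel_hist hg hA)

theorem integrable_smul_hist (X : IsExtendedSolution τ b c k g T Ψ) (hg : IsMemoryKernel c g)
    (hA : IsWeakOperator A L) (t : ℝ) :
    IntegrableOn (fun s => g s • hist g A (Ψ t).η s) (Ioi 0) :=
  hg.isWeight.integrableOn_smul ((X.isHistory hg hA).aesm t) (X.integrable_kernel_hist hg hA t)

end Memory

theorem inner_histIntegral_gradL2 (X : IsExtendedSolution τ b c k g T Ψ) (hg : IsMemoryKernel c g)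
    (t : ℝ) {h : Rn n → ℝ} {j : ℕ} (hh : GradMemH j h) (h0 : MemLp h 2 volume) :
    ⟪histIntegral g gradL2 (Ψ t).η, gradL2 h⟫ = -⟪histIntegral g lapL2 (Ψ t).η, toL2 h⟫ := by
  have h1 := integral_inner (𝕜 := ℝ) (X.integrable_smul_hist hg isWeakOperator_gradL2 t) (gradL2 h)
  have h2 := integral_inner (𝕜 := ℝ) (X.integrable_smul_hist hg isWeakOperator_lapL2 t) (toL2 h)
  rw [real_inner_comm, ← h1, real_inner_comm (toL2 h), ← h2, ← integral_neg]
  refine integral_congr_ae (ae_restrict_of_ae ?_)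
  filter_upwards [(X.memHistory t).ae_gradMemH hg] with s hs
  by_cases hs' : s ∈ kernelSupport g
  · simp only [hist, indicator_of_mem hs', real_inner_smul_right]
    rw [real_inner_comm, inner_gradL2 (hs hs') hh h0, real_inner_comm]
    ring
  · simp only [hist, indicator_of_notMem hs', smul_zero, inner_zero_right, neg_zero]

theorem toL2_w_eq (X : IsExtendedSolution τ b c k g T Ψ) (hg : IsMemoryKernel c g)
    (hτ : 0 < τ) {f : ℝ → L2 n} (hf : Continuous f)
    (hfF : ∀ t ∈ Icc 0 T, ∀ φ, IsTestFunction φ → ∫ x, source k (Ψ t) x * φ x = ⟪f t, toL2 φ⟫) :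
    ∀ t ∈ Icc 0 T, toL2 (Ψ t).w = toL2 (Ψ 0).w + ∫ σ in (0 : ℝ)..t,
      τ⁻¹ • (cgSq c g • lapL2 (Ψ σ).ψ + b • lapL2 (Ψ σ).v + histIntegral g lapL2 (Ψ σ).η + f σ
        - toL2 (Ψ σ).w) := by
  intro t ht
  refine eq_of_inner_test fun φ hφ => ?_
  have hp : (toL2 φ, Δ φ) ∈ lapTests n := ⟨φ, hφ, rfl⟩
  have h1 := X.continuous_operator_ψ isWeakOperator_lapL2
  have h2 := X.continuous_operator_v isWeakOperator_lapL2
  have h3 := X.continuous_histIntegral hg isWeakOperator_lapL2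
  have h4 := X.continuous_toL2_w
  have hc : Continuous fun σ => τ⁻¹ • (cgSq c g • lapL2 (Ψ σ).ψ + b • lapL2 (Ψ σ).v
      + histIntegral g lapL2 (Ψ σ).η + f σ - toL2 (Ψ σ).w) := by fun_prop
  have he := X.eq_w t ht φ hφ
  rw [inner_add_left, inner_integral_right hc, inner_toL2 (X.memLp_w t) (hφ.memLp 2),
    inner_toL2 (X.memLp_w 0) (hφ.memLp 2)]
  have h5 : ∫ σ in (0 : ℝ)..t, ⟪τ⁻¹ • (cgSq c g • lapL2 (Ψ σ).ψ + b • lapL2 (Ψ σ).v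
      + histIntegral g lapL2 (Ψ σ).η + f σ - toL2 (Ψ σ).w), toL2 φ⟫
      = τ⁻¹ * ∫ σ in (0 : ℝ)..t,
        (-(∫ x, (Ψ σ).w x * φ x)
          + cgSq c g * (∫ x, (Ψ σ).ψ x * (Δ φ) x)
          + b * (∫ x, (Ψ σ).v x * (Δ φ) x)
          + (∫ s in Ioi 0, g s * ∫ x, (Ψ σ).η s x * (Δ φ) x)
          + ∫ x, 2 * (k * (Ψ σ).v x * (Ψ σ).w x
              + inner ℝ (weakGrad (Ψ σ).ψ x) (weakGrad (Ψ σ).v x)) * φ x) := by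
    rw [← intervalIntegral.integral_const_mul]
    refine intervalIntegral.integral_congr fun σ hσ => ?_
    rw [uIcc_of_le ht.1] at hσ
    have e1 := hfF σ ⟨hσ.1, hσ.2.trans ht.2⟩ φ hφ
    have e2 := inner_integral_hist hg isWeakOperator_lapL2 (X.memHistory σ) (κ := g)
      measurableSet_Ioi subset_rfl
      (fun s hs h => ⟨hs, (hg.nonneg s hs).lt_of_ne (Ne.symm h)⟩)
      (X.integrable_smul_hist hg isWeakOperator_lapL2 σ) hp
    simp only [source] at e1
    simp only [real_inner_smul_left, inner_add_left, inner_sub_left] at e2 ⊢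
    rw [inner_lapL2_test ((X.gradMemH_ψ σ).mono (by norm_num)) hφ,
      inner_lapL2_test ((X.gradMemH_v σ).mono (by norm_num)) hφ, e2,
      inner_toL2 (X.memLp_w σ) (hφ.memLp 2), e1]
    ring
  rw [h5]
  refine mul_left_cancel₀ hτ.ne' (he.trans ?_)
  rw [mul_add, mul_inv_cancel_left₀ hτ.ne']

theorem isEnergyTrajectory (X : IsExtendedSolution τ b c k g T Ψ) (hg : IsMemoryKernel c g)
    (hτ : 0 < τ) (hζ : 0 < ζ) (hd : ∀ s, 0 < s → deriv g s ≤ -ζ * g s) {f : ℝ → L2 n}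
    (hf : Continuous f)
    (hfF : ∀ t ∈ Icc 0 T, ∀ φ, IsTestFunction φ → ∫ x, source k (Ψ t) x * φ x = ⟪f t, toL2 φ⟫) :
    IsEnergyTrajectory τ (cgSq c g) (b - τ * cgSq c g) (∫ s in Ioi 0, g s) ζ T
      (fun t => gradL2 (Ψ t).ψ + τ • gradL2 (Ψ t).v) (fun t => gradL2 (Ψ t).v)
      (fun t => gradL2 (Ψ t).w) (fun t => histIntegral g gradL2 (Ψ t).η)
      (fun t => lapL2 (Ψ t).ψ + τ • lapL2 (Ψ t).v) (fun t => lapL2 (Ψ t).v)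
      (fun t => lapL2 (Ψ t).w) (fun t => toL2 (Ψ t).v) (fun t => toL2 (Ψ t).w)
      (fun t => histIntegral g lapL2 (Ψ t).η) f
      (fun t => histNormSq g gradL2 (Ψ t).η) (fun t => histNormSq g lapL2 (Ψ t).η)
      (fun t => histKernelNormSq g gradL2 (Ψ t).η) (fun t => histKernelNormSq g lapL2 (Ψ t).η) := by
  have hG := isWeakOperator_gradL2 (n := n)
  have hL := isWeakOperator_lapL2 (n := n)
  have cψ0 := X.continuous_operator_ψ hG
  have cv0 := X.continuous_operator_v hG
  have cw0 := X.continuous_operator_w hG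
  have cψ1 := X.continuous_operator_ψ hL
  have cv1 := X.continuous_operator_v hL
  have cw1 := X.continuous_operator_w hL
  have cv := X.continuous_toL2_v
  have cw := X.continuous_toL2_w
  have cm := X.continuous_histIntegral hg hL
  have dψ0 := hasDerivWithinAt_of_eq_add_integral cv0 (X.operator_ψ_eq hG)
  have dψ1 := hasDerivWithinAt_of_eq_add_integral cv1 (X.operator_ψ_eq hL)
  have dv0 := hasDerivWithinAt_of_eq_add_integral cw0 (X.operator_v_eq hG)
  have dv1 := hasDerivWithinAt_of_eq_add_integral cw1 (X.operator_v_eq hL)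
  have mψ := fun t => (X.gradMemH_ψ t).mono (i := 1) (by norm_num)
  have mv := fun t => (X.gradMemH_v t).mono (i := 1) (by norm_num)
  have mw := X.gradMemH_w
  have gu : ∀ t, gradL2 (Ψ t).ψ + τ • gradL2 (Ψ t).v = gradL2 ((Ψ t).ψ + τ • (Ψ t).v) := fun t =>
    (gradL2_add_smul (mψ t) (mv t) τ).symm
  have gz : ∀ t, gradL2 (Ψ t).v + τ • gradL2 (Ψ t).w = gradL2 ((Ψ t).v + τ • (Ψ t).w) := fun t =>
    (gradL2_add_smul (mv t) (mw t) τ).symm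
  have lu : ∀ t, lapL2 (Ψ t).ψ + τ • lapL2 (Ψ t).v = lapL2 ((Ψ t).ψ + τ • (Ψ t).v) := fun t =>
    (lapL2_add_smul (mψ t) (mv t) τ).symm
  have lz : ∀ t, lapL2 (Ψ t).v + τ • lapL2 (Ψ t).w = lapL2 ((Ψ t).v + τ • (Ψ t).w) := fun t =>
    (lapL2_add_smul (mv t) (mw t) τ).symm
  have zz : ∀ t, toL2 (Ψ t).v + τ • toL2 (Ψ t).w = toL2 ((Ψ t).v + τ • (Ψ t).w) := fun t => by
    rw [toL2_add (X.memLp_v t) ((X.memLp_w t).const_smul τ), toL2_smul (X.memLp_w t)]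
  have mz := fun t => (mv t).add_smul (mw t) τ
  have z2 : ∀ t, MemLp ((Ψ t).v + τ • (Ψ t).w) 2 volume := fun t =>
    (X.memLp_v t).add ((X.memLp_w t).const_smul τ)
  exact
    { cont_gu := by fun_prop
      cont_gv := cv0
      cont_gw := cw0
      cont_m₀ := X.continuous_histIntegral hg hG
      cont_lu := by fun_prop
      cont_lv := cv1
      cont_lw := cw1
      cont_v := cv
      cont_w := cw
      cont_m₁ := cm
      cont_N₀ := X.continuous_histNormSq hg hG
      cont_N₁ := X.continuous_histNormSq hg hL
      cont_P₀ := X.continuous_histKernelNormSq hg hG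
      cont_P₁ := X.continuous_histKernelNormSq hg hL
      deriv_gu := fun t ht => (dψ0 t ht).add ((dv0 t ht).const_smul τ)
      deriv_gv := dv0
      deriv_lu := fun t ht => (dψ1 t ht).add ((dv1 t ht).const_smul τ)
      deriv_lv := dv1
      deriv_v := hasDerivWithinAt_of_eq_add_integral cw X.toL2_v_eq
      deriv_w := fun t ht => by
        refine (hasDerivWithinAt_of_eq_add_integral (by fun_prop) (X.toL2_w_eq hg hτ hf hfF)
          t ht).congr_deriv ?_
        module
      green_u := fun t => by
        rw [gu, gz, lu, zz, inner_gradL2 ((mψ t).add_smul (mv t) τ) (mz t) (z2 t)]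
      green_v := fun t => by rw [gz, zz, inner_gradL2 (mv t) (mz t) (z2 t)]
      green_z := fun s t => by
        rw [gz, gz, lz, zz, real_inner_comm, inner_gradL2 (mz t) (mz s) (z2 s), real_inner_comm]
      green_m := fun t => by
        rw [gz, zz, X.inner_histIntegral_gradL2 hg t (mz t) (z2 t)]
      memory₀ := fun t ht => (X.isHistory hg hG).upperRightDerivLE_memory hg hτ dv0 ht
      memory₁ := fun t ht => (X.isHistory hg hL).upperRightDerivLE_memory hg hτ dv1 ht
      bound_m₀ := fun t => hg.isWeight.norm_integral_smul_sq_le ((X.isHistory hg hG).aesm t)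
        (X.integrable_kernel_hist hg hG t)
      bound_m₁ := fun t => hg.isWeight.norm_integral_smul_sq_le ((X.isHistory hg hL).aesm t)
        (X.integrable_kernel_hist hg hL t)
      bound_P₀ := fun t => (hg.integrable_weight hζ hd ((X.isHistory hg hG).aesm t)
        ((X.isHistory hg hG).integrable t)).2
      bound_P₁ := fun t => (hg.integrable_weight hζ hd ((X.isHistory hg hL).aesm t)
        ((X.isHistory hg hL).integrable t)).2 }

end IsExtendedSolution

/-! ### The energy and the dissipation -/

/-- The energy of a state. -/
def stateEnergy (τ : ℝ) (g : ℝ → ℝ) (Φ : State n) : ℝ :=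
  IsEnergyTrajectory.energy (gradL2 Φ.ψ + τ • gradL2 Φ.v) (gradL2 Φ.v)
    (gradL2 Φ.v + τ • gradL2 Φ.w) (toL2 Φ.v + τ • toL2 Φ.w) (lapL2 Φ.ψ + τ • lapL2 Φ.v)
    (lapL2 Φ.v) (toL2 Φ.w) (histNormSq g gradL2 Φ.η) (histNormSq g lapL2 Φ.η)

/-- The dissipation of a state. -/
def stateDissipation (τ : ℝ) (g : ℝ → ℝ) (Φ : State n) : ℝ :=
  IsEnergyTrajectory.dissipation (gradL2 Φ.v)
    (gradL2 Φ.v + τ • gradL2 Φ.w) (lapL2 Φ.ψ + τ • lapL2 Φ.v)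
    (lapL2 Φ.v) (toL2 Φ.w) (histNormSq g gradL2 Φ.η) (histNormSq g lapL2 Φ.η)

theorem enorm_sq_eq_ofReal {E : Type*} [NormedAddCommGroup E] (a : E) :
    ‖a‖ₑ ^ 2 = ENNReal.ofReal (‖a‖ ^ 2) := by
  rw [ENNReal.ofReal_pow (norm_nonneg _), ofReal_norm]

section Densities

variable {c τ : ℝ} {g : ℝ → ℝ} {Φ : State n} {η : ℝ → Rn n → ℝ}

theorem histNormSq_nonneg (hg : IsMemoryKernel c g) {E : Type*}
    [NormedAddCommGroup E] (A : (Rn n → ℝ) → E) (η : ℝ → Rn n → ℝ) : 0 ≤ histNormSq g A η :=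
  integral_nonneg_of_ae (hg.ae_weight_nonneg _)

theorem MemHistory.lintegral_weakGrad (hg : IsMemoryKernel c g) (hη : MemHistory g 2 η) :
    ∫⁻ s, l2Sq (weakGrad (η s)) ∂memMeasure g = ENNReal.ofReal (histNormSq g gradL2 η) := by
  rw [← (lintegral_memMeasure_operator hg isWeakOperator_gradL2 hη).2.2]
  exact lintegral_congr_ae (hη.2.1.mono fun s hs => l2Sq_weakGrad hs)

theorem MemHistory.lintegral_weakLaplacian (hg : IsMemoryKernel c g) (hη : MemHistory g 2 η) :
    ∫⁻ s, l2Sq (weakLaplacian (η s)) ∂memMeasure g = ENNReal.ofReal (histNormSq g lapL2 η) := by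
  rw [← (lintegral_memMeasure_operator hg isWeakOperator_lapL2 hη).2.2]
  exact lintegral_congr_ae (hη.2.1.mono fun s hs => l2Sq_weakLaplacian (hs.mono (by norm_num)))

theorem l2Sq_eq_toL2 {f : Rn n → ℝ} (hf : MemLp f 2 volume) : l2Sq f = ‖toL2 f‖ₑ ^ 2 := by
  rw [enorm_toL2 hf, l2Sq]

theorem stateEnergy_nonneg (hg : IsMemoryKernel c g) : 0 ≤ stateEnergy τ g Φ := by
  have h1 := histNormSq_nonneg hg gradL2 Φ.η
  have h2 := histNormSq_nonneg hg lapL2 Φ.η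
  simp only [stateEnergy, IsEnergyTrajectory.energy]
  positivity

theorem stateDissipation_nonneg (hg : IsMemoryKernel c g) : 0 ≤ stateDissipation τ g Φ := by
  have h1 := histNormSq_nonneg hg gradL2 Φ.η
  have h2 := histNormSq_nonneg hg lapL2 Φ.η
  simp only [stateDissipation, IsEnergyTrajectory.dissipation]
  positivity

theorem MemPhase.energyDensity_eq (hg : IsMemoryKernel c g) (hΦ : MemPhase g 2 Φ) :
    energyDensity τ g Φ = ENNReal.ofReal (stateEnergy τ g Φ) := by
  have h1 := histNormSq_nonneg hg gradL2 Φ.η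
  have h2 := histNormSq_nonneg hg lapL2 Φ.η
  have mψ : GradMemH 1 Φ.ψ := hΦ.1.mono (by norm_num)
  have mv : GradMemH 1 Φ.v := GradMemH.mono (j := 2) (by norm_num) hΦ.2.1.2
  have mw : GradMemH 1 Φ.w := hΦ.2.2.1.2
  have kv : MemLp Φ.v 2 volume := hΦ.2.1.1
  have kw : MemLp Φ.w 2 volume := hΦ.2.2.1.1
  rw [energyDensity, hΦ.2.2.2.lintegral_weakGrad hg, hΦ.2.2.2.lintegral_weakLaplacian hg,
    l2Sq_weakGrad (mψ.add_smul mv τ), l2Sq_eq_toL2 (kv.add (kw.const_smul τ)), l2Sq_weakGrad mv,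
    l2Sq_eq_toL2 kw, l2Sq_weakLaplacian (mψ.add_smul mv τ), l2Sq_weakGrad (mv.add_smul mw τ),
    l2Sq_weakLaplacian mv, gradL2_add_smul mψ mv, lapL2_add_smul mψ mv, gradL2_add_smul mv mw,
    toL2_add kv (kw.const_smul τ), toL2_smul kw, stateEnergy, IsEnergyTrajectory.energy]
  simp only [enorm_sq_eq_ofReal]
  repeat rw [ENNReal.ofReal_add (by positivity) (by positivity)]

theorem MemPhase.dissipationDensity_eq (hg : IsMemoryKernel c g) (hΦ : MemPhase g 2 Φ) :
    dissipationDensity τ g Φ = ENNReal.ofReal (stateDissipation τ g Φ) := by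
  have h1 := histNormSq_nonneg hg gradL2 Φ.η
  have h2 := histNormSq_nonneg hg lapL2 Φ.η
  have mψ : GradMemH 1 Φ.ψ := hΦ.1.mono (by norm_num)
  have mv : GradMemH 1 Φ.v := GradMemH.mono (j := 2) (by norm_num) hΦ.2.1.2
  have mw : GradMemH 1 Φ.w := hΦ.2.2.1.2
  have kw : MemLp Φ.w 2 volume := hΦ.2.2.1.1
  rw [dissipationDensity, hΦ.2.2.2.lintegral_weakGrad hg, hΦ.2.2.2.lintegral_weakLaplacian hg,
    l2Sq_weakGrad mv,
    l2Sq_eq_toL2 kw, l2Sq_weakLaplacian (mψ.add_smul mv τ), l2Sq_weakGrad (mv.add_smul mw τ),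
    l2Sq_weakLaplacian mv, lapL2_add_smul mψ mv, gradL2_add_smul mv mw,
    stateDissipation, IsEnergyTrajectory.dissipation]
  simp only [enorm_sq_eq_ofReal]
  repeat rw [ENNReal.ofReal_add (by positivity) (by positivity)]

end Densities

namespace IsExtendedSolution

variable {τ b c k T ζ : ℝ} {g : ℝ → ℝ} {Ψ : ℝ → State n}

theorem continuous_stateDissipation (X : IsExtendedSolution τ b c k g T Ψ)
    (hg : IsMemoryKernel c g) : Continuous fun t => stateDissipation τ g (Ψ t) := by
  have hG := isWeakOperator_gradL2 (n := n)
  have hL := isWeakOperator_lapL2 (n := n)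
  have cv0 := X.continuous_operator_v hG
  have cw0 := X.continuous_operator_w hG
  have cψ1 := X.continuous_operator_ψ hL
  have cv1 := X.continuous_operator_v hL
  have cw := X.continuous_toL2_w
  have cN₀ := X.continuous_histNormSq hg hG
  have cN₁ := X.continuous_histNormSq hg hL
  simp only [stateDissipation, IsEnergyTrajectory.dissipation]
  fun_prop

theorem dissipationSq_eq (X : IsExtendedSolution τ b c k g T Ψ) (hg : IsMemoryKernel c g) {t : ℝ}
    (ht : 0 ≤ t) : dissipationSq τ g Ψ t
      = ENNReal.ofReal (∫ σ in (0 : ℝ)..t, stateDissipation τ g (Ψ σ)) := by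
  have hc := X.continuous_stateDissipation hg
  rw [dissipationSq, intervalIntegral.integral_of_le ht, ← integral_Icc_eq_integral_Ioc,
    ofReal_integral_eq_lintegral_ofReal (hc.integrableOn_Icc)
      (ae_of_all _ fun σ => stateDissipation_nonneg hg)]
  exact lintegral_congr fun σ => (X.mem_all σ).dissipationDensity_eq hg

end IsExtendedSolution

end JMGT
end

noncomputable section

namespace JMGT

local notation "⟪" x ", " y "⟫" => inner ℝ x y

variable {n : ℕ}

/-! ### Bounds in `L²` -/

/-- `f` is square integrable with norm at most `B`. -/
def L2Le (f : Rn n → ℝ) (B : ℝ) : Prop := MemLp f 2 volume ∧ ‖toL2 f‖ ≤ B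

namespace L2Le

variable {f h a : Rn n → ℝ} {B B' Λ : ℝ}

theorem nonneg (hf : L2Le f B) : 0 ≤ B := (norm_nonneg _).trans hf.2

theorem mono (hf : L2Le f B) (hB : B ≤ B') : L2Le f B' := ⟨hf.1, hf.2.trans hB⟩

theorem congr (hf : L2Le f B) (hfh : f =ᵐ[volume] h) : L2Le h B :=
  ⟨hf.1.ae_eq hfh, toL2_congr hf.1 hfh ▸ hf.2⟩

theorem add (hf : L2Le f B) (hh : L2Le h B') : L2Le (f + h) (B + B') :=
  ⟨hf.1.add hh.1, by
    rw [toL2_add hf.1 hh.1]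
    exact (norm_add_le _ _).trans (add_le_add hf.2 hh.2)⟩

theorem smul (hf : L2Le f B) (r : ℝ) : L2Le (r • f) (|r| * B) :=
  ⟨hf.1.const_smul r, by
    rw [toL2_smul hf.1, norm_smul]
    exact mul_le_mul_of_nonneg_left hf.2 (norm_nonneg _)⟩

theorem sum {ι : Type*} {s : Finset ι} {f : ι → Rn n → ℝ} {B : ι → ℝ}
    (hf : ∀ i ∈ s, L2Le (f i) (B i)) : L2Le (∑ i ∈ s, f i) (∑ i ∈ s, B i) := by
  classical
  induction s using Finset.induction_on with
  | empty =>
    refine ⟨by simp, ?_⟩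
    rw [Finset.sum_empty, toL2_of_memLp MemLp.zero, MemLp.toLp_zero]
    simp
  | insert a s ha ih =>
    rw [Finset.sum_insert ha, Finset.sum_insert ha]
    exact (hf a (Finset.mem_insert_self a s)).add (ih fun i hi => hf i (Finset.mem_insert_of_mem hi))

theorem eLpNorm_le (hf : L2Le f B) : eLpNorm f 2 volume ≤ ENNReal.ofReal B := by
  rw [← enorm_toL2 hf.1, ← ofReal_norm]
  exact ENNReal.ofReal_le_ofReal hf.2

theorem of_eLpNorm_le (hf : AEStronglyMeasurable f volume) (hB : 0 ≤ B)
    (h : eLpNorm f 2 volume ≤ ENNReal.ofReal B) : L2Le f B := by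
  have h1 : MemLp f 2 volume := ⟨hf, h.trans_lt ENNReal.ofReal_lt_top⟩
  refine ⟨h1, ?_⟩
  rw [← enorm_toL2 h1, ← ofReal_norm] at h
  exact (ENNReal.ofReal_le_ofReal_iff hB).1 h

theorem mul_left (hf : L2Le f B) (ha : AEStronglyMeasurable a volume) (hΛ : 0 ≤ Λ)
    (h : eLpNorm a ⊤ volume ≤ ENNReal.ofReal Λ) : L2Le (a * f) (Λ * B) := by
  refine of_eLpNorm_le (ha.mul hf.1.1) (mul_nonneg hΛ hf.nonneg) ?_
  have h1 := eLpNorm_smul_le_eLpNorm_top_mul_eLpNorm 2 hf.1.1 a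
  rw [ENNReal.ofReal_mul hΛ]
  exact h1.trans (mul_le_mul' h hf.eLpNorm_le)

end L2Le

theorem toL2_sum {ι : Type*} {s : Finset ι} {f : ι → Rn n → ℝ}
    (hf : ∀ i ∈ s, MemLp (f i) 2 volume) : toL2 (∑ i ∈ s, f i) = ∑ i ∈ s, toL2 (f i) := by
  classical
  induction s using Finset.induction_on with
  | empty =>
    rw [Finset.sum_empty, Finset.sum_empty, toL2_of_memLp MemLp.zero, MemLp.toLp_zero]
  | insert a s ha ih =>
    have h1 := fun i hi => hf i (Finset.mem_insert_of_mem hi)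
    rw [Finset.sum_insert ha, Finset.sum_insert ha, toL2_add (hf a (Finset.mem_insert_self a s))
      (memLp_finsetSum' s h1), ih h1]

theorem IsWeakPartial.sum {ι : Type*} {s : Finset ι} {f f' : ι → Rn n → ℝ} {i : Fin n}
    (hf : ∀ l ∈ s, IsWeakPartial i (f l) (f' l)) :
    IsWeakPartial i (∑ l ∈ s, f l) (∑ l ∈ s, f' l) := by
  classical
  induction s using Finset.induction_on with
  | empty =>
    exact ⟨(integrable_zero _ _ _).locallyIntegrable, (integrable_zero _ _ _).locallyIntegrable,
      fun φ _ => by simp⟩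
  | insert a s ha ih =>
    rw [Finset.sum_insert ha, Finset.sum_insert ha]
    exact (hf a (Finset.mem_insert_self a s)).add (ih fun i hi => hf i (Finset.mem_insert_of_mem hi))

/-! ### Norms of real order -/

theorem eLpNorm_two_le_normHs {s : ℝ} (hs : 0 ≤ s) {f : Rn n → ℝ} (hf : MemLp f 2 volume) :
    eLpNorm f 2 volume ≤ normHs s f := by
  have hc : MemLp (fun x => (f x : ℂ)) 2 (volume : Measure (Rn n)) := hf.ofReal
  have h1 : eLpNorm f 2 volume = ‖hc.toLp (fun x => (f x : ℂ))‖ₑ := by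
    rw [Lp.enorm_toLp]
    exact eLpNorm_congr_norm_ae (ae_of_all _ fun x => by simp)
  have h2 : ‖hc.toLp (fun x => (f x : ℂ))‖ₑ
      = ‖(𝓕 (hc.toLp (fun x => (f x : ℂ))) : Lp ℂ 2 (volume : Measure (Rn n)))‖ₑ := by
    rw [← ofReal_norm, ← ofReal_norm, Lp.norm_fourier_eq]
  rw [h1, h2, Lp.enorm_def, eLpNorm_two_eq, normHs, normHsSq, dif_pos hc]
  refine ENNReal.rpow_le_rpow (lintegral_mono fun ξ => ?_) (by norm_num)
  refine le_mul_of_one_le_left zero_le ?_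
  rw [← ENNReal.ofReal_one]
  exact ENNReal.ofReal_le_ofReal (Real.one_le_rpow (by nlinarith [sq_nonneg (2 * Real.pi * ‖ξ‖)]) hs)

theorem eLpNorm_weakPartial_le_gradNormHs {s : ℝ} (hs : 0 ≤ s) {f : Rn n → ℝ} (i : Fin n)
    (hf : MemLp (weakPartial i f) 2 volume) :
    eLpNorm (weakPartial i f) 2 volume ≤ gradNormHs s f := by
  refine (eLpNorm_two_le_normHs hs hf).trans ?_
  exact ENNReal.rpow_le_rpow (Finset.single_le_sum (f := fun i => normHsSq s (weakPartial i f))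
    (fun _ _ => zero_le) (Finset.mem_univ i)) (by norm_num)

theorem eLpNorm_weakPartial_top_le (f : Rn n → ℝ) (i : Fin n) :
    eLpNorm (weakPartial i f) ⊤ volume ≤ eLpNorm (weakGrad f) ⊤ volume :=
  eLpNorm_mono fun x => PiLp.norm_apply_le (weakGrad f x) i

theorem eLpNorm_natCast_le (hn : 2 ≤ n) {f : Rn n → ℝ} {M : ℝ≥0∞}
    (hf : AEStronglyMeasurable f volume)
    (h2 : eLpNorm f 2 volume ≤ M) (h : eLpNorm f ⊤ volume ≤ M) :
    eLpNorm f (n : ℝ≥0∞) volume ≤ M := by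
  have hn0 : n ≠ 0 := by omega
  have h3 : ∫⁻ x, ‖f x‖ₑ ^ 2 ≤ M ^ 2 := by
    rw [eLpNorm_two_eq] at h2
    have := pow_le_pow_left' h2 2
    rw [← ENNReal.rpow_natCast, ← ENNReal.rpow_mul] at this
    norm_num at this
    exact this
  rw [eLpNorm_eq_lintegral_rpow_enorm_toReal (by simpa using hn0) (by simp)]
  simp only [ENNReal.toReal_natCast, ENNReal.rpow_natCast]
  have h4 : ∫⁻ x, ‖f x‖ₑ ^ n ≤ M ^ n := by
    calc ∫⁻ x, ‖f x‖ₑ ^ n ≤ ∫⁻ x, M ^ (n - 2) * ‖f x‖ₑ ^ 2 := by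
          refine lintegral_mono_ae ?_
          filter_upwards [enorm_ae_le_eLpNormEssSup f volume] with x hx
          rw [← Nat.sub_add_cancel hn, pow_add, Nat.add_sub_cancel]
          refine mul_le_mul_left (pow_le_pow_left' (hx.trans ?_) _) _
          rwa [eLpNorm_exponent_top] at h
      _ = M ^ (n - 2) * ∫⁻ x, ‖f x‖ₑ ^ 2 := lintegral_const_mul'' _ (hf.enorm.pow_const 2)
      _ ≤ M ^ (n - 2) * M ^ 2 := mul_le_mul_right h3 _
      _ = M ^ n := by rw [← pow_add, Nat.sub_add_cancel hn]
  refine (ENNReal.rpow_le_rpow h4 (by positivity)).trans (le_of_eq ?_)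
  rw [← ENNReal.rpow_natCast, ← ENNReal.rpow_mul, mul_one_div_cancel (by exact_mod_cast hn0),
    ENNReal.rpow_one]

theorem holderTriple_sobolev (hn : 3 ≤ n) :
    ENNReal.HolderTriple (n : ℝ≥0∞) ((2 * n / (n - 2) : ℝ≥0) : ℝ≥0∞) 2 := by
  have h1 : (2 : ℝ≥0) ≤ n := by exact_mod_cast (by omega : 2 ≤ n)
  have h2 : (n : ℝ≥0)⁻¹ + (2 * n / (n - 2) : ℝ≥0)⁻¹ = 2⁻¹ := by
    rw [← NNReal.coe_inj]
    have : (3 : ℝ) ≤ n := by exact_mod_cast hn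
    push_cast [NNReal.coe_sub h1]
    have h3 : (n : ℝ) - 2 ≠ 0 := by linarith
    field_simp
    ring
  have h4 : (2 * n / (n - 2) : ℝ≥0) ≠ 0 := by
    have : (0 : ℝ≥0) < n - 2 := tsub_pos_of_lt (by exact_mod_cast (by omega : 2 < n))
    have : (0 : ℝ≥0) < n := by exact_mod_cast (by omega : 0 < n)
    positivity
  constructor
  have h5 : (n : ℝ≥0) ≠ 0 := by exact_mod_cast (by omega : n ≠ 0)
  have h6 := congrArg (fun r : ℝ≥0 => (r : ℝ≥0∞)) h2
  simp only [ENNReal.coe_add, ENNReal.coe_inv h4, ENNReal.coe_inv h5,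
    ENNReal.coe_inv (two_ne_zero' ℝ≥0)] at h6
  simpa using h6

/-! ### The nonlinear source -/

/-- Pointwise and integral bounds for a state. -/
structure IsBoundedState (Λ : ℝ) (Φ : State n) : Prop where
  nonneg : 0 ≤ Λ
  v_top : eLpNorm Φ.v ⊤ volume ≤ ENNReal.ofReal Λ
  w_top : eLpNorm Φ.w ⊤ volume ≤ ENNReal.ofReal Λ
  v_two : eLpNorm Φ.v 2 volume ≤ ENNReal.ofReal Λ
  grad_v_top : ∀ i, eLpNorm (weakPartial i Φ.v) ⊤ volume ≤ ENNReal.ofReal Λ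
  grad_ψ_top : ∀ i, eLpNorm (weakPartial i Φ.ψ) ⊤ volume ≤ ENNReal.ofReal Λ
  grad_ψ_two : ∀ i, eLpNorm (weakPartial i Φ.ψ) 2 volume ≤ ENNReal.ofReal Λ

theorem source_eq (k : ℝ) (Φ : State n) :
    source k Φ = (2 * k) • (Φ.v * Φ.w) + (2 : ℝ) • ∑ i, weakPartial i Φ.ψ * weakPartial i Φ.v := by
  ext x
  have h1 : ⟪weakGrad Φ.ψ x, weakGrad Φ.v x⟫
      = ∑ i, weakPartial i Φ.ψ x * weakPartial i Φ.v x := by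
    rw [PiLp.inner_apply]
    exact Finset.sum_congr rfl fun i _ => by simp [weakGrad, mul_comm]
  simp only [source, h1, Pi.add_apply, Pi.smul_apply, Pi.mul_apply, Finset.sum_apply, smul_eq_mul]
  ring

theorem norm_toL2_weakPartial_le (f : Rn n → ℝ) (i : Fin n) :
    ‖toL2 (weakPartial i f)‖ ≤ ‖gradL2 f‖ := PiLp.norm_apply_le (gradL2 f) i

section Source

variable {Λ d τ : ℝ} {Φ : State n}

theorem L2Le_weakPartial {j : ℕ} {f : Rn n → ℝ} (hf : GradMemH j f) (hd : ‖gradL2 f‖ ≤ d)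
    (i : Fin n) : L2Le (weakPartial i f) d :=
  ⟨hf.memLp i, (norm_toL2_weakPartial_le f i).trans hd⟩

theorem L2Le_hess {f : Rn n → ℝ} (hf : GradMemH 2 f) (hd : ‖lapL2 f‖ ≤ d) (i l : Fin n) :
    L2Le (weakPartial l (weakPartial i f)) d := by
  have h1 : GradMemH 1 f := hf.mono (by norm_num)
  refine ⟨(h1.grad i).memLp l, (abs_le_of_sq_le_sq' ?_ (norm_nonneg _)).2.trans hd⟩
  rw [← sum_norm_hess_sq hf]
  refine le_trans ?_ (Finset.single_le_sum (f := fun i => ∑ l,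
    ‖toL2 (weakPartial l (weakPartial i f))‖ ^ 2)
    (fun _ _ => Finset.sum_nonneg fun _ _ => sq_nonneg _) (Finset.mem_univ i))
  exact Finset.single_le_sum (f := fun l => ‖toL2 (weakPartial l (weakPartial i f))‖ ^ 2)
    (fun _ _ => sq_nonneg _) (Finset.mem_univ l)

theorem L2Le_source {g : ℝ → ℝ} (hΦ : MemPhase g 2 Φ) (hb : IsBoundedState Λ Φ)
    (hv : ‖gradL2 Φ.v‖ ≤ d) (hw : ‖toL2 Φ.w‖ ≤ d) (k : ℝ) :
    L2Le (source k Φ) ((2 * |k| + 2 * n) * (Λ * d)) := by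
  have mv : GradMemH 2 Φ.v := hΦ.2.1.2
  have h1 : L2Le Φ.w d := ⟨hΦ.2.2.1.1, hw⟩
  have h2 := (h1.mul_left hΦ.2.1.1.1 hb.nonneg hb.v_top).smul (2 * k)
  have h3 := (L2Le.sum (s := Finset.univ) fun i _ => (L2Le_weakPartial mv hv i).mul_left
    (hΦ.1.memLp i).1 hb.nonneg (hb.grad_ψ_top i)).smul 2
  rw [source_eq]
  refine (h2.add h3).mono (le_of_eq ?_)
  simp only [Finset.sum_const, Finset.card_univ, Fintype.card_fin, nsmul_eq_mul, abs_mul, abs_two]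
  ring

/-- The weak partial derivative of a product of bounded functions. -/
theorem product_rule_bound {a h : Rn n → ℝ} {A H : Fin n → Rn n → ℝ} (ha : HasL2Grad a A)
    (hh : HasL2Grad h H) (hΛ : 0 ≤ Λ) (h1 : eLpNorm a ⊤ volume ≤ ENNReal.ofReal Λ)
    (h2 : eLpNorm h ⊤ volume ≤ ENNReal.ofReal Λ) (i : Fin n) {B₁ B₂ : ℝ} (hA : ‖toL2 (A i)‖ ≤ B₁)
    (hH : ‖toL2 (H i)‖ ≤ B₂) :
    IsWeakPartial i (a * h) (h * A i + a * H i) ∧ L2Le (h * A i + a * H i) (Λ * B₁ + Λ * B₂) := by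
  refine ⟨?_, ?_⟩
  · refine (HasL2Grad.isWeakPartial_mul ha hh i).congr_right (ae_of_all _ fun x => ?_)
    simp only [Pi.add_apply, Pi.mul_apply]
    ring
  · exact (L2Le.mul_left ⟨ha.grad_memLp i, hA⟩ hh.memLp.1 hΛ h2).add
      (L2Le.mul_left ⟨hh.grad_memLp i, hH⟩ ha.memLp.1 hΛ h1)

theorem grad_source {g : ℝ → ℝ} (hΦ : MemPhase g 2 Φ) (hb : IsBoundedState Λ Φ)
    (hv : ‖gradL2 Φ.v‖ ≤ d) (hw : ‖gradL2 Φ.w‖ ≤ d) (hlψ : ‖lapL2 Φ.ψ‖ ≤ d)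
    (hlv : ‖lapL2 Φ.v‖ ≤ d) (k : ℝ) (i : Fin n) :
    ∃ F, IsWeakPartial i (source k Φ) F ∧ L2Le F ((4 * |k| + 4 * n) * (Λ * d)) := by
  have mψ : GradMemH 2 Φ.ψ := hΦ.1
  have mψ1 : GradMemH 1 Φ.ψ := mψ.mono (by norm_num)
  have mv : GradMemH 2 Φ.v := hΦ.2.1.2
  have mv1 : GradMemH 1 Φ.v := mv.mono (by norm_num)
  have mw : GradMemH 1 Φ.w := hΦ.2.2.1.2
  obtain ⟨w1, l1⟩ := product_rule_bound (mv.hasL2Grad hΦ.2.1.1) (mw.hasL2Grad hΦ.2.2.1.1)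
    hb.nonneg hb.v_top hb.w_top i (L2Le_weakPartial mv hv i).2 (L2Le_weakPartial mw hw i).2
  have h2 := fun l => product_rule_bound ((mψ1.grad l).hasL2Grad (mψ1.memLp l))
    ((mv1.grad l).hasL2Grad (mv1.memLp l)) hb.nonneg (hb.grad_ψ_top l) (hb.grad_v_top l) i
    (L2Le_hess mψ hlψ l i).2 (L2Le_hess mv hlv l i).2
  rw [source_eq]
  refine ⟨_, (w1.smul (2 * k)).add ((IsWeakPartial.sum (s := Finset.univ)
    fun l _ => (h2 l).1).smul 2), ?_⟩
  refine ((l1.smul (2 * k)).add ((L2Le.sum (s := Finset.univ) fun l _ => (h2 l).2).smul 2)).mono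
    (le_of_eq ?_)
  simp only [Finset.sum_const, Finset.card_univ, Fintype.card_fin, nsmul_eq_mul, abs_mul, abs_two]
  ring

theorem abs_inner_source_v_le (hn : 3 ≤ n) {C : ℝ≥0}
    (hC : ∀ (f : Rn n → ℝ) (F : Fin n → Rn n → ℝ), HasL2Grad f F →
      eLpNorm f ((2 * n / (n - 2) : ℝ≥0) : ℝ≥0∞) volume ≤ C * ∑ i, eLpNorm (F i) 2 volume)
    {g : ℝ → ℝ} (hΦ : MemPhase g 2 Φ) (hb : IsBoundedState Λ Φ)
    (hv : ‖gradL2 Φ.v‖ ≤ d) (hw : ‖toL2 Φ.w‖ ≤ d) (k : ℝ) :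
    |⟪toL2 (source k Φ), toL2 Φ.v⟫| ≤ (2 * |k| + 2 * n) * (C * n) * (Λ * d ^ 2) := by
  have mv : GradMemH 2 Φ.v := hΦ.2.1.2
  have kv : MemLp Φ.v 2 volume := hΦ.2.1.1
  have kw : MemLp Φ.w 2 volume := hΦ.2.2.1.1
  have hd : 0 ≤ d := (norm_nonneg _).trans hw
  have hq : eLpNorm Φ.v ((2 * n / (n - 2) : ℝ≥0) : ℝ≥0∞) volume
      ≤ ENNReal.ofReal (C * (n * d)) := by
    refine (hC _ _ (mv.hasL2Grad kv)).trans ?_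
    rw [ENNReal.ofReal_mul C.coe_nonneg, ENNReal.ofReal_coe_nnreal]
    refine mul_le_mul_right ((Finset.sum_le_sum fun i _ =>
      (L2Le_weakPartial mv hv i).eLpNorm_le).trans (le_of_eq ?_)) _
    simp [ENNReal.ofReal_mul]
  have hprod : ∀ a : Rn n → ℝ, AEStronglyMeasurable a volume →
      eLpNorm a 2 volume ≤ ENNReal.ofReal Λ → eLpNorm a ⊤ volume ≤ ENNReal.ofReal Λ →
      L2Le (a * Φ.v) (Λ * (C * (n * d))) := fun a ha h2 ht => by
    have := holderTriple_sobolev hn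
    refine L2Le.of_eLpNorm_le (ha.mul kv.1) (mul_nonneg hb.nonneg (by positivity)) ?_
    rw [ENNReal.ofReal_mul hb.nonneg]
    exact (eLpNorm_smul_le_mul_eLpNorm (p := n) (q := ((2 * n / (n - 2) : ℝ≥0) : ℝ≥0∞)) kv.1
      ha).trans (mul_le_mul' (eLpNorm_natCast_le (by omega) ha h2 ht) hq)
  have hin : ∀ a h : Rn n → ℝ, AEStronglyMeasurable a volume → MemLp h 2 volume →
      ‖toL2 h‖ ≤ d → eLpNorm a 2 volume ≤ ENNReal.ofReal Λ →
      eLpNorm a ⊤ volume ≤ ENNReal.ofReal Λ →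
      |⟪toL2 (a * h), toL2 Φ.v⟫| ≤ Λ * (C * (n * d)) * d := fun a h ha hh hhd h2 ht => by
    have hah := (L2Le.mul_left ⟨hh, hhd⟩ ha hb.nonneg ht).1
    have hav := hprod a ha h2 ht
    have e : ⟪toL2 (a * h), toL2 Φ.v⟫ = ⟪toL2 (a * Φ.v), toL2 h⟫ := by
      rw [inner_toL2 hah kv, inner_toL2 hav.1 hh]
      refine integral_congr_ae (ae_of_all _ fun x => ?_)
      simp only [Pi.mul_apply]
      ring
    rw [e]
    exact (abs_real_inner_le_norm _ _).trans
      (mul_le_mul hav.2 hhd (norm_nonneg _) hav.nonneg)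
  have m1 : MemLp (Φ.v * Φ.w) 2 volume :=
    (L2Le.mul_left ⟨kw, hw⟩ kv.1 hb.nonneg hb.v_top).1
  have m2 : ∀ i, MemLp (weakPartial i Φ.ψ * weakPartial i Φ.v) 2 volume := fun i =>
    ((L2Le_weakPartial mv hv i).mul_left (hΦ.1.memLp i).1 hb.nonneg (hb.grad_ψ_top i)).1
  have m3 : MemLp (∑ i, weakPartial i Φ.ψ * weakPartial i Φ.v) 2 volume :=
    memLp_finsetSum' _ fun i _ => m2 i
  rw [source_eq, toL2_add (m1.const_smul _) (m3.const_smul _), toL2_smul m1, toL2_smul m3,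
    toL2_sum fun i _ => m2 i, inner_add_left, real_inner_smul_left, real_inner_smul_left,
    sum_inner]
  have b1 := hin Φ.v Φ.w kv.1 kw hw hb.v_two hb.v_top
  have b2 : |∑ i, ⟪toL2 (weakPartial i Φ.ψ * weakPartial i Φ.v), toL2 Φ.v⟫|
      ≤ n * (Λ * (C * (n * d)) * d) := by
    refine (Finset.abs_sum_le_sum_abs _ _).trans ((Finset.sum_le_sum fun i _ =>
      hin _ _ (hΦ.1.memLp i).1 (mv.memLp i) (L2Le_weakPartial mv hv i).2 (hb.grad_ψ_two i)
        (hb.grad_ψ_top i)).trans (le_of_eq ?_))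
    simp
  refine (abs_add_le _ _).trans ?_
  rw [abs_mul, abs_mul, abs_mul, abs_two]
  have b3 := mul_le_mul_of_nonneg_left b1 (by positivity : 0 ≤ 2 * |k|)
  nlinarith [b2, b3]

theorem exists_sourceWork_le (hn : 3 ≤ n) (hτ : 0 < τ) (k : ℝ) : ∃ C : ℝ, 0 < C ∧
    ∀ (c : ℝ) (g : ℝ → ℝ) (Φ : State n) (Λ : ℝ), IsMemoryKernel c g → MemPhase g 2 Φ →
      IsBoundedState Λ Φ →
      IsEnergyTrajectory.sourceWork (toL2 Φ.v + τ • toL2 Φ.w) (lapL2 Φ.v + τ • lapL2 Φ.w)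
        (lapL2 Φ.ψ + τ • lapL2 Φ.v) (lapL2 Φ.v) (toL2 Φ.w) (toL2 (source k Φ))
      ≤ C * Λ * stateDissipation τ g Φ := by
  obtain ⟨C₀, hC₀⟩ := HasL2Grad.exists_eLpNorm_le hn
  set R : ℝ := 1 + τ + 2 / τ with hR
  have hR1 : 1 ≤ R := by
    have : 0 < 2 / τ := by positivity
    linarith
  set K : ℝ := 2 * |k| + 2 * n with hK
  have hK0 : 0 ≤ K := by positivity
  refine ⟨K * (C₀ * n) + τ * K + n * (2 * K * R) + 3 * K + 1, by positivity,
    fun c g Φ Λ hg hΦ hb => ?_⟩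
  have n1 := histNormSq_nonneg hg gradL2 Φ.η
  have n2 := histNormSq_nonneg hg lapL2 Φ.η
  set D := stateDissipation τ g Φ with hD
  have hD0 : 0 ≤ D := stateDissipation_nonneg hg
  set d := √D with hdd
  have hd2 : d ^ 2 = D := Real.sq_sqrt hD0
  have hd0 : 0 ≤ d := Real.sqrt_nonneg _
  have hDe : D = ‖gradL2 Φ.v‖ ^ 2 + histNormSq g gradL2 Φ.η + ‖lapL2 Φ.ψ + τ • lapL2 Φ.v‖ ^ 2
      + ‖gradL2 Φ.v + τ • gradL2 Φ.w‖ ^ 2 + ‖lapL2 Φ.v‖ ^ 2 + histNormSq g lapL2 Φ.η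
      + ‖toL2 Φ.w‖ ^ 2 := rfl
  have le_d : ∀ x : ℝ, x ^ 2 ≤ D → x ≤ d := fun x hx => Real.le_sqrt_of_sq_le hx
  have q1 := sq_nonneg (‖gradL2 Φ.v‖)
  have q2 := sq_nonneg (‖lapL2 Φ.ψ + τ • lapL2 Φ.v‖)
  have q3 := sq_nonneg (‖gradL2 Φ.v + τ • gradL2 Φ.w‖)
  have q4 := sq_nonneg (‖lapL2 Φ.v‖)
  have q5 := sq_nonneg (‖toL2 Φ.w‖)
  have hgv : ‖gradL2 Φ.v‖ ≤ d := le_d _ (by linarith)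
  have hlu : ‖lapL2 Φ.ψ + τ • lapL2 Φ.v‖ ≤ d := le_d _ (by linarith)
  have hgz : ‖gradL2 Φ.v + τ • gradL2 Φ.w‖ ≤ d := le_d _ (by linarith)
  have hlv : ‖lapL2 Φ.v‖ ≤ d := le_d _ (by linarith)
  have hw : ‖toL2 Φ.w‖ ≤ d := le_d _ (by linarith)
  have hRd : d ≤ R * d := le_mul_of_one_le_left hd0 hR1
  have hlψ : ‖lapL2 Φ.ψ‖ ≤ R * d := by
    have h1 := norm_sub_le (lapL2 Φ.ψ + τ • lapL2 Φ.v) (τ • lapL2 Φ.v)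
    rw [add_sub_cancel_right, norm_smul, Real.norm_of_nonneg hτ.le] at h1
    have h2 := mul_le_mul_of_nonneg_left hlv hτ.le
    have h3 : 0 ≤ 2 / τ * d := by positivity
    rw [hR]
    linarith
  have hgw : ‖gradL2 Φ.w‖ ≤ R * d := by
    have h1 := norm_sub_le (gradL2 Φ.v + τ • gradL2 Φ.w) (gradL2 Φ.v)
    rw [add_sub_cancel_left, norm_smul, Real.norm_of_nonneg hτ.le] at h1
    have h2 : ‖gradL2 Φ.w‖ ≤ 2 / τ * d := by
      rw [div_mul_eq_mul_div, le_div_iff₀' hτ]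
      linarith
    have h3 : 0 ≤ τ * d := by positivity
    rw [hR]
    linarith
  have mv : GradMemH 1 Φ.v := GradMemH.mono (j := 2) (by norm_num) hΦ.2.1.2
  have mw : GradMemH 1 Φ.w := hΦ.2.2.1.2
  have hF := L2Le_source hΦ hb hgv hw k
  have hG := fun i => grad_source hΦ hb (hgv.trans hRd) hgw hlψ (hlv.trans hRd) k i
  choose F hF1 hF2 using hG
  have hFg : GradMemH 0 (source k Φ) := fun i =>
    ⟨⟨F i, hF1 i⟩, ((hF2 i).congr (hF1 i).weakPartial_ae_eq.symm).1⟩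
  have hin : ∀ a : L2 n, ‖a‖ ≤ d → |⟪toL2 (source k Φ), a⟫| ≤ K * (Λ * d) * d := fun a ha =>
    (abs_real_inner_le_norm _ _).trans (mul_le_mul hF.2 ha (norm_nonneg _) hF.nonneg)
  have s1 : |⟪toL2 (source k Φ), toL2 Φ.v + τ • toL2 Φ.w⟫|
      ≤ K * (C₀ * n) * (Λ * d ^ 2) + τ * (K * (Λ * d) * d) := by
    rw [inner_add_right, real_inner_smul_right]
    refine (abs_add_le _ _).trans (add_le_add
      (abs_inner_source_v_le hn hC₀ hΦ hb hgv hw k) ?_)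
    rw [abs_mul, abs_of_pos hτ]
    exact mul_le_mul_of_nonneg_left (hin _ hw) hτ.le
  have s2 : |⟪toL2 (source k Φ), lapL2 Φ.v + τ • lapL2 Φ.w⟫|
      ≤ n * (d * ((4 * |k| + 4 * n) * (Λ * (R * d)))) := by
    rw [← lapL2_add_smul mv mw, real_inner_comm, ← abs_neg,
      ← inner_gradL2 (mv.add_smul mw τ) hFg hF.1, gradL2_add_smul mv mw]
    have h1 : ⟪gradL2 Φ.v + τ • gradL2 Φ.w, gradL2 (source k Φ)⟫
        = ∑ i, ⟪(gradL2 Φ.v + τ • gradL2 Φ.w) i, toL2 (weakPartial i (source k Φ))⟫ :=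
      PiLp.inner_apply _ _
    rw [h1]
    refine (Finset.abs_sum_le_sum_abs _ _).trans ((Finset.sum_le_sum (g := fun _ : Fin n =>
      d * ((4 * |k| + 4 * n) * (Λ * (R * d)))) fun i _ => ?_).trans (le_of_eq ?_))
    · have h2 := (hF2 i).congr (hF1 i).weakPartial_ae_eq.symm
      exact (abs_real_inner_le_norm _ _).trans (mul_le_mul ((PiLp.norm_apply_le _ i).trans hgz) h2.2
        (norm_nonneg _) hd0)
    · simp
  have s3 := hin _ hlu
  have s4 := hin _ hlv
  have s5 := hin _ hw
  have h0 : 0 ≤ Λ * d ^ 2 := mul_nonneg hb.nonneg (sq_nonneg d)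
  simp only [IsEnergyTrajectory.sourceWork]
  rw [← hd2]
  have e2 : (n : ℝ) * (d * ((4 * |k| + 4 * n) * (Λ * (R * d)))) = n * (2 * K * R) * (Λ * d ^ 2) := by
    rw [hK]; ring
  rw [e2] at s2
  linarith

end Source

end JMGT
end

noncomputable section

namespace JMGT

local notation "⟪" x ", " y "⟫" => inner ℝ x y

variable {n : ℕ}

/-! ### The energy estimate for solutions -/

theorem continuousOn_toL2_mul {S : Set ℝ} {Λ : ℝ} (hΛ : 0 ≤ Λ) {a h : ℝ → Rn n → ℝ}
    (ha : ∀ t, MemLp (a t) 2 volume) (hh : ∀ t, MemLp (h t) 2 volume)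
    (hat : ∀ t ∈ S, eLpNorm (a t) ⊤ volume ≤ ENNReal.ofReal Λ)
    (hht : ∀ t ∈ S, eLpNorm (h t) ⊤ volume ≤ ENNReal.ofReal Λ)
    (hac : Continuous fun t => toL2 (a t)) (hhc : Continuous fun t => toL2 (h t)) :
    ContinuousOn (fun t => toL2 (a t * h t)) S := by
  intro t₀ ht₀
  have h1 : Tendsto (fun t => Λ * ‖toL2 (h t) - toL2 (h t₀)‖ + Λ * ‖toL2 (a t) - toL2 (a t₀)‖)
      (𝓝[S] t₀) (𝓝 0) := by
    have c1 : Continuous fun t => Λ * ‖toL2 (h t) - toL2 (h t₀)‖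
        + Λ * ‖toL2 (a t) - toL2 (a t₀)‖ := by fun_prop
    have := c1.tendsto t₀
    simp only [sub_self, norm_zero, mul_zero, add_zero] at this
    exact this.mono_left nhdsWithin_le_nhds
  rw [ContinuousWithinAt, tendsto_iff_norm_sub_tendsto_zero]
  refine squeeze_zero' (Eventually.of_forall fun t => norm_nonneg _) ?_ h1
  filter_upwards [self_mem_nhdsWithin] with t ht
  have e1 : L2Le (h t - h t₀) ‖toL2 (h t) - toL2 (h t₀)‖ :=
    ⟨(hh t).sub (hh t₀), by rw [toL2_sub (hh t) (hh t₀)]⟩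
  have e2 : L2Le (a t - a t₀) ‖toL2 (a t) - toL2 (a t₀)‖ :=
    ⟨(ha t).sub (ha t₀), by rw [toL2_sub (ha t) (ha t₀)]⟩
  have m : ∀ t ∈ S, MemLp (a t * h t) 2 volume := fun t ht =>
    (L2Le.mul_left ⟨hh t, le_rfl⟩ (ha t).1 hΛ (hat t ht)).1
  have e3 := (e1.mul_left (ha t).1 hΛ (hat t ht)).add (e2.mul_left (hh t₀).1 hΛ (hht t₀ ht₀))
  have e4 : a t * (h t - h t₀) + h t₀ * (a t - a t₀) = a t * h t - a t₀ * h t₀ := by ring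
  rw [e4, L2Le, toL2_sub (m t ht) (m t₀ ht₀)] at e3
  exact e3.2

theorem ae_eq_zero_of_toL2 {f : Rn n → ℝ} (hf : MemLp f 2 volume) (h : toL2 f = 0) :
    f =ᵐ[volume] 0 := by
  have h1 := toL2_coeFn hf
  rw [h] at h1
  exact h1.symm.trans (Lp.coeFn_zero _ _ _)

theorem source_ae_eq_zero {g : ℝ → ℝ} {Φ : State n} (hΦ : MemPhase g 2 Φ) (hw : toL2 Φ.w = 0)
    (hv : gradL2 Φ.v = 0) (k : ℝ) : source k Φ =ᵐ[volume] 0 := by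
  have mv : GradMemH 2 Φ.v := hΦ.2.1.2
  have h1 := ae_eq_zero_of_toL2 hΦ.2.2.1.1 hw
  have h2 : ∀ᵐ x, ∀ i, weakPartial i Φ.v x = 0 := ae_all_iff.2 fun i =>
    ae_eq_zero_of_toL2 (mv.memLp i) (congrArg (fun a : L2Vec n => a i) hv)
  rw [source_eq]
  filter_upwards [h1, h2] with x hx1 hx2
  simp [hx1, hx2]

theorem isBoundedState_of_Lam {g : ℝ → ℝ} (hn : 2 ≤ n) {Ψ : ℝ → State n} {T : ℝ}
    (hΛ : Lam Ψ T ≠ ⊤) {t : ℝ} (ht : t ∈ Icc 0 T) (hΦ : MemPhase g 2 (Ψ t)) :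
    IsBoundedState (Lam Ψ T).toReal (Ψ t) := by
  have hs : (0 : ℝ) ≤ ((n : ℝ) - 2) / 2 := by
    have : (2 : ℝ) ≤ n := by exact_mod_cast hn
    linarith
  have h := le_iSup₂ (f := fun σ (_ : σ ∈ Icc 0 T) =>
      ((eLpNorm (Ψ σ).v ⊤ volume + eLpNorm (weakGrad (Ψ σ).v) ⊤ volume)
      + eLpNorm (Ψ σ).w ⊤ volume
      + eLpNorm (weakGrad (Ψ σ).ψ) ⊤ volume
      + gradNormHs (((n : ℝ) - 2) / 2) (Ψ σ).ψ
      + hessNormHs (((n : ℝ) - 2) / 2) (Ψ σ).ψ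
      + normHs (((n : ℝ) - 2) / 2) (Ψ σ).v
      + gradNormHs (((n : ℝ) - 2) / 2) (Ψ σ).v
      + normHs (((n : ℝ) - 2) / 2) (Ψ σ).w)) t ht
  change _ ≤ Lam Ψ T at h
  rw [← ENNReal.ofReal_toReal hΛ] at h
  obtain ⟨h, -⟩ := (⟨le_self_add.trans h, le_add_self.trans h⟩ : _ ∧ _)
  obtain ⟨h, -⟩ := (⟨le_self_add.trans h, le_add_self.trans h⟩ : _ ∧ _)
  obtain ⟨h, h7⟩ := (⟨le_self_add.trans h, le_add_self.trans h⟩ : _ ∧ _)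
  obtain ⟨h, -⟩ := (⟨le_self_add.trans h, le_add_self.trans h⟩ : _ ∧ _)
  obtain ⟨h, h5⟩ := (⟨le_self_add.trans h, le_add_self.trans h⟩ : _ ∧ _)
  obtain ⟨h, h4⟩ := (⟨le_self_add.trans h, le_add_self.trans h⟩ : _ ∧ _)
  obtain ⟨h, h3⟩ := (⟨le_self_add.trans h, le_add_self.trans h⟩ : _ ∧ _)
  obtain ⟨h1, h2⟩ := (⟨le_self_add.trans h, le_add_self.trans h⟩ : _ ∧ _)
  exact
    { nonneg := ENNReal.toReal_nonneg
      v_top := h1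
      w_top := h3
      v_two := (eLpNorm_two_le_normHs hs hΦ.2.1.1).trans h7
      grad_v_top := fun i => (eLpNorm_weakPartial_top_le _ i).trans h2
      grad_ψ_top := fun i => (eLpNorm_weakPartial_top_le _ i).trans h4
      grad_ψ_two := fun i => (eLpNorm_weakPartial_le_gradNormHs hs i (hΦ.1.memLp i)).trans h5 }

theorem continuous_toL2_weakPartial {p : ℝ → Rn n → ℝ} (h : Continuous fun t => gradL2 (p t))
    (i : Fin n) : Continuous fun t => toL2 (weakPartial i (p t)) := by
  have h' := (PiLp.continuous_apply 2 (fun _ : Fin n => L2 n) i).comp h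
  exact h'

theorem toL2_source {k : ℝ} {Φ : State n} (m1 : MemLp (Φ.v * Φ.w) 2 volume)
    (m2 : ∀ i, MemLp (weakPartial i Φ.ψ * weakPartial i Φ.v) 2 volume) :
    toL2 (source k Φ) = (2 * k) • toL2 (Φ.v * Φ.w)
      + (2 : ℝ) • ∑ i, toL2 (weakPartial i Φ.ψ * weakPartial i Φ.v) := by
  have m3 : MemLp (∑ i, weakPartial i Φ.ψ * weakPartial i Φ.v) 2 volume :=
    memLp_finsetSum' _ fun i _ => m2 i
  rw [source_eq, toL2_add (m1.const_smul _) (m3.const_smul _), toL2_smul m1, toL2_smul m3,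
    toL2_sum fun i _ => m2 i]

namespace IsExtendedSolution

variable {τ b c k T ζ Λ : ℝ} {g : ℝ → ℝ} {Ψ : ℝ → State n}

theorem continuousOn_toL2_source (X : IsExtendedSolution τ b c k g T Ψ)
    (hb : ∀ t ∈ Icc 0 T, IsBoundedState Λ (Ψ t)) (hΛ : 0 ≤ Λ) :
    ContinuousOn (fun t => toL2 (source k (Ψ t))) (Icc 0 T) := by
  have h1 := continuousOn_toL2_mul hΛ X.memLp_v X.memLp_w (fun t ht => (hb t ht).v_top)
    (fun t ht => (hb t ht).w_top) X.continuous_toL2_v X.continuous_toL2_w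
  have h2 : ∀ i, ContinuousOn
      (fun t => toL2 (weakPartial i (Ψ t).ψ * weakPartial i (Ψ t).v)) (Icc 0 T) := fun i =>
    continuousOn_toL2_mul (a := fun t => weakPartial i (Ψ t).ψ)
      (h := fun t => weakPartial i (Ψ t).v) hΛ (fun t => (X.gradMemH_ψ t).memLp i)
      (fun t => (X.gradMemH_v t).memLp i) (fun t ht => (hb t ht).grad_ψ_top i)
      (fun t ht => (hb t ht).grad_v_top i)
      (continuous_toL2_weakPartial (X.continuous_operator_ψ isWeakOperator_gradL2) i)
      (continuous_toL2_weakPartial (X.continuous_operator_v isWeakOperator_gradL2) i)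
  have h3 := continuousOn_finsetSum Finset.univ fun i _ => h2 i
  refine ((h1.const_smul (2 * k)).add (h3.const_smul (2 : ℝ))).congr fun t ht => ?_
  have m1 : MemLp ((Ψ t).v * (Ψ t).w) 2 volume :=
    (L2Le.mul_left ⟨X.memLp_w t, le_rfl⟩ (X.memLp_v t).1 hΛ (hb t ht).v_top).1
  have m2 : ∀ i, MemLp (weakPartial i (Ψ t).ψ * weakPartial i (Ψ t).v) 2 volume := fun i =>
    (L2Le.mul_left ⟨(X.gradMemH_v t).memLp i, le_rfl⟩ ((X.gradMemH_ψ t).memLp i).1 hΛ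
      ((hb t ht).grad_ψ_top i)).1
  exact toL2_source m1 m2

theorem stateDissipation_eq_zero (X : IsExtendedSolution τ b c k g T Ψ) (hg : IsMemoryKernel c g)
    (hT : 0 < T) (h : dissipationSq τ g Ψ T = 0) :
    ∀ t ∈ Icc 0 T, stateDissipation τ g (Ψ t) = 0 := by
  intro t ht
  rw [X.dissipationSq_eq hg hT.le, ENNReal.ofReal_eq_zero] at h
  by_contra hne
  have hpos : 0 < stateDissipation τ g (Ψ t) := (stateDissipation_nonneg hg).lt_of_ne (Ne.symm hne)
  exact absurd h (not_le.2 (intervalIntegral.integral_pos hT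
    (X.continuous_stateDissipation hg).continuousOn (fun σ _ => stateDissipation_nonneg hg)
    ⟨t, ht, hpos⟩))

theorem energySq_add_dissipationSq_le (X : IsExtendedSolution τ b c k g T Ψ)
    (hg : IsMemoryKernel c g) (hT : 0 ≤ T) {B : ℝ} (h : ∀ t ∈ Icc 0 T,
      stateEnergy τ g (Ψ t) + ∫ σ in (0 : ℝ)..t, stateDissipation τ g (Ψ σ) ≤ B) :
    energySq τ g Ψ T + dissipationSq τ g Ψ T ≤ ENNReal.ofReal (2 * B) := by
  have h0 : ∀ t ∈ Icc 0 T, 0 ≤ ∫ σ in (0 : ℝ)..t, stateDissipation τ g (Ψ σ) := fun t ht =>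
    intervalIntegral.integral_nonneg ht.1 fun σ _ => stateDissipation_nonneg hg
  have hB : 0 ≤ B :=
    (add_nonneg (stateEnergy_nonneg hg) (h0 0 ⟨le_rfl, hT⟩)).trans (h 0 ⟨le_rfl, hT⟩)
  rw [two_mul, ENNReal.ofReal_add hB hB]
  refine add_le_add (iSup₂_le fun t ht => ?_) ?_
  · rw [(X.mem_all t).energyDensity_eq hg]
    exact ENNReal.ofReal_le_ofReal (by linarith [h t ht, h0 t ht])
  · rw [X.dissipationSq_eq hg hT]
    have := h T ⟨hT, le_rfl⟩
    exact ENNReal.ofReal_le_ofReal (by linarith [stateEnergy_nonneg (τ := τ) (Φ := Ψ T) hg])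

theorem exists_estimate (hn : 3 ≤ n) (hτ : 0 < τ) (hg : IsMemoryKernel c g) (hb : τ * c ^ 2 < b)
    (k : ℝ) : ∃ C : ℝ, 1 ≤ C ∧ ∀ (T : ℝ) (Ψ : ℝ → State n), 0 < T →
      IsExtendedSolution τ b c k g T Ψ →
      energySq τ g Ψ T + dissipationSq τ g Ψ T ≤ ENNReal.ofReal C *
        (energyDensity τ g (Ψ 0) + Lam Ψ T * dissipationSq τ g Ψ T) := by
  obtain ⟨ζ, hζ, hd⟩ := hg.decay
  have hκ : 0 < cgSq c g := sub_pos.2 hg.integral_lt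
  have hβ : τ * (∫ s in Ioi 0, g s) < b - τ * cgSq c g := by
    rw [cgSq]
    linarith
  obtain ⟨C₁, hC₁, H⟩ := IsEnergyTrajectory.exists_energy_estimate hτ hκ hg.integral_pos hζ hβ
    (L2 n) (L2Vec n)
  obtain ⟨C₂, hC₂, hS⟩ := exists_sourceWork_le hn hτ k
  refine ⟨1 + 2 * C₁ * (1 + C₂), by nlinarith [mul_pos hC₁ hC₂], fun T Ψ hT X => ?_⟩
  have hE0 : 0 ≤ stateEnergy τ g (Ψ 0) := stateEnergy_nonneg hg
  have hD0 : ∀ t ∈ Icc 0 T, 0 ≤ ∫ σ in (0 : ℝ)..t, stateDissipation τ g (Ψ σ) := fun t ht =>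
    intervalIntegral.integral_nonneg ht.1 fun σ _ => stateDissipation_nonneg hg
  set I := ∫ σ in (0 : ℝ)..T, stateDissipation τ g (Ψ σ) with hI
  have hI0 : 0 ≤ I := hD0 T ⟨hT.le, le_rfl⟩
  have hIt : ∀ t ∈ Icc 0 T, ∫ σ in (0 : ℝ)..t, stateDissipation τ g (Ψ σ) ≤ I := fun t ht =>
    intervalIntegral.integral_mono_interval le_rfl ht.1 ht.2
      (ae_of_all _ fun σ => stateDissipation_nonneg hg)
      ((X.continuous_stateDissipation hg).intervalIntegrable _ _)
  have key : ∀ lam : ℝ, 0 ≤ lam → ∀ f : ℝ → L2 n, Continuous f →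
      (∀ t ∈ Icc 0 T, ∀ φ, IsTestFunction φ → ∫ x, source k (Ψ t) x * φ x = ⟪f t, toL2 φ⟫) →
      (∀ t ∈ Ico 0 T, IsEnergyTrajectory.sourceWork (toL2 (Ψ t).v + τ • toL2 (Ψ t).w)
        (lapL2 (Ψ t).v + τ • lapL2 (Ψ t).w) (lapL2 (Ψ t).ψ + τ • lapL2 (Ψ t).v) (lapL2 (Ψ t).v)
        (toL2 (Ψ t).w) (f t) ≤ lam * stateDissipation τ g (Ψ t)) →
      energySq τ g Ψ T + dissipationSq τ g Ψ T
        ≤ ENNReal.ofReal (2 * (C₁ * (stateEnergy τ g (Ψ 0) + lam * I))) := by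
    intro lam hlam f hf hfF hW
    refine X.energySq_add_dissipationSq_le hg hT.le fun t ht => ?_
    refine (H T lam _ _ _ _ _ _ _ _ _ _ f _ _ _ _
      (X.isEnergyTrajectory hg hτ hζ hd hf hfF) hlam hW t ht).trans ?_
    refine mul_le_mul_of_nonneg_left (add_le_add le_rfl ?_) hC₁.le
    exact mul_le_mul_of_nonneg_left (hIt t ht) hlam
  have hfin : ∀ Λ : ℝ, 0 ≤ Λ → ENNReal.ofReal Λ ≤ Lam Ψ T →
      ENNReal.ofReal (2 * (C₁ * (stateEnergy τ g (Ψ 0) + C₂ * Λ * I)))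
      ≤ ENNReal.ofReal (1 + 2 * C₁ * (1 + C₂)) *
        (energyDensity τ g (Ψ 0) + Lam Ψ T * dissipationSq τ g Ψ T) := by
    intro Λ hΛ hle
    refine le_trans ?_ (mul_le_mul_right (add_le_add le_rfl (mul_le_mul_left hle _)) _)
    rw [(X.mem_all 0).energyDensity_eq hg, X.dissipationSq_eq hg hT.le, ← ENNReal.ofReal_mul hΛ,
      ← ENNReal.ofReal_add hE0 (by positivity), ← ENNReal.ofReal_mul (by positivity)]
    refine ENNReal.ofReal_le_ofReal ?_
    have h1 := mul_nonneg hΛ hI0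
    nlinarith [mul_nonneg hC₁.le hE0, mul_nonneg hC₁.le h1, mul_nonneg (mul_pos hC₁ hC₂).le hE0,
      mul_nonneg (mul_pos hC₁ hC₂).le h1]
  by_cases hΛ : Lam Ψ T = ⊤
  · by_cases hD : dissipationSq τ g Ψ T = 0
    · have hz := X.stateDissipation_eq_zero hg hT hD
      refine (key 0 le_rfl (fun _ => 0) continuous_const (fun t ht φ hφ => ?_) fun t ht => ?_).trans
        ?_
      · have h1 := hz t ht
        have n1 := histNormSq_nonneg hg gradL2 (Ψ t).η
        have n2 := histNormSq_nonneg hg lapL2 (Ψ t).η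
        simp only [stateDissipation, IsEnergyTrajectory.dissipation] at h1
        have q1 := sq_nonneg (‖gradL2 (Ψ t).v‖)
        have q2 := sq_nonneg (‖lapL2 (Ψ t).ψ + τ • lapL2 (Ψ t).v‖)
        have q3 := sq_nonneg (‖gradL2 (Ψ t).v + τ • gradL2 (Ψ t).w‖)
        have q4 := sq_nonneg (‖lapL2 (Ψ t).v‖)
        have q5 := sq_nonneg (‖toL2 (Ψ t).w‖)
        have r1 : ‖gradL2 (Ψ t).v‖ ^ 2 = 0 := by linarith
        have r2 : ‖toL2 (Ψ t).w‖ ^ 2 = 0 := by linarith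
        have h2 := source_ae_eq_zero (X.mem_all t) (norm_eq_zero.1 (pow_eq_zero_iff two_ne_zero |>.1 r2))
          (norm_eq_zero.1 (pow_eq_zero_iff two_ne_zero |>.1 r1)) k
        rw [inner_zero_left]
        refine integral_eq_zero_of_ae ?_
        filter_upwards [h2] with x hx
        simp only [hx, Pi.zero_apply, zero_mul]
      · simp [IsEnergyTrajectory.sourceWork]
      · have := hfin 0 le_rfl (by simp)
        simpa using this
    · rw [hΛ, ENNReal.top_mul hD, add_top, ENNReal.mul_top]
      · exact le_top
      · rw [ne_eq, ENNReal.ofReal_eq_zero, not_le]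
        positivity
  · set Λ := (Lam Ψ T).toReal with hΛr
    have hΛ0 : 0 ≤ Λ := ENNReal.toReal_nonneg
    have hbd : ∀ t ∈ Icc 0 T, IsBoundedState Λ (Ψ t) := fun t ht =>
      isBoundedState_of_Lam (by omega) hΛ ht (X.mem_all t)
    have hm : ∀ t, max 0 (min t T) ∈ Icc 0 T := fun t =>
      ⟨le_max_left _ _, max_le hT.le (min_le_right _ _)⟩
    have hid : ∀ t ∈ Icc 0 T, max 0 (min t T) = t := fun t ht => by
      rw [min_eq_left ht.2, max_eq_right ht.1]
    refine (key (C₂ * Λ) (by positivity) (fun t => toL2 (source k (Ψ (max 0 (min t T))))) ?_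
      (fun t ht φ hφ => ?_) fun t ht => ?_).trans (hfin Λ hΛ0 (ENNReal.ofReal_toReal hΛ).le)
    · exact (X.continuousOn_toL2_source hbd hΛ0).comp_continuous
        (continuous_const.max (continuous_id.min continuous_const)) hm
    · simp only [hid t ht]
      rw [inner_toL2 (L2Le_source (X.mem_all t) (hbd t ht) (le_max_left _ _) (le_max_right _ _) k).1
        (hφ.memLp 2)]
    · have ht' : t ∈ Icc 0 T := ⟨ht.1, ht.2.le⟩
      simp only [hid t ht']
      exact hS c g (Ψ t) Λ hg (X.mem_all t) (hbd t ht')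

end IsExtendedSolution

end JMGT
end

theorem mainTheorem6 (n : ℕ) (hn : 3 ≤ n) (τ b c k : ℝ) (g : ℝ → ℝ)
    (hτ : 0 < τ) (hc : 0 < c) (hg : JMGT.IsMemoryKernel c g)
    (hb : τ * c ^ 2 < b) (hcg : τ * JMGT.cgSq c g < τ * c ^ 2) :
    ∃ C : ℝ, 0 < C ∧
      ∀ (m : ℕ) (_ : (n : ℝ) / 2 + 1 < m) (T : ℝ) (_ : 0 < T) (Ψ : ℝ → JMGT.State n)
        (_ : JMGT.IsSolution τ b c k g (m - 1) T Ψ),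
        ∀ t ∈ Set.Icc 0 T,
          JMGT.energySq τ g Ψ t + JMGT.dissipationSq τ g Ψ t ≤
            ENNReal.ofReal C *
              (JMGT.energySq τ g Ψ 0 + JMGT.Lam Ψ t * JMGT.dissipationSq τ g Ψ t) := by
  obtain ⟨C, hC, H⟩ := JMGT.IsExtendedSolution.exists_estimate hn hτ hg hb k
  refine ⟨C, by linarith, fun m hm T hT Ψ h t ht => ?_⟩
  have h2 : 2 ≤ m - 1 := by
    have h3 : (3 : ℝ) ≤ n := by exact_mod_cast hn
    have h4 : (2 : ℝ) < m := by linarith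
    have h5 : 2 < m := by exact_mod_cast h4
    omega
  rcases ht.1.eq_or_lt with h0 | h0
  · subst h0
    have hD : JMGT.dissipationSq τ g Ψ 0 = 0 := by
      rw [JMGT.dissipationSq, Icc_self, Measure.restrict_singleton]
      simp
    simp only [hD, mul_zero, add_zero]
    refine le_mul_of_one_le_left zero_le ?_
    rw [← ENNReal.ofReal_one]
    exact ENNReal.ofReal_le_ofReal hC
  have hid : ∀ s ∈ Icc 0 t, max 0 (min s t) = s := fun s hs => by
    rw [min_eq_left hs.2, max_eq_right hs.1]
  have key := H t _ h0 ((h.mono h2).extend h0.le ht.2)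
  have e0 : JMGT.energySq τ g Ψ 0 = JMGT.energyDensity τ g (Ψ 0) := by
    simp [JMGT.energySq]
  have e1 : JMGT.energySq τ g (fun s => Ψ (max 0 (min s t))) t = JMGT.energySq τ g Ψ t :=
    biSup_congr fun s hs => by simp only [hid s hs]
  have e2 : JMGT.dissipationSq τ g (fun s => Ψ (max 0 (min s t))) t
      = JMGT.dissipationSq τ g Ψ t :=
    setLIntegral_congr_fun measurableSet_Icc fun s hs => by simp only [hid s hs]
  have e3 : JMGT.Lam (fun s => Ψ (max 0 (min s t))) t = JMGT.Lam Ψ t :=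
    biSup_congr fun s hs => by simp only [hid s hs]
  rw [e1, e2, e3, hid 0 ⟨le_rfl, h0.le⟩, ← e0] at key
  exact key
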